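/- \textbf{Definitions.} Let $S=(\Sigma,Q,\Delta,q_0)$ be a collapsible pushdown system of level 2: $\Sigma\ni\bot$ and $Q$ are finite, $q_0\in Q$, and $\Delta\subseteq Q\times\Sigma\times Q\times \mathrm{Op}$, where $\mathrm{Op}$ consists of $\mathrm{Push}_{\sigma,k}$ ($\sigma\in\Sigma\setminus\{\bot\}$, $k\in\{1,2\}$), $\mathrm{Clone}_2$, $\mathrm{Pop}_1$, $\mathrm{Pop}_2$, $\mathrm{Collapse}$. These act partially on lists $s=w_1:\dots:w_n$ of nonempty words over $\Sigma\times\{1,2\}\times\mathbb N$: $\mathrm{Push}_{\sigma,1}$ appends $(\sigma,1,|w_n|)$ to $w_n$; $\mathrm{Push}_{\sigma,2}$ appends $(\sigma,2,n-1)$ to $w_n$; $\mathrm{Clone}_2$ appends a copy of $w_n$ to the list; $\mathrm{Pop}_1$ removes the last letter of $w_n$ (if $|w_n|\ge 2$); $\mathrm{Pop}_2$ removes $w_n$ (if $n\ge2$); if the last letter of $w_n$ is $(\sigma,1,k)$, then $\mathrm{Collapse}$ is $\mathrm{Pop}_1$, and if it is $(\sigma,2,r)$ with $r>0$, then $\mathrm{Collapse}$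 yields $w_1:\dots:w_r$. Otherwise $\mathrm{Pop}_k$ and $\mathrm{Collapse}$ are undefined. $\mathrm{Stacks}(\Sigma)$ is the smallest set containing the initial stack $\bot_2=[(\bot,1,0)]$ and closed under all operations. For configurations, $(q,s)\to(q',t)$ if there is $(q,\sigma,q',op)\in\Delta$ such that the last letter of the last word of $s$ has symbol $\sigma$ and $op(s)=t$. A run is a finite sequence $r(0)\to r(1)\to\dots\to r(m)$. A configuration is reachable if there is a run from $(q_0,\bot_2)$ to it; the reachable configurations are the vertices of the collapsible pushdown graph (CPG) of $S$. Trees are finite labelled binary trees, i.e. functions on finite prefix-closed sets of addresses in $\{0,1\}^*$; tree automata are nondeterministic, finite and top-down. If all words of $s=w_1:\dots:w_n$ begin with the same letter, then $\mathrm{Encode}(s,\rho)$ is the following tree. Its root has label $\rho$. Its left subtree is missing if $|w_1|=1$; in this case put $j=1$. If $|w_1|\ge2$, let $w_1:\dots:w_j$ be the longest initial segment of $s$ all of whose words begin with the same two letters; if the second of these letters is $(\sigma',l',k')$, the left subtree is $\mathrm{Encode}(w_1':\dots:w_j',(\sigma',l'))$, where $w_i'$ is $w_i$ without its first letter. The right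 subtree is $\mathrm{Encode}(w_{j+1}:\dots:w_n,\varepsilon)$, with $\varepsilon$ a default label, and is missing if $j=n$. Put $\mathrm{Encode}(s)=\mathrm{Encode}(s,(\bot,1))$, and let $\mathrm{Encode}(q,s)$ be the tree whose root has label $q$, whose left subtree is $\mathrm{Encode}(s)$ and whose right subtree is missing. Let $\mathrm{Decode}$ be the inverse of $\mathrm{Encode}$ on $\mathrm{Stacks}(\Sigma)$. For a node $d\ne\varepsilon$ of $\mathrm{Encode}(q,s)$, the left stack $\mathrm{LeftStack}(d)$ is $\mathrm{Decode}$ of the restriction of $\mathrm{Encode}(q,s)$ to the nodes $d'\neq\varepsilon$ with $d'\le_{lex}d$ (a tree with root $0$). A map $f:\mathrm{dom}(\mathrm{Encode}(q,s))\setminus\{\varepsilon\}\to Q$ is a \emph{certificate} for the reachability of $(q,s)$ if there is a run $r$ from $(q_0,\bot_2)$ to $(q,s)$ such that for every $d$ in the domain of $f$ the run visits the stack $\mathrm{LeftStack}(d)$ and is in state $f(d)$ at its last visit there, i.e. $r(i)=(f(d),\mathrm{LeftStack}(d))$ for the maximal $i$ at which the stack of $r(i)$ is $\mathrm{LeftStack}(d)$.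 \textbf{Statement.} For every collapsible pushdown system $S$ of level 2: (1) There is a tree automaton $A$ such that for all $q\in Q$, all $s\in\mathrm{Stacks}(\Sigma)$ and all maps $f:\mathrm{dom}(\mathrm{Encode}(q,s))\setminus\{\varepsilon\}\to Q$, the automaton $A$ accepts the tree $\mathrm{Encode}(q,s)\otimes f$, in which each node $d\ne\varepsilon$ of $\mathrm{Encode}(q,s)$ additionally carries the label $f(d)$ (and the root carries a padding symbol), if and only if $f$ is a certificate for the reachability of $(q,s)$. (2) The set $\{\mathrm{Encode}(q,s) : (q,s)\text{ reachable}\}$ is a regular tree language, i.e. there is a tree automaton that accepts exactly these trees. -/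

import Mathlib

/-! ### Finite binary trees and tree automata

A finite labelled tree `T : D → α` with `D ⊆ {0,1}*` finite and prefix-closed is a term of
Mathlib's `BinaryTree α`: `nil` is the empty tree, `node a l r` is the tree with root label `a`,
subtree `l` at address `0` and subtree `r` at address `1`.  Addresses are lists of Booleans, with
`false` for `0` and `true` for `1`. -/

namespace CPG

/-- The label of `T` at an address (`none` outside of the domain). -/
def labelAt {α : Type*} : BinaryTree α → List Bool → Option α
  | .nil, _ => none
  | .node a _ _, [] => some a
  | .node _ l _, false :: d => labelAt l d
  | .node _ _ r, true :: d => labelAt r d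

/-- The domain `D ⊆ {0,1}*` of a tree. -/
def dom {α : Type*} (T : BinaryTree α) : Set (List Bool) :=
  {d | (labelAt T d).isSome}

/-- The restriction of a tree to the addresses satisfying `P` (for `P` closed under prefixes). -/
def restrict {α : Type*} : BinaryTree α → (P : List Bool → Prop) → [DecidablePred P] →
    BinaryTree α
  | .nil, _, _ => .nil
  | .node a l r, P, _ =>
    if P [] then
      .node a (restrict l (fun d => P (false :: d))) (restrict r (fun d => P (true :: d)))
    else .nil

/-- The tree with the same domain as `T`, and with label `(T d, g d)` at every address `d`. -/
def annotate {α β : Type*} : BinaryTree α → (List Bool → β) → BinaryTree (α × β)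
  | .nil, _ => .nil
  | .node a l r, g =>
    .node (a, g []) (annotate l (fun d => g (false :: d))) (annotate r (fun d => g (true :: d)))

/-- A nondeterministic finite top-down automaton on finite binary trees: a run labels the root by
an initial state, obeys the transition relation `(state, label, left state, right state)` at every
node, and labels every missing child (the root itself, if the tree is empty) by a final state. -/
structure TreeAutomaton (α : Type*) where
  State : Type
  finite : Finite State
  init : Set State
  trans : Set (State × α × State × State)
  final : Set State

/-- There is a labelling of the tree by states that obeys the automaton and has the given state at
the root. -/
def TreeAutomaton.AcceptsFrom {α : Type*} (A : TreeAutomaton α) : A.State → BinaryTree α → Prop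
  | p, .nil => p ∈ A.final
  | p, .node a l r =>
    ∃ p₀ p₁, (p, a, p₀, p₁) ∈ A.trans ∧ A.AcceptsFrom p₀ l ∧ A.AcceptsFrom p₁ r

def TreeAutomaton.Accepts {α : Type*} (A : TreeAutomaton α) (T : BinaryTree α) : Prop :=
  ∃ p ∈ A.init, A.AcceptsFrom p T

/-- A set of finite trees is regular if it is recognised by a tree automaton. -/
def IsRegularTreeLanguage {α : Type*} (L : Set (BinaryTree α)) : Prop :=
  ∃ A : TreeAutomaton α, ∀ T, A.Accepts T ↔ T ∈ L

/-! ### Collapsible pushdown stacks of level 2 -/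

/-- The collapse levels `1` and `2`. -/
inductive Level
  | one
  | two
  deriving DecidableEq

/-- The elements `(σ, l, k)` of `Σ × {1,2} × ℕ`. -/
abbrev Letter (Γ : Type*) := Γ × Level × ℕ

/-- A `2`-word `w₁ : w₂ : … : wₙ`; the top of the stack is at the end of the last word. -/
abbrev Stack (Γ : Type*) := List (List (Letter Γ))

/-- The operations `Push_{σ,k}` (with `σ ≠ ⊥`), `Clone₂`, `Pop₁`, `Pop₂`, `Collapse`. -/
inductive StackOp {Γ : Type*} (bot : Γ)
  | push (σ : {a : Γ // a ≠ bot}) (k : Level)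
  | clone
  | pop (k : Level)
  | collapse

/-- The initial stack `⊥₂`. -/
def initialStack {Γ : Type*} (bot : Γ) : Stack Γ := [[(bot, Level.one, 0)]]

/-- The topmost element `Top₁(s)`. -/
def top1 {Γ : Type*} (s : Stack Γ) : Option (Letter Γ) :=
  s.getLast?.bind List.getLast?

/-- The topmost symbol `Sym(s)`. -/
def topSym {Γ : Type*} (s : Stack Γ) : Option Γ :=
  (top1 s).map (fun a => a.1)

def push {Γ : Type*} (σ : Γ) (k : Level) (s : Stack Γ) : Option (Stack Γ) :=
  match s.getLast? with
  | none => none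
  | some w =>
    match k with
    | .one => some (s.dropLast ++ [w ++ [(σ, Level.one, w.length)]])
    | .two => some (s.dropLast ++ [w ++ [(σ, Level.two, s.length - 1)]])

def clone {Γ : Type*} (s : Stack Γ) : Option (Stack Γ) :=
  match s.getLast? with
  | none => none
  | some w => some (s ++ [w])

def pop1 {Γ : Type*} (s : Stack Γ) : Option (Stack Γ) :=
  match s.getLast? with
  | none => none
  | some w => if 2 ≤ w.length then some (s.dropLast ++ [w.dropLast]) else none

def pop2 {Γ : Type*} (s : Stack Γ) : Option (Stack Γ) :=
  if 2 ≤ s.length then some s.dropLast else none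

def collapse {Γ : Type*} (s : Stack Γ) : Option (Stack Γ) :=
  match top1 s with
  | none => none
  | some (_, .one, _) => pop1 s
  | some (_, .two, r) => if 0 < r then some (s.take r) else none

/-- The partial function on stacks given by an operation (`none` means undefined). -/
def StackOp.apply {Γ : Type*} {bot : Γ} : StackOp bot → Stack Γ → Option (Stack Γ)
  | .push σ k, s => CPG.push σ.1 k s
  | .clone, s => CPG.clone s
  | .pop .one, s => pop1 s
  | .pop .two, s => pop2 s
  | .collapse, s => CPG.collapse s

/-- `Stacks(Σ)`: the smallest set that contains `⊥₂` and is closed under all operations. -/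
inductive IsStack {Γ : Type*} (bot : Γ) : Stack Γ → Prop
  | init : IsStack bot (initialStack bot)
  | step {s t : Stack Γ} (op : StackOp bot) :
      IsStack bot s → op.apply s = some t → IsStack bot t

/-! ### Collapsible pushdown systems -/

/-- A collapsible pushdown system of level 2 with stack alphabet `Γ` and state set `Q` (these are
assumed finite where the notion is used). -/
structure CPS (Γ Q : Type*) where
  bot : Γ
  trans : Set (Q × Γ × Q × StackOp bot)
  init : Q

namespace CPS

variable {Γ Q : Type*}

/-- The union `⟶` of the labelled transition relations. -/
def Step (S : CPS Γ Q) (c c' : Q × Stack Γ) : Prop :=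
  ∃ (σ : Γ) (op : StackOp S.bot), (c.1, σ, c'.1, op) ∈ S.trans ∧
    topSym c.2 = some σ ∧ op.apply c.2 = some c'.2

/-- The initial configuration `(q₀, ⊥₂)`. -/
def initialConfig (S : CPS Γ Q) : Q × Stack Γ := (S.init, initialStack S.bot)

/-- `C(S)`: the configurations reachable from the initial one, i.e. the vertices of the
collapsible pushdown graph generated by `S`. -/
def reachable (S : CPS Γ Q) : Set (Q × Stack Γ) :=
  {c | Relation.ReflTransGen S.Step S.initialConfig c}

/-- A run of length `length`. -/
structure Run (S : CPS Γ Q) where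
  length : ℕ
  config : Fin (length + 1) → Q × Stack Γ
  step : ∀ i : Fin length, S.Step (config i.castSucc) (config i.succ)

end CPS

/-! ### Encoding of stacks and configurations -/

/-- The tree `Encode(s, ρ)` of a blockline `s`.  The root is labelled `ρ`.  If the first word has
length one, it is the first maximal block and has no left subtree.  Otherwise the first maximal
block consists of the leading words that begin with the same two letters `x y` as the first word;
it is stripped of its first letter and encoded in the left subtree, with the symbol and level of
`y` at its root.  The remaining words are encoded in the right subtree, with `ε` (here `none`) at
its root.  A subtree for which no words are left is missing. -/
def encodeBlockline {Γ : Type*} [DecidableEq Γ] :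
    Stack Γ → Option (Γ × Level) → BinaryTree (Option (Γ × Level))
  | [], _ => .nil
  | [] :: _, _ => .nil
  | [_] :: rest, ρ => .node ρ .nil (encodeBlockline rest none)
  | (x :: y :: v) :: rest, ρ =>
    .node ρ
      (encodeBlockline
        (((x :: y :: v) :: rest.takeWhile (fun w => decide ([x, y] <+: w))).map List.tail)
        (some (y.1, y.2.1)))
      (encodeBlockline (rest.dropWhile (fun w => decide ([x, y] <+: w))) none)
termination_by s => (s.map List.length).sum
decreasing_by
  · simp
  · have h1 : ∀ l : List (List (Letter Γ)),
        ((l.map List.tail).map List.length).sum ≤ (l.map List.length).sum := by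
      intro l
      induction l with
      | nil => simp
      | cons a l ih => simp only [List.map_cons, List.sum_cons, List.length_tail]; omega
    have h2 : ∀ p : List (Letter Γ) → Bool,
        ((rest.takeWhile p).map List.length).sum ≤ (rest.map List.length).sum := fun p =>
      ((List.takeWhile_sublist p).map List.length).sum_le_sum (by simp)
    have h3 := h1 (rest.takeWhile (fun w => decide ([x, y] <+: w)))
    have h4 := h2 (fun w => decide ([x, y] <+: w))
    simp only [List.map_cons, List.sum_cons, List.tail_cons, List.length_cons]
    omega
  · have h2 : ∀ p : List (Letter Γ) → Bool,
        ((rest.dropWhile p).map List.length).sum ≤ (rest.map List.length).sum := fun p =>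
      ((List.dropWhile_sublist p).map List.length).sum_le_sum (by simp)
    have h4 := h2 (fun w => decide ([x, y] <+: w))
    simp only [List.map_cons, List.sum_cons, List.length_cons]
    omega

/-- The labels of encodings of configurations: a state, or an element of `(Σ × {1,2}) ∪ {ε}`. -/
abbrev ConfigLabel (Γ Q : Type*) := Q ⊕ Option (Γ × Level)

namespace CPS

variable {Γ Q : Type*} [DecidableEq Γ]

/-- `Encode(s) = Encode(s, (⊥, 1))`. -/
def encodeStack (S : CPS Γ Q) (s : Stack Γ) : BinaryTree (Option (Γ × Level)) :=
  encodeBlockline s (some (S.bot, Level.one))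

/-- `Encode(q, s)`: the root is labelled `q`, its left subtree is `Encode(s)`, and it has no right
subtree. -/
def encode (S : CPS Γ Q) (c : Q × Stack Γ) : BinaryTree (ConfigLabel Γ Q) :=
  .node (Sum.inl c.1) ((S.encodeStack c.2).map Sum.inr) .nil

/-- The inverse of `Encode` on stacks. -/
noncomputable def decode (S : CPS Γ Q) (T : BinaryTree (Option (Γ × Level))) : Stack Γ :=
  Function.invFunOn S.encodeStack {s | IsStack S.bot s} T

/-- The left stack `LeftStack(d, Encode(q, s))` induced by an address `d ≠ ε` of `Encode(q, s)`: the
stack encoded by the restriction of `Encode(q, s)` to the addresses `d' ≠ ε` that are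
lexicographically at most `d`.  These are the addresses `d' = 0 e` with `e` in the domain of
`Encode(s)`; the order on `List Bool` is the lexicographic one. -/
noncomputable def leftStack (S : CPS Γ Q) (s : Stack Γ) (d : List Bool) : Stack Γ :=
  S.decode (restrict (S.encodeStack s) (fun e => false :: e ≤ d))

/-- The set `dom(Encode(q, s)) \ {ε}`. -/
abbrev Position (S : CPS Γ Q) (c : Q × Stack Γ) :=
  {d : List Bool // d ∈ dom (S.encode c) ∧ d ≠ []}

/-- `f` is a certificate for the reachability of `c = (q, s)`: there is a run from the initial
configuration to `c` such that for every `d`, at the last index at which the run visits the left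
stack induced by `d`, the state is `f d`. -/
def IsCertificate (S : CPS Γ Q) (c : Q × Stack Γ) (f : S.Position c → Q) : Prop :=
  ∃ r : S.Run, r.config 0 = S.initialConfig ∧ r.config (Fin.last r.length) = c ∧
    ∀ d : S.Position c, ∃ i : Fin (r.length + 1),
      r.config i = (f d, S.leftStack c.2 d.1) ∧
      ∀ j, i < j → (r.config j).2 ≠ S.leftStack c.2 d.1

/-- `Encode(q, s)` with the label `f d` added at every `d ≠ ε`, and the padding symbol (here
`none`) added at the root, where `f` is not defined. -/
noncomputable def encodeWith (S : CPS Γ Q) (c : Q × Stack Γ) (f : S.Position c → Q) :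
    BinaryTree (ConfigLabel Γ Q × Option Q) :=
  open Classical in
  annotate (S.encode c)
    (fun d => if h : d ∈ dom (S.encode c) ∧ d ≠ [] then some (f ⟨d, h⟩) else none)

end CPS

end CPG

/-!
The proof is an analysis of the runs of a collapsible pushdown system by *milestones*. A stack
`M = T ++ [v]` is a milestone of `s` if `s` extends `T` by a word that begins with `v` and that has
no longer prefix in common with the topmost word of `T` (`IsMilestone`). A step cannot enter the
set of stacks with milestone `M` from outside except at `M` itself (`IsMilestone.enter`), so that a
run to `s` from the initial stack visits all milestones of `s`. The left stacks of the nodes of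
`Encode(s)`, in lexicographic order of the nodes, form a chain of milestones that begins with the
initial stack and ends with `s` (`isChain_preorder`). Hence `f` is a certificate if and only if
there is a run to the initial stack in the state that `f` gives to the first node, any two
consecutive left stacks are linked, in the states given by `f`, by a run that leaves the first of
them for good at its beginning (a `Segment`), and the last of these states is `q`
(`exists_lastVisit_iff`).

Whether there is a segment from a left stack to the next one depends on little information. If the
next node is a left child, the next stack is obtained by pushing a letter, and the segment is such a
push followed by a *loop*, a run from the new stack to itself that never goes below its topmost
letter (`segment_push_iff`). If the next node is a right child, whose word is `u`, the next stack is
obtained by cloning the topmost word and removing letters from the copy until `u` remains. The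
segment then consists of the clone and the removals, separated by runs that start and end in the
same cloned word on top of the same stack (`segment_clone_iff`, `exists_run_to_prefix_iff`). Such
runs and loops involve *returns*, runs that remove the topmost word. The links of the letters of
level `2` in a cloned word point strictly below the stack under this word, and a collapse that uses
such a link cannot be part of a return. So it depends on the symbols and levels in a word alone
which pairs of states are connected by these runs. This is shown by inductive predicates `Return`
and `Loop` on words of symbols and levels, which are proved to describe runs
(`returnBase_iff_exists_run`, `loop_iff_exists_run`). The relations of a word are determined by its
last letter and the relations of the rest of the word (`returnBase_append`), so that a finite amount
of information, the `wordState`, can be updated letter by letter.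

A tree automaton that reads `Encode(q, s) ⊗ f` keeps at every node the state of the word of the
node and the state given by `f`. Since the last left stack of a left subtree precedes the right
child of the node in lexicographic order, it also guesses at every node what happens after the last
left stack of the subtree: either the run ends there, or it goes on with a segment that ends in a
copy of the word of the node, in a guessed state. Popping the letter of a left child turns such a
guess for the child into one for its parent (`derives_nodeTrans_iff`). This gives the first part.

A configuration is reachable if and only if it has a certificate, because all milestones of `s` are
visited by each run to `s` (`reachable_iff_exists_certificate`). Therefore the second part follows
by projection, once it is known that the encodings of stacks form a regular language. These are the
trees with labels of the right kind at left and at right children in which the left child of a right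
child `d1` is not labelled like the left child of `d` if the level is `1` (`ValidTree`,
`rootStack_encodeStack`, `encodeStack_rootStack`).
-/

namespace CPG

/-! ### Steps of a collapsible pushdown system, seen at the topmost word -/

section Steps

variable {Γ Q : Type*}

/-- The symbol and the level of a letter, without its link. -/
def Letter.sym (a : Letter Γ) : Γ × Level := (a.1, a.2.1)

/-- The letter created by pushing `b` onto a word of length `m` that has `n` words below it. -/
def freshLetter (b : Γ × Level) (n m : ℕ) : Letter Γ :=
  (b.1, b.2, match b.2 with | .one => m | .two => n)

@[simp] theorem sym_freshLetter (b : Γ × Level) (n m : ℕ) :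
    Letter.sym (freshLetter b n m) = b := rfl

theorem topSym_concat (T : Stack Γ) (v : List (Letter Γ)) (a : Letter Γ) :
    topSym (T ++ [v ++ [a]]) = some a.1 := by
  simp [topSym, top1]

theorem exists_of_topSym {t : Stack Γ} {σ : Γ} (h : topSym t = some σ) :
    ∃ T v a, t = T ++ [v ++ [a]] ∧ a.1 = σ := by
  rcases List.eq_nil_or_concat' t with rfl | ⟨T, w, rfl⟩
  · simp [topSym, top1] at h
  · rcases List.eq_nil_or_concat' w with rfl | ⟨v, a, rfl⟩
    · simp [topSym, top1] at h
    · refine ⟨T, v, a, by simp, ?_⟩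
      simpa [topSym, top1] using h

/-- A transition that removes the topmost letter from the topmost word, if this letter is `a`:
`Pop₁`, or `Collapse` if `a` has level `1`. -/
def PopStep (S : CPS Γ Q) (p : Q) (a : Γ × Level) (q : Q) : Prop :=
  (p, a.1, q, StackOp.pop .one) ∈ S.trans ∨
    (a.2 = .one ∧ (p, a.1, q, StackOp.collapse) ∈ S.trans)

/-- A transition that pushes `b` when the topmost symbol is `σ`. -/
def PushStep (S : CPS Γ Q) (p : Q) (σ : Γ) (b : Γ × Level) (q : Q) : Prop :=
  ∃ h : b.1 ≠ S.bot, (p, σ, q, StackOp.push ⟨b.1, h⟩ b.2) ∈ S.trans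

/-- The five kinds of steps available at a stack with topmost letter `a`. -/
inductive StepAt (S : CPS Γ Q) (T : Stack Γ) (v : List (Letter Γ)) (a : Letter Γ) (p q : Q) :
    Stack Γ → Prop
  | push (b : Γ × Level) : PushStep S p a.1 b q →
      StepAt S T v a p q (T ++ [v ++ [a] ++ [freshLetter b T.length (v.length + 1)]])
  | clone : (p, a.1, q, StackOp.clone) ∈ S.trans →
      StepAt S T v a p q (T ++ [v ++ [a]] ++ [v ++ [a]])
  | pop1 : PopStep S p (Letter.sym a) q → v ≠ [] → StepAt S T v a p q (T ++ [v])
  | pop2 : (p, a.1, q, StackOp.pop .two) ∈ S.trans → T ≠ [] → StepAt S T v a p q T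
  | collapse : (p, a.1, q, StackOp.collapse) ∈ S.trans → a.2.1 = .two → 0 < a.2.2 →
      StepAt S T v a p q ((T ++ [v ++ [a]]).take a.2.2)

theorem step_concat_iff (S : CPS Γ Q) {T : Stack Γ} {v : List (Letter Γ)} {a : Letter Γ} {p q : Q}
    {t : Stack Γ} : S.Step (p, T ++ [v ++ [a]]) (q, t) ↔ StepAt S T v a p q t := by
  constructor
  · rintro ⟨σ, op, htr, hσ, hop⟩
    rw [topSym_concat] at hσ
    obtain rfl : a.1 = σ := by simpa using hσ
    dsimp only at htr hop
    match op, htr, hop with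
    | .push b .one, htr, hop =>
      obtain rfl : _ = t := by simpa [StackOp.apply, CPG.push] using hop
      have := StepAt.push (S := S) (T := T) (v := v) (a := a) (p := p) (q := q) (b.1, .one)
        ⟨b.2, htr⟩
      simpa [freshLetter] using this
    | .push b .two, htr, hop =>
      obtain rfl : _ = t := by simpa [StackOp.apply, CPG.push] using hop
      have := StepAt.push (S := S) (T := T) (v := v) (a := a) (p := p) (q := q) (b.1, .two)
        ⟨b.2, htr⟩
      simpa [freshLetter] using this
    | .clone, htr, hop =>
      obtain rfl : _ = t := by simpa [StackOp.apply, CPG.clone] using hop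
      simpa using StepAt.clone (T := T) (v := v) htr
    | .pop .one, htr, hop =>
      by_cases hv : v = []
      · simp [hv, StackOp.apply, CPG.pop1] at hop
      · have : 1 ≤ v.length := List.length_pos_iff.2 hv
        simp only [StackOp.apply, CPG.pop1, List.getLast?_append, List.getLast?_singleton,
          Option.some_or, List.length_append, List.length_singleton, List.dropLast_concat] at hop
        rw [if_pos (by omega)] at hop
        obtain rfl : _ = t := by simpa using hop
        exact .pop1 (.inl htr) hv
    | .pop .two, htr, hop =>
      by_cases hT : T = []
      · simp [hT, StackOp.apply, CPG.pop2] at hop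
      · have : 1 ≤ T.length := List.length_pos_iff.2 hT
        simp only [StackOp.apply, CPG.pop2, List.length_append, List.length_singleton,
          List.dropLast_concat] at hop
        rw [if_pos (by omega)] at hop
        obtain rfl : _ = t := by simpa using hop
        exact .pop2 htr hT
    | .collapse, htr, hop =>
      obtain ⟨σ, l, r⟩ := a
      cases l with
      | one =>
        by_cases hv : v = []
        · simp [hv, StackOp.apply, CPG.collapse, CPG.pop1, top1] at hop
        · have : 1 ≤ v.length := List.length_pos_iff.2 hv
          simp only [StackOp.apply, CPG.collapse, top1, CPG.pop1, List.getLast?_append,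
            List.getLast?_singleton, Option.some_or, List.length_append, List.length_singleton,
            List.dropLast_concat, Option.bind_some] at hop
          rw [if_pos (by omega)] at hop
          obtain rfl : _ = t := by simpa using hop
          exact .pop1 (.inr ⟨rfl, htr⟩) hv
      | two =>
        simp only [StackOp.apply, CPG.collapse, top1, List.getLast?_append,
            List.getLast?_singleton, Option.some_or, Option.bind_some] at hop
        split_ifs at hop with hr
        obtain rfl : _ = t := by simpa using hop
        exact .collapse htr rfl hr
  · intro h
    refine ⟨a.1, ?_⟩
    cases h with
    | push b h =>
      obtain ⟨hb, h⟩ := h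
      refine ⟨_, h, topSym_concat _ _ _, ?_⟩
      obtain ⟨σ, l⟩ := b
      cases l <;> simp [StackOp.apply, CPG.push, freshLetter]
    | clone h => exact ⟨_, h, topSym_concat _ _ _, by simp [StackOp.apply, CPG.clone]⟩
    | pop1 h hv =>
      have : 1 ≤ v.length := List.length_pos_iff.2 hv
      have h1 : pop1 (T ++ [v ++ [a]]) = some (T ++ [v]) := by
        simp [CPG.pop1]; omega
      rcases h with h | ⟨h2, h⟩
      · exact ⟨_, h, topSym_concat _ _ _, h1⟩
      · refine ⟨_, h, topSym_concat _ _ _, ?_⟩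
        obtain ⟨σ, l, r⟩ := a
        obtain rfl : l = .one := h2
        simpa [StackOp.apply, CPG.collapse, top1] using h1
    | pop2 h hT =>
      have : 1 ≤ T.length := List.length_pos_iff.2 hT
      refine ⟨_, h, topSym_concat _ _ _, ?_⟩
      simp [StackOp.apply, CPG.pop2]; omega
    | collapse h h2 hr =>
      refine ⟨_, h, topSym_concat _ _ _, ?_⟩
      obtain ⟨σ, l, r⟩ := a
      obtain rfl : l = .two := h2
      simpa [StackOp.apply, CPG.collapse, top1, Nat.pos_iff_ne_zero] using hr

theorem exists_concat_of_step (S : CPS Γ Q) {c c' : Q × Stack Γ} (h : S.Step c c') :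
    ∃ T v a, c.2 = T ++ [v ++ [a]] := by
  obtain ⟨σ, op, -, h, -⟩ := h
  obtain ⟨T, v, a, h, -⟩ := exists_of_topSym h
  exact ⟨T, v, a, h⟩

end Steps

/-! ### Runs confined to a set of stacks -/

section RunIn

variable {Γ Q : Type*}

/-- There is a run of `n` steps from one configuration to another, all of whose stacks, except
possibly the last one, satisfy `P`. -/
inductive RunIn (S : CPS Γ Q) (P : Stack Γ → Prop) : ℕ → Q × Stack Γ → Q × Stack Γ → Prop
  | refl (c) : RunIn S P 0 c c
  | head {n c c₁ c'} : P c.2 → S.Step c c₁ → RunIn S P n c₁ c' → RunIn S P (n + 1) c c'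

namespace RunIn

variable {S : CPS Γ Q} {P P' : Stack Γ → Prop} {m n : ℕ} {c c₁ c' : Q × Stack Γ}

theorem mono (h : RunIn S P n c c') (hP : ∀ t, P t → P' t) : RunIn S P' n c c' := by
  induction h with
  | refl => exact .refl _
  | head h1 h2 _ ih => exact .head (hP _ h1) h2 ih

theorem trans (h : RunIn S P m c c₁) (h' : RunIn S P n c₁ c') : RunIn S P (m + n) c c' := by
  induction h with
  | refl => simpa using h'
  | head h1 h2 _ ih => rw [Nat.add_right_comm]; exact .head h1 h2 (ih h')

theorem single (hP : P c.2) (h : S.Step c c') : RunIn S P 1 c c' := .head hP h (.refl _)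

/-- Either a run remains in `P'`, or it leaves `P'` at a first configuration. -/
theorem split (h : RunIn S P n c c') (P' : Stack Γ → Prop) :
    RunIn S P' n c c' ∨ ∃ k m c₁, RunIn S P' k c c₁ ∧ ¬ P' c₁.2 ∧ P c₁.2 ∧
      RunIn S P m c₁ c' ∧ k + m = n ∧ 0 < m := by
  induction h with
  | refl => exact .inl (.refl _)
  | @head n c c₁ c' h1 h2 h3 ih =>
    by_cases hc : P' c.2
    · rcases ih with ih | ⟨k, m, d, hk, hd, hd', hm, e, hm'⟩
      · exact .inl (.head hc h2 ih)
      · exact .inr ⟨k + 1, m, d, .head hc h2 hk, hd, hd', hm, by omega, hm'⟩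
    · exact .inr ⟨0, n + 1, c, .refl _, hc, h1, .head h1 h2 h3, by omega, by omega⟩

theorem exists_first_exit {P₁ : Stack Γ → Prop} (h : RunIn S P n c c') (hP : ∀ t, P t → P₁ t)
    (hc : P₁ c'.2) (hc' : ¬ P' c'.2) : ∃ k m c₁, RunIn S P' k c c₁ ∧ ¬ P' c₁.2 ∧ P₁ c₁.2 ∧
      RunIn S P m c₁ c' ∧ k + m = n := by
  rcases h.split P' with h | ⟨k, m, c₁, h1, h2, h3, h4, h5, -⟩
  · exact ⟨n, 0, c', h, hc', hc, .refl _, rfl⟩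
  · exact ⟨k, m, c₁, h1, h2, hP _ h3, h4, h5⟩

theorem exists_last_step (h : RunIn S P (n + 1) c c') :
    ∃ d, RunIn S P n c d ∧ P d.2 ∧ S.Step d c' := by
  induction n generalizing c with
  | zero =>
    cases h with
    | head h1 h2 h3 => cases h3; exact ⟨c, .refl _, h1, h2⟩
  | succ n ih =>
    cases h with
    | head h1 h2 h3 =>
      obtain ⟨d, hd, hd', hs⟩ := ih h3
      exact ⟨d, .head h1 h2 hd, hd', hs⟩

/-- A run in `P` that starts in `P'` stays in `P'`, if no step inside `P` leaves `P'`. -/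
theorem stay (h : RunIn S P n c c') (hc : P' c.2) (hc' : P c'.2)
    (hstep : ∀ d d' : Q × Stack Γ, P' d.2 → S.Step d d' → P d'.2 → P' d'.2) :
    RunIn S P' n c c' ∧ P' c'.2 := by
  induction h with
  | refl => exact ⟨.refl _, hc⟩
  | @head n c c₁ c' h1 h2 h3 ih =>
    have h4 : P c₁.2 := by
      cases h3 with
      | refl => exact hc'
      | head h _ _ => exact h
    have h5 := ih (hstep _ _ hc h2 h4) hc'
    exact ⟨.head hc h2 h5.1, h5.2⟩

end RunIn

/-! ### The stacks above a given stack -/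

/-- The stacks obtained from `T ++ [u]` by extending the word `u` and adding words on top.  In
particular, `Above T []` consists of the proper extensions of `T`. -/
def Above (T : Stack Γ) (u : List (Letter Γ)) (t : Stack Γ) : Prop :=
  ∃ x rest, t = T ++ (u ++ x) :: rest

variable {S : CPS Γ Q} {T : Stack Γ} {u : List (Letter Γ)}

theorem above_concat (T : Stack Γ) (u x : List (Letter Γ)) : Above T u (T ++ [u ++ x]) :=
  ⟨x, [], rfl⟩

theorem above_self (T : Stack Γ) (u : List (Letter Γ)) : Above T u (T ++ [u]) :=
  ⟨[], [], by simp⟩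

theorem above_nil_concat (T : Stack Γ) (w : List (Letter Γ)) : Above T [] (T ++ [w]) :=
  ⟨w, [], rfl⟩

theorem Above.nil {t : Stack Γ} (h : Above T u t) : Above T [] t := by
  obtain ⟨x, rest, rfl⟩ := h
  exact ⟨u ++ x, rest, rfl⟩

theorem Above.of_above {w x : List (Letter Γ)} {t : Stack Γ} (h : Above (T ++ [u ++ x]) w t) :
    Above T u t := by
  obtain ⟨y, rest, rfl⟩ := h
  exact ⟨x, (w ++ y) :: rest, by simp⟩

theorem Above.length_lt {t : Stack Γ} (h : Above T u t) : T.length < t.length := by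
  obtain ⟨x, rest, rfl⟩ := h
  simp

theorem Above.not_prefix {t : Stack Γ} (h : Above T u t) : ¬ t <+: T := fun h' =>
  absurd h'.length_le (by have := h.length_lt; omega)

/-- A step that leaves `Above T u` leads to a prefix of `T`, or pops the last letter of `u`. -/
theorem Above.exit {c c' : Q × Stack Γ} (h : Above T u c.2) (hs : S.Step c c')
    (h' : ¬ Above T u c'.2) :
    c'.2 <+: T ∨ ∃ v a, u = v ++ [a] ∧ v ≠ [] ∧ c.2 = T ++ [u] ∧ c'.2 = T ++ [v] ∧
      PopStep S c.1 a.sym c'.1 := by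
  obtain ⟨p, t⟩ := c
  obtain ⟨q, t'⟩ := c'
  obtain ⟨T', v, a, rfl : t = _⟩ := exists_concat_of_step S hs
  rw [step_concat_iff] at hs
  obtain ⟨x, rest, h⟩ := h
  dsimp only at h h' ⊢
  have htake : ∀ r, ¬ Above T u ((T ++ (u ++ x) :: rest).take r) →
      (T ++ (u ++ x) :: rest).take r <+: T := by
    intro r hr
    rw [List.take_append] at hr ⊢
    rcases Nat.lt_or_ge T.length r with h1 | h1
    · exfalso
      apply hr
      obtain ⟨k, hk⟩ : ∃ k, r - T.length = k + 1 := ⟨r - T.length - 1, by omega⟩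
      rw [List.take_of_length_le (by omega), hk]
      exact ⟨x, rest.take k, by simp⟩
    · rw [show r - T.length = 0 by omega]
      simpa using List.take_prefix _ _
  rcases List.eq_nil_or_concat' rest with rfl | ⟨rest, w, rfl⟩
  · obtain ⟨rfl, h⟩ := List.append_inj' h rfl
    obtain h : v ++ [a] = u ++ x := by simpa using h
    cases hs with
    | push b _ => rw [h] at h'; exact absurd ⟨_, [], by simp; rfl⟩ h'
    | clone _ => rw [h] at h'; exact absurd ⟨x, [_], by simp; rfl⟩ h'
    | pop1 hp hv =>
      rcases List.eq_nil_or_concat' x with rfl | ⟨x, b, rfl⟩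
      · right
        exact ⟨v, a, by simpa using h.symm, hv, by rw [h]; simp, rfl, hp⟩
      · exfalso
        obtain ⟨rfl, -⟩ := List.append_inj' (s₁ := v) (s₂ := u ++ x) (t₁ := [a]) (t₂ := [b])
          (by simpa using h) rfl
        exact h' ⟨x, [], rfl⟩
    | pop2 => exact .inl List.prefix_rfl
    | collapse _ _ _ =>
      left
      rw [h] at h' ⊢
      exact htake _ h'
  · obtain ⟨rfl, h0⟩ := List.append_inj' (s₁ := T') (s₂ := T ++ (u ++ x) :: rest)
      (t₁ := [v ++ [a]]) (t₂ := [w]) (by simpa using h) rfl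
    cases hs with
    | push b _ => exact absurd ⟨x, rest ++ [_], by simp; rfl⟩ h'
    | clone _ => exact absurd ⟨x, rest ++ [_, _], by simp; exact ⟨rfl, rfl⟩⟩ h'
    | pop1 _ _ => exact absurd ⟨x, rest ++ [_], by simp; rfl⟩ h'
    | pop2 _ _ => exact absurd ⟨x, rest, rfl⟩ h'
    | collapse _ _ _ =>
      left
      rw [h] at h' ⊢
      exact htake _ h'

/-- A step that enters `Above T u` clones the topmost word of `T`, or pushes the last letter
of `u`. -/
theorem Above.enter {c c' : Q × Stack Γ} (h : ¬ Above T u c.2) (hs : S.Step c c')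
    (h' : Above T u c'.2) :
    c.2 = T ∨ ∃ v a b, u = v ++ [a] ++ [freshLetter b T.length (v.length + 1)] ∧
      c.2 = T ++ [v ++ [a]] ∧ c'.2 = T ++ [u] ∧ PushStep S c.1 a.1 b c'.1 := by
  obtain ⟨p, t⟩ := c
  obtain ⟨q, t'⟩ := c'
  obtain ⟨T', v, a, rfl : t = _⟩ := exists_concat_of_step S hs
  rw [step_concat_iff] at hs
  obtain ⟨x, rest, h'⟩ := h'
  dsimp only at h h' ⊢
  have hpre : ∀ t₁ t₂, t₁ = T ++ (u ++ x) :: rest → t₁ <+: t₂ → Above T u t₂ := by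
    rintro t₁ t₂ rfl ⟨r, rfl⟩
    exact ⟨x, rest ++ r, by simp⟩
  cases hs with
  | push b hb =>
    rcases List.eq_nil_or_concat' rest with rfl | ⟨rest, w, rfl⟩
    · obtain ⟨rfl, h'⟩ := List.append_inj' h' rfl
      obtain h' : v ++ [a] ++ [freshLetter b T'.length (v.length + 1)] = u ++ x := by
        simpa using h'
      rcases List.eq_nil_or_concat' x with rfl | ⟨x, d, rfl⟩
      · right
        rw [List.append_nil] at h'
        exact ⟨v, a, b, h'.symm, rfl, by rw [h'], hb⟩
      · exfalso
        obtain ⟨h1, -⟩ := List.append_inj' (s₁ := v ++ [a]) (s₂ := u ++ x)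
          (t₁ := [freshLetter b T'.length (v.length + 1)]) (t₂ := [d]) (by rw [h']; simp) rfl
        exact h ⟨x, [], by rw [h1]⟩
    · exfalso
      obtain ⟨rfl, h0⟩ := List.append_inj' (s₁ := T') (s₂ := T ++ (u ++ x) :: rest)
        (t₁ := [v ++ [a] ++ [freshLetter b T'.length (v.length + 1)]]) (t₂ := [w]) (by rw [h']; simp) rfl
      exact h ⟨x, rest ++ [_], by simp; rfl⟩
  | clone _ =>
    rcases List.eq_nil_or_concat' rest with rfl | ⟨rest, w, rfl⟩
    · obtain ⟨rfl, h'⟩ := List.append_inj' h' rfl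
      exact .inl rfl
    · exfalso
      obtain ⟨h1, h0⟩ := List.append_inj' (s₁ := T' ++ [v ++ [a]])
        (s₂ := T ++ (u ++ x) :: rest) (t₁ := [v ++ [a]]) (t₂ := [w]) (by rw [h']; simp) rfl
      exact h ⟨x, rest, h1⟩
  | pop1 _ _ =>
    exfalso
    rcases List.eq_nil_or_concat' rest with rfl | ⟨rest, w, rfl⟩
    · obtain ⟨rfl, h'⟩ := List.append_inj' h' rfl
      obtain h' : v = u ++ x := by simpa using h'
      exact h ⟨x ++ [a], [], by simp [h']⟩
    · obtain ⟨rfl, h0⟩ := List.append_inj' (s₁ := T') (s₂ := T ++ (u ++ x) :: rest)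
        (t₁ := [v]) (t₂ := [w]) (by rw [h']; simp) rfl
      exact h ⟨x, rest ++ [_], by simp; rfl⟩
  | pop2 _ _ => exact absurd (hpre _ _ h' (List.prefix_append _ _)) h
  | collapse _ _ _ => exact absurd (hpre _ _ h' (List.take_prefix _ _)) h

end RunIn

/-! ### Returns: runs that remove the topmost word -/

section Returns

variable {Γ Q : Type*}

/-- The abstract counterpart of the runs that remove the topmost word of a stack.  The word is
given with its top first and without links, but with a mark on some letters.

Suppose that `T₀` is a nonempty prefix of `T`, and that the marked letters of `x` are those of
level `2` with link `|T₀|`.  With the empty relation for `R`, `Return S R m p x q` says that there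
is a run from `p` at `T` with `x` on top to `q` at `T₀` that stays strictly above `T` before its
last step; here `m` tells whether `T = T₀`.  A run that clones either comes back to the cloned word
(`cloneReturn`), or does not and ends by a collapse at a copy of a marked letter (`cloneCollapse`).

The relation `R` describes how to go on once all of `x` is removed, and thereby stands for an
unmarked word below `x`. -/
inductive Return (S : CPS Γ Q) (R : Bool → Q → Q → Prop) :
    Bool → Q → List ((Γ × Level) × Bool) → Q → Prop
  | base {m p q} : R m p q → Return S R m p [] q
  | pop2 {p q a x} : (p, a.1.1, q, StackOp.pop .two) ∈ S.trans → Return S R true p (a :: x) q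
  | collapse {m p q σ x} : (p, σ, q, StackOp.collapse) ∈ S.trans →
      Return S R m p (((σ, .two), true) :: x) q
  | pop1 {m p p' q a x} : PopStep S p a.1 p' → Return S R m p' x q → Return S R m p (a :: x) q
  | push {m p p' q a x} (b : Γ × Level) : PushStep S p a.1.1 b p' →
      Return S R m p' ((b, decide (b.2 = .two) && m) :: a :: x) q → Return S R m p (a :: x) q
  | cloneReturn {m p p' q' q a x} : (p, a.1.1, p', StackOp.clone) ∈ S.trans →
      Return S R true p' ((a :: x).map fun b => (b.1, false)) q' →
      Return S R m q' (a :: x) q → Return S R m p (a :: x) q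
  | cloneCollapse {m p p' q a x} : (p, a.1.1, p', StackOp.clone) ∈ S.trans →
      Return S R false p' (a :: x) q → Return S R m p (a :: x) q

/-- The symbols and levels of a word, top first. -/
def symbols (w : List (Letter Γ)) : List (Γ × Level) := (w.map Letter.sym).reverse

/-- The symbols and levels of a word, top first; the letters of level `2` with link `n` are
marked. -/
def marked (n : ℕ) (w : List (Letter Γ)) : List ((Γ × Level) × Bool) :=
  (w.map fun a => (a.sym, decide (a.2.1 = .two ∧ a.2.2 = n))).reverse

/-- The word without marks. -/
def unmarked (x : List (Γ × Level)) : List ((Γ × Level) × Bool) := x.map fun b => (b, false)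

@[simp] theorem symbols_nil : symbols ([] : List (Letter Γ)) = [] := rfl

@[simp] theorem symbols_concat (w : List (Letter Γ)) (a : Letter Γ) :
    symbols (w ++ [a]) = a.sym :: symbols w := by simp [symbols]

theorem symbols_append (v w : List (Letter Γ)) :
    symbols (v ++ w) = symbols w ++ symbols v := by simp [symbols]

@[simp] theorem marked_nil (n : ℕ) : marked n ([] : List (Letter Γ)) = [] := rfl

@[simp] theorem marked_concat (n : ℕ) (w : List (Letter Γ)) (a : Letter Γ) :
    marked n (w ++ [a]) = (a.sym, decide (a.2.1 = .two ∧ a.2.2 = n)) :: marked n w := by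
  simp [marked]

theorem marked_freshLetter (n k m : ℕ) (w : List (Letter Γ)) (b : Γ × Level) :
    marked n (w ++ [freshLetter b k m]) =
      (b, decide (b.2 = .two) && decide (k = n)) :: marked n w := by
  obtain ⟨σ, _ | _⟩ := b <;> simp [freshLetter, Letter.sym]

@[simp] theorem unmarked_nil : unmarked ([] : List (Γ × Level)) = [] := rfl

@[simp] theorem unmarked_cons (a : Γ × Level) (x : List (Γ × Level)) :
    unmarked (a :: x) = (a, false) :: unmarked x := rfl

@[simp] theorem unmarked_append (x y : List (Γ × Level)) :
    unmarked (x ++ y) = unmarked x ++ unmarked y := by simp [unmarked]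

theorem map_unmark_marked (n : ℕ) (w : List (Letter Γ)) :
    ((marked n w).map fun b => (b.1, false)) = unmarked (symbols w) := by
  simp [marked, symbols, unmarked]

theorem map_unmark_unmarked (x : List (Γ × Level)) :
    ((unmarked x).map fun b => (b.1, false)) = unmarked x := by
  simp [unmarked]

/-- The links of the letters of level `2` are less than `n`. -/
def LinksLT (n : ℕ) (w : List (Letter Γ)) : Prop := ∀ a ∈ w, a.2.1 = .two → a.2.2 < n

theorem LinksLT.mono {m n : ℕ} {w : List (Letter Γ)} (h : LinksLT m w) (hmn : m ≤ n) :
    LinksLT n w := fun a ha h2 => (h a ha h2).trans_le hmn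

theorem LinksLT.of_prefix {n : ℕ} {v w : List (Letter Γ)} (h : LinksLT n w) (hv : v <+: w) :
    LinksLT n v := fun a ha => h a (hv.subset ha)

theorem LinksLT.freshLetter {n k : ℕ} {w : List (Letter Γ)} (h : LinksLT n w) (hk : k < n)
    (b : Γ × Level) (m : ℕ) : LinksLT n (w ++ [freshLetter b k m]) := by
  intro a ha h2
  rcases List.mem_append.1 ha with ha | ha
  · exact h a ha h2
  · obtain rfl : a = _ := by simpa using ha
    obtain ⟨σ, _ | _⟩ := b
    · simp [CPG.freshLetter] at h2
    · simpa [CPG.freshLetter] using hk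

theorem marked_eq_unmarked {n : ℕ} {w : List (Letter Γ)} (h : LinksLT n w) :
    marked n w = unmarked (symbols w) := by
  simp only [marked, symbols, unmarked, List.map_reverse, List.map_map]
  congr 1
  apply List.map_congr_left
  intro a ha
  have := h a ha
  simp only [Function.comp, Prod.mk.injEq, true_and, decide_eq_false_iff_not]
  rintro ⟨h2, rfl⟩
  exact lt_irrefl _ (this h2)

/-- The relation that replaces an unmarked word `x` as the base of `Return`. -/
def returnBase (S : CPS Γ Q) (x : List (Γ × Level)) : Bool → Q → Q → Prop :=
  fun m p q => Return S (fun _ _ _ => False) m p (unmarked x) q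

/-- The runs that remove a word depend on an unmarked lower part of it only through `returnBase`. -/
theorem return_append_iff (S : CPS Γ Q) {m : Bool} {p q : Q} {x : List ((Γ × Level) × Bool)}
    {y : List (Γ × Level)} (R : Bool → Q → Q → Prop) :
    Return S R m p (x ++ unmarked y) q ↔
      Return S (fun m p q => Return S R m p (unmarked y) q) m p x q := by
  constructor
  · intro h
    generalize hz : x ++ unmarked y = z at h
    induction h generalizing x with
    | base h =>
      obtain ⟨rfl, hy⟩ := List.append_eq_nil_iff.1 hz
      rw [hy]
      exact .base (.base h)
    | @pop2 p q a z h =>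
      rcases x with _ | ⟨b, x⟩
      · exact .base (by rw [show unmarked y = _ from hz]; exact .pop2 h)
      · obtain ⟨rfl, rfl⟩ : b = a ∧ x ++ unmarked y = z := by simpa using hz
        exact .pop2 h
    | @collapse m p q σ z h =>
      rcases x with _ | ⟨b, x⟩
      · exact .base (by rw [show unmarked y = _ from hz]; exact .collapse h)
      · obtain ⟨rfl, rfl⟩ : b = _ ∧ x ++ unmarked y = z := by simpa using hz
        exact .collapse h
    | @pop1 m p p' q a z h h' ih =>
      rcases x with _ | ⟨b, x⟩
      · exact .base (by rw [show unmarked y = _ from hz]; exact .pop1 h h')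
      · obtain ⟨rfl, rfl⟩ : b = a ∧ x ++ unmarked y = z := by simpa using hz
        exact .pop1 h (ih rfl)
    | @push m p p' q a z b h h' ih =>
      rcases x with _ | ⟨d, x⟩
      · exact .base (by rw [show unmarked y = _ from hz]; exact .push b h h')
      · obtain ⟨rfl, rfl⟩ : d = a ∧ x ++ unmarked y = z := by simpa using hz
        exact .push b h (ih (x := _ :: d :: x) rfl)
    | @cloneReturn m p p' q' q a z h h' h'' ih ih' =>
      rcases x with _ | ⟨d, x⟩
      · exact .base (by rw [show unmarked y = _ from hz]; exact .cloneReturn h h' h'')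
      · obtain ⟨rfl, rfl⟩ : d = a ∧ x ++ unmarked y = z := by simpa using hz
        refine .cloneReturn h (ih ?_) (ih' (x := d :: x) rfl)
        simp [unmarked]
    | @cloneCollapse m p p' q a z h h' ih =>
      rcases x with _ | ⟨d, x⟩
      · exact .base (by rw [show unmarked y = _ from hz]; exact .cloneCollapse h h')
      · obtain ⟨rfl, rfl⟩ : d = a ∧ x ++ unmarked y = z := by simpa using hz
        exact .cloneCollapse h (ih (x := d :: x) rfl)
  · intro h
    induction h with
    | base h => simpa using h
    | pop2 h => exact .pop2 h
    | collapse h => exact .collapse h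
    | pop1 h _ ih => exact .pop1 h ih
    | push b h _ ih => exact .push b h ih
    | cloneReturn h _ _ ih ih' =>
      refine .cloneReturn h ?_ ih'
      rw [← map_unmark_unmarked y, ← List.map_append] at ih
      exact ih
    | cloneCollapse h _ ih => exact .cloneCollapse h ih

theorem returnBase_append (S : CPS Γ Q) (x y : List (Γ × Level)) :
    returnBase S (x ++ y) =
      fun m p q => Return S (returnBase S y) m p (unmarked x) q := by
  funext m p q
  rw [returnBase, unmarked_append, return_append_iff]
  rfl

variable {S : CPS Γ Q}

/-- Every abstract return is realised by a run. -/
theorem Return.exists_run {m : Bool} {p q : Q} {x : List ((Γ × Level) × Bool)}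
    (h : Return S (fun _ _ _ => False) m p x q) {T₀ T : Stack Γ} {w : List (Letter Γ)}
    (hT₀ : T₀ ≠ []) (hT : T₀ <+: T) (hm : m = true ↔ T = T₀) (hw : LinksLT (T.length + 1) w)
    (hx : marked T₀.length w = x) : ∃ n, RunIn S (Above T []) n (p, T ++ [w]) (q, T₀) := by
  have hcons : ∀ {n : ℕ} {a : (Γ × Level) × Bool} {x : List ((Γ × Level) × Bool)}
      {w : List (Letter Γ)}, marked n w = a :: x → ∃ v d, w = v ++ [d] ∧ marked n v = x ∧
        (d.sym, decide (d.2.1 = .two ∧ d.2.2 = n)) = a := by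
    intro n a x w h
    rcases List.eq_nil_or_concat' w with rfl | ⟨v, d, rfl⟩
    · simp at h
    · rw [marked_concat, List.cons.injEq] at h
      exact ⟨v, d, rfl, h.2, h.1⟩
  have step : ∀ {T : Stack Γ} {p q : Q} {v : List (Letter Γ)} {a : Letter Γ} {t : Stack Γ},
      StepAt S T v a p q t → RunIn S (Above T []) 1 (p, T ++ [v ++ [a]]) (q, t) :=
    fun h => .single (above_nil_concat _ _) ((step_concat_iff S).2 h)
  induction h generalizing T₀ T w with
  | base h => exact h.elim
  | pop2 h =>
    obtain ⟨v, d, rfl, -, rfl⟩ := hcons hx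
    obtain rfl : T = T₀ := hm.1 rfl
    exact ⟨1, step (.pop2 h hT₀)⟩
  | @collapse m p q σ x h =>
    obtain ⟨v, d, rfl, -, hd⟩ := hcons hx
    rw [Prod.mk.injEq, decide_eq_true_iff] at hd
    obtain ⟨hd, h2, hlink⟩ := hd
    have h3 : (T ++ [v ++ [d]]).take d.2.2 = T₀ := by
      rw [hlink]
      exact (List.prefix_iff_eq_take.1 (hT.trans (List.prefix_append _ _))).symm
    have h4 := StepAt.collapse (S := S) (T := T) (v := v) (a := d) (p := p) (q := q)
      (by rw [show d.1 = σ from congrArg Prod.fst hd]; exact h) h2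
      (by rw [hlink]; exact List.length_pos_iff.2 hT₀)
    rw [h3] at h4
    exact ⟨1, step h4⟩
  | @pop1 m p p' q a x h h' ih =>
    obtain ⟨v, d, rfl, hv, rfl⟩ := hcons hx
    have hv0 : v ≠ [] := by
      rintro rfl
      obtain rfl : [] = x := by simpa using hv
      cases h' with
      | base h => exact h
    obtain ⟨n, hn⟩ := ih hT₀ hT hm (hw.of_prefix (List.prefix_append _ _)) hv
    exact ⟨1 + n, (step (.pop1 h hv0)).trans hn⟩
  | @push m p p' q a x b h h' ih =>
    obtain ⟨v, d, rfl, hv, rfl⟩ := hcons hx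
    obtain ⟨n, hn⟩ := ih (w := v ++ [d] ++ [freshLetter b T.length (v.length + 1)]) hT₀ hT hm
      (hw.freshLetter (by omega) _ _) (by
        rw [marked_freshLetter, hx]
        congr 3
        rw [Bool.eq_iff_iff, decide_eq_true_iff, hm]
        exact ⟨fun h => (hT.eq_of_length h.symm).symm, fun h => h ▸ rfl⟩)
    exact ⟨1 + n, (step (.push b h)).trans hn⟩
  | @cloneReturn m p p' q' q a x h h' h'' ih ih' =>
    obtain ⟨v, d, rfl, hv, rfl⟩ := hcons hx
    obtain ⟨n₁, h₁⟩ := ih (T₀ := T ++ [v ++ [d]]) (T := T ++ [v ++ [d]]) (w := v ++ [d]) (by simp)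
      List.prefix_rfl (by simp) (hw.mono (by simp))
      (by rw [← hx, map_unmark_marked, marked_eq_unmarked (by simpa using hw)])
    obtain ⟨n₂, h₂⟩ := ih' hT₀ hT hm hw hx
    exact ⟨1 + n₁ + n₂, ((step (.clone h)).trans
      (h₁.mono fun _ ht => Above.of_above (u := []) ht)).trans h₂⟩
  | @cloneCollapse m p p' q a x h h' ih =>
    obtain ⟨v, d, rfl, hv, rfl⟩ := hcons hx
    obtain ⟨n, hn⟩ := ih (T := T ++ [v ++ [d]]) (w := v ++ [d]) hT₀
      (hT.trans (List.prefix_append _ _))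
      (by
        have := hT.length_le
        simp only [Bool.false_eq_true, false_iff]
        rintro rfl
        simp at this)
      (hw.mono (by simp)) hx
    exact ⟨1 + n, (step (.clone h)).trans (hn.mono fun _ ht => Above.of_above (u := []) ht)⟩

/-- Every run that removes the topmost word is accounted for by an abstract return. -/
theorem RunIn.to_return {n : ℕ} {m : Bool} {p q : Q} {T₀ T : Stack Γ} {w : List (Letter Γ)}
    (h : RunIn S (Above T []) n (p, T ++ [w]) (q, T₀))
    (hT : T₀ <+: T) (hm : m = true ↔ T = T₀) (hw : LinksLT (T.length + 1) w) :
    Return S (fun _ _ _ => False) m p (marked T₀.length w) q := by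
  induction n using Nat.strong_induction_on generalizing m p q T₀ T w with
  | _ n ih =>
  cases h with
  | refl => exact absurd hT (above_nil_concat _ _).not_prefix
  | @head n _ c₁ _ h1 hs h' =>
    obtain ⟨p', t⟩ := c₁
    have hw0 : w ≠ [] := by
      rintro rfl
      obtain ⟨σ, _, _, h, _⟩ := hs
      simp [topSym, top1] at h
    obtain ⟨v, a, rfl⟩ := (List.eq_nil_or_concat' w).resolve_left hw0
    rw [step_concat_iff] at hs
    have hend : ∀ {t}, ¬ Above T [] t → RunIn S (Above T []) n (p', t) (q, T₀) →
        p' = q ∧ t = T₀ := by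
      intro t ht h
      cases h with
      | refl => exact ⟨rfl, rfl⟩
      | head h _ _ => exact absurd h ht
    rw [marked_concat]
    cases hs with
    | push b hb =>
      refine .push b hb ?_
      have := ih n (by omega) h' hT hm (hw.freshLetter (by omega) _ _)
      rw [marked_freshLetter, marked_concat] at this
      have hlen : decide (T.length = T₀.length) = m := by
        rw [Bool.eq_iff_iff, decide_eq_true_iff, hm]
        exact ⟨fun h => (hT.eq_of_length h.symm).symm, fun h => h ▸ rfl⟩
      rwa [hlen] at this
    | clone hc =>
      rcases h'.split (Above (T ++ [v ++ [a]]) []) with h2 | ⟨k, l, ⟨q', t⟩, h2, h3, h4, h5, hkl, _⟩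
      · refine .cloneCollapse hc ?_
        rw [← marked_concat]
        refine ih n (by omega) h2 (hT.trans (List.prefix_append _ _)) ?_ (hw.mono (by simp))
        have := hT.length_le
        simp only [Bool.false_eq_true, false_iff]
        rintro rfl
        simp at this
      · -- The first stack that is not above `T ++ [v ++ [a]]` is this stack itself.
        obtain rfl : t = T ++ [v ++ [a]] := by
          rcases k with _ | k
          · cases h2
            exact absurd (above_nil_concat _ _) h3
          · obtain ⟨d, -, hd, hs⟩ := h2.exists_last_step
            rcases hd.exit hs h3 with h6 | ⟨_, _, h6, _⟩
            · obtain ⟨x, rest, rfl⟩ := h4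
              have h7 := h6.length_le
              exact h6.eq_of_length (by simp at h7 ⊢; omega)
            · simp at h6
        have h6 := ih k (by omega) h2 List.prefix_rfl (iff_of_true rfl rfl) (hw.mono (by simp))
        have h7 := ih l (by omega) h5 hT hm hw
        rw [marked_eq_unmarked (by simpa using hw), ← map_unmark_marked T₀.length,
          marked_concat] at h6
        rw [marked_concat] at h7
        exact .cloneReturn hc h6 h7
    | pop1 hp hv => exact .pop1 hp (ih n (by omega) h' hT hm (hw.of_prefix (List.prefix_append _ _)))
    | pop2 hp hT' =>
      obtain ⟨rfl, rfl⟩ := hend (fun h => h.not_prefix List.prefix_rfl) h'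
      obtain rfl : m = true := hm.2 rfl
      exact .pop2 hp
    | collapse hc h2 h0 =>
      have h3 : a.2.2 ≤ T.length := Nat.lt_succ_iff.1 (hw a (by simp) h2)
      rw [List.take_append_of_le_length h3] at h'
      obtain ⟨rfl, rfl⟩ := hend (fun h => h.not_prefix (List.take_prefix _ _)) h'
      obtain ⟨σ, l, r⟩ := a
      obtain rfl : l = .two := h2
      have h4 : decide ((Level.two : Level) = .two ∧ r = (T.take r).length) = true := by
        simpa using h3
      dsimp only
      rw [h4]
      exact .collapse hc

end Returns

section Loops

variable {Γ Q : Type*}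

/-- Runs that remove a cloned topmost word, in terms of `returnBase`. -/
theorem returnBase_iff_exists_run {S : CPS Γ Q} {T : Stack Γ} {w : List (Letter Γ)} {p q : Q}
    (hT : T ≠ []) (hw : LinksLT T.length w) :
    returnBase S (symbols w) true p q ↔ ∃ n, RunIn S (Above T []) n (p, T ++ [w]) (q, T) := by
  rw [returnBase, ← marked_eq_unmarked hw]
  exact ⟨fun h => h.exists_run hT List.prefix_rfl (by simp) (hw.mono (by simp)) rfl,
    fun ⟨n, h⟩ => h.to_return List.prefix_rfl (by simp) (hw.mono (by simp))⟩

/-- A run from just above a stack to a configuration that is not above it visits this stack. -/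
theorem RunIn.exists_return {S : CPS Γ Q} {P : Stack Γ → Prop} {n : ℕ} {c c' : Q × Stack Γ}
    {T : Stack Γ} {w : List (Letter Γ)} (h : RunIn S P n c c') (hc : Above (T ++ [w]) [] c.2)
    (hc' : ¬ Above (T ++ [w]) [] c'.2) (hP : ∀ t, P t → Above T [] t) (hT : Above T [] c'.2) :
    ∃ k m q', RunIn S (Above (T ++ [w]) []) k c (q', T ++ [w]) ∧
      RunIn S P m (q', T ++ [w]) c' ∧ k + m = n := by
  have key : ∀ {k c₁}, RunIn S (Above (T ++ [w]) []) k c c₁ → ¬ Above (T ++ [w]) [] c₁.2 →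
      Above T [] c₁.2 → c₁.2 = T ++ [w] := by
    intro k c₁ h h' hT
    rcases k with _ | k
    · cases h
      exact absurd hc h'
    · obtain ⟨d, -, hd, hs⟩ := h.exists_last_step
      rcases hd.exit hs h' with h6 | ⟨_, _, h6, _⟩
      · have h7 := hT.length_lt
        exact h6.eq_of_length (le_antisymm h6.length_le (by simpa using h7))
      · simp at h6
  obtain ⟨k, m, ⟨q', t⟩, h2, h3, h4, h5, hkm⟩ :=
    h.exists_first_exit (P' := Above (T ++ [w]) []) hP hT hc'
  obtain rfl : t = T ++ [w] := key h2 h3 h4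
  exact ⟨k, m, q', h2, h5, hkm⟩

/-! ### Loops: runs that come back to a stack without going below it -/

/-- The abstract counterpart of the runs that end in a given stack without going below it.
The word `y` consists of the topmost letter of the given stack, with the letters of the current
topmost word above it, top first; the relation `R` stands for the word below this letter, as in
`Return`. -/
inductive Loop (S : CPS Γ Q) (R : Bool → Q → Q → Prop) : Q → List (Γ × Level) → Q → Prop
  | refl (p a) : Loop S R p [a] p
  | pop {p p' q b c y} : PopStep S p b p' → Loop S R p' (c :: y) q → Loop S R p (b :: c :: y) q
  | push {p p' q a y} (b : Γ × Level) : PushStep S p a.1 b p' → Loop S R p' (b :: a :: y) q →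
      Loop S R p (a :: y) q
  | clone {p p' q' q a y} : (p, a.1, p', StackOp.clone) ∈ S.trans →
      Return S R true p' (unmarked (a :: y)) q' → Loop S R q' (a :: y) q → Loop S R p (a :: y) q

variable {S : CPS Γ Q}

theorem Loop.exists_run {p q : Q} {y : List (Γ × Level)} {T : Stack Γ} {v x : List (Letter Γ)}
    {d : Letter Γ} (h : Loop S (returnBase S (symbols v)) p y q) (hy : symbols x ++ [d.sym] = y)
    (hw : LinksLT (T.length + 1) (v ++ [d] ++ x)) :
    ∃ n, RunIn S (Above T (v ++ [d])) n (p, T ++ [v ++ [d] ++ x]) (q, T ++ [v ++ [d]]) := by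
  have step : ∀ {p q : Q} {u x' : List (Letter Γ)} {a : Letter Γ} {t : Stack Γ},
      u ++ [a] = v ++ [d] ++ x' → StepAt S T u a p q t →
        RunIn S (Above T (v ++ [d])) 1 (p, T ++ [v ++ [d] ++ x']) (q, t) := by
    intro p q u x' a t e h
    rw [← step_concat_iff, e] at h
    exact .single (above_concat _ _ _) h
  have hlast : ∀ {x : List (Letter Γ)} {a : Γ × Level} {y : List (Γ × Level)},
      symbols x ++ [d.sym] = a :: y → ∃ u b, v ++ [d] ++ x = u ++ [b] ∧ Letter.sym b = a := by
    intro x a y h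
    rcases List.eq_nil_or_concat' x with rfl | ⟨x, b, rfl⟩
    · exact ⟨v, d, by simp, by simpa using (List.cons.inj h).1⟩
    · rw [symbols_concat] at h
      exact ⟨v ++ [d] ++ x, b, by simp, (List.cons.inj h).1⟩
  induction h generalizing x with
  | refl p a =>
    rcases List.eq_nil_or_concat' x with rfl | ⟨x, b, rfl⟩
    · exact ⟨0, by rw [List.append_nil]; exact .refl _⟩
    · simp at hy
  | pop h h' ih =>
    rcases List.eq_nil_or_concat' x with rfl | ⟨x, b, rfl⟩
    · simp at hy
    · rw [symbols_concat, List.cons_append, List.cons.injEq] at hy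
      obtain ⟨rfl, hy⟩ := hy
      obtain ⟨n, hn⟩ := ih hy (hw.of_prefix ⟨[b], by simp⟩)
      exact ⟨1 + n, (step (by simp) (.pop1 h (by simp))).trans hn⟩
  | @push p p' q a y b h h' ih =>
    obtain ⟨u, c, hu, rfl⟩ := hlast hy
    obtain ⟨n, hn⟩ := ih (x := x ++ [freshLetter b T.length (u.length + 1)]) (by simp [hy])
      (by rw [← List.append_assoc]; exact hw.freshLetter (by omega) _ _)
    rw [← List.append_assoc, hu] at hn
    exact ⟨1 + n, (step hu.symm (.push b h)).trans hn⟩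
  | @clone p p' q' q a y h h' h'' ih =>
    obtain ⟨u, c, hu, rfl⟩ := hlast hy
    obtain ⟨n₂, h₂⟩ := ih hy hw
    have h3 : returnBase S (symbols (v ++ [d] ++ x)) true p' q' := by
      rw [symbols_append, symbols_concat, ← List.singleton_append, ← List.append_assoc, hy,
        returnBase_append]
      exact h'
    obtain ⟨n₁, h₁⟩ := (returnBase_iff_exists_run (T := T ++ [v ++ [d] ++ x]) (by simp)
      (by simpa using hw)).1 h3
    have h4 := step hu.symm (.clone h)
    rw [← hu] at h4
    exact ⟨1 + n₁ + n₂, (h4.trans (h₁.mono fun _ ht => ht.of_above)).trans h₂⟩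

theorem RunIn.to_loop {n : ℕ} {p q : Q} {T : Stack Γ} {v x : List (Letter Γ)} {d : Letter Γ}
    (h : RunIn S (Above T (v ++ [d])) n (p, T ++ [v ++ [d] ++ x]) (q, T ++ [v ++ [d]]))
    (hw : LinksLT (T.length + 1) (v ++ [d] ++ x)) :
    Loop S (returnBase S (symbols v)) p (symbols x ++ [d.sym]) q := by
  induction n using Nat.strong_induction_on generalizing p x with
  | _ n ih =>
  generalize hc' : (q, T ++ [v ++ [d]]) = c' at h
  generalize hc : (p, T ++ [v ++ [d] ++ x]) = c at h
  cases h with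
  | refl =>
    obtain ⟨rfl, h⟩ := Prod.mk.inj (hc.trans hc'.symm)
    have h : x = [] := by simpa using h
    subst h
    exact .refl _ _
  | @head n _ c₁ _ h1 hs h' =>
    subst hc hc'
    obtain ⟨p', t⟩ := c₁
    have ht : Above T (v ++ [d]) t := by
      cases h' with
      | refl => exact above_self _ _
      | head h _ _ => exact h
    obtain ⟨u, a, hu, hsym⟩ : ∃ u a, v ++ [d] ++ x = u ++ [a] ∧
        ∃ y, symbols x ++ [d.sym] = a.sym :: y := by
      rcases List.eq_nil_or_concat' x with rfl | ⟨x, b, rfl⟩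
      · exact ⟨v, d, by simp, _, rfl⟩
      · exact ⟨v ++ [d] ++ x, b, by simp, _, by rw [symbols_concat]; rfl⟩
    obtain ⟨y, hsym⟩ := hsym
    rw [hu, step_concat_iff] at hs
    cases hs with
    | push b hb =>
      rw [← hu, List.append_assoc _ x] at h'
      have h2 := ih n (by omega) h' (by
        rw [← List.append_assoc]; exact hw.freshLetter (by omega) _ _)
      rw [symbols_concat, List.cons_append, hsym, sym_freshLetter] at h2
      rw [hsym]
      exact .push b hb h2
    | clone hcl =>
      rw [← hu] at h'
      obtain ⟨k, l, q', h2, h5, hkl⟩ := h'.exists_return (above_nil_concat _ _)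
        (fun h => by simpa using h.length_lt) (fun _ => Above.nil) (above_nil_concat _ _)
      have h6 := (returnBase_iff_exists_run (T := T ++ [v ++ [d] ++ x]) (by simp)
          (by simpa using hw)).2 ⟨k, h2⟩
      have h7 := ih l (by omega) h5 hw
      rw [symbols_append, symbols_concat, ← List.singleton_append, ← List.append_assoc, hsym,
        returnBase_append] at h6
      rw [hsym] at h7 ⊢
      exact .clone hcl h6 h7
    | pop1 hp hv =>
      obtain ⟨x', rest, ht⟩ := ht
      have ht : u = v ++ [d] ++ x' ∧ rest = [] := by simpa using ht
      obtain ⟨rfl, -⟩ := ht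
      obtain rfl : x = x' ++ [a] := by simpa using hu
      have h2 := ih n (by omega) h' (hw.of_prefix ⟨[a], by simp⟩)
      rw [symbols_concat, List.cons_append]
      obtain ⟨c, y', hc⟩ := List.exists_cons_of_ne_nil
        (show symbols x' ++ [d.sym] ≠ [] by simp)
      rw [hc] at h2 ⊢
      exact .pop hp h2
    | pop2 hp hT' => exact absurd List.prefix_rfl ht.not_prefix
    | collapse hc h2 h0 =>
      have h3 : a.2.2 ≤ T.length := Nat.lt_succ_iff.1 (hw a (by simp [hu]) h2)
      rw [List.take_append_of_le_length h3] at ht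
      exact absurd (List.take_prefix _ _) ht.not_prefix

end Loops

section WordStates

variable {Γ Q : Type*}

/-! ### The finite information about a word -/

/-- What the tree automaton remembers of a nonempty word: its topmost letter, the relation
`returnBase` of the word below this letter, and the relation of all pairs of states that are
connected by a run from a stack with this word (as a cloned word) on top to the same stack, which
stays strictly above the stack without the topmost word. -/
abbrev WordState (Γ Q : Type*) := (Γ × Level) × (Bool → Q → Q → Prop) × (Q → Q → Prop)

/-- The relation `returnBase` of the word itself. -/
def WordState.ret (S : CPS Γ Q) (W : WordState Γ Q) : Bool → Q → Q → Prop :=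
  fun m p q => Return S W.2.1 m p (unmarked [W.1]) q

/-- The information about a word with one more letter `b`.  A run of the kind recorded in the third
component consists of loops and of excursions below `b`; an excursion can only restore `b` if `b`
has level `1`, because the link of a letter of level `2` changes. -/
def WordState.next (S : CPS Γ Q) (W : WordState Γ Q) (b : Γ × Level) : WordState Γ Q :=
  (b, W.ret S, Relation.ReflTransGen fun p q => Loop S (W.ret S) p [b] q ∨
    (b.2 = .one ∧ ∃ p' q', PopStep S p b p' ∧ W.2.2 p' q' ∧ PushStep S q' W.1.1 b q))

/-- The information about the word with topmost letter `a` and rest `x`. -/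
def wordState (S : CPS Γ Q) : Γ × Level → List (Γ × Level) → WordState Γ Q
  | a, [] => (a, returnBase S [], fun p q => Loop S (returnBase S []) p [a] q)
  | a, c :: x => (wordState S c x).next S a

variable (S : CPS Γ Q)

@[simp] theorem wordState_fst (a : Γ × Level) (x : List (Γ × Level)) :
    (wordState S a x).1 = a := by
  cases x <;> rfl

theorem wordState_snd (a : Γ × Level) (x : List (Γ × Level)) :
    (wordState S a x).2.1 = returnBase S x := by
  induction x generalizing a with
  | nil => rfl
  | cons c x ih =>
    rw [← List.singleton_append, returnBase_append, ← ih c]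
    funext m p q
    simp [wordState, WordState.next, WordState.ret]

theorem wordState_ret (a : Γ × Level) (x : List (Γ × Level)) :
    (wordState S a x).ret S = returnBase S (a :: x) :=
  wordState_snd S a (a :: x)

/-- The links of the letters of level `1` are their positions. -/
def PositionLinks (w : List (Letter Γ)) : Prop :=
  ∀ v a, v ++ [a] <+: w → a.2.1 = .one → a.2.2 = v.length

variable {S}

theorem PositionLinks.of_prefix {v w : List (Letter Γ)} (h : PositionLinks w) (hv : v <+: w) :
    PositionLinks v := fun u a hu => h u a (hu.trans hv)

theorem loop_iff_exists_run {T : Stack Γ} {v : List (Letter Γ)} {d : Letter Γ} {p q : Q}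
    (hw : LinksLT (T.length + 1) (v ++ [d])) :
    Loop S (returnBase S (symbols v)) p [d.sym] q ↔
      ∃ n, RunIn S (Above T (v ++ [d])) n (p, T ++ [v ++ [d]]) (q, T ++ [v ++ [d]]) := by
  constructor
  · intro h
    simpa using h.exists_run (T := T) (x := []) rfl (by simpa using hw)
  · rintro ⟨n, h⟩
    rw [← List.append_nil (v ++ [d])] at hw
    exact RunIn.to_loop (x := []) (by simpa using h) hw

/-- The third component of the information about a word, in terms of runs. -/
theorem wordState_loops_iff {T : Stack Γ} {v : List (Letter Γ)} {d : Letter Γ} {p q : Q}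
    (hT : T ≠ []) (hw : LinksLT T.length (v ++ [d])) (hp : PositionLinks (v ++ [d])) :
    (wordState S d.sym (symbols v)).2.2 p q ↔
      ∃ n, RunIn S (Above T []) n (p, T ++ [v ++ [d]]) (q, T ++ [v ++ [d]]) := by
  have hloop := fun p q => loop_iff_exists_run (S := S) (T := T) (v := v) (d := d) (p := p) (q := q)
    (hw.mono (by omega))
  induction v using List.reverseRecOn generalizing d p q with
  | nil =>
    refine (hloop p q).trans (exists_congr fun n => ⟨fun h => h.mono fun _ => Above.nil, fun h => ?_⟩)
    refine (h.stay (P' := Above T ([] ++ [d])) (above_self _ _) (above_nil_concat _ _) ?_).1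
    intro c c' hc hs hc'
    by_contra h'
    rcases hc.exit hs h' with h1 | ⟨v, a, h1, hv, -⟩
    · exact hc'.not_prefix h1
    · exact hv (List.append_inj' h1 rfl).1.symm
  | append_singleton v e ih =>
    have hve : v ++ [e] <+: v ++ [e] ++ [d] := List.prefix_append _ _
    have ih' := fun p q => ih (d := e) (p := p) (q := q) (hw.of_prefix hve) (hp.of_prefix hve)
      fun p q => loop_iff_exists_run ((hw.of_prefix hve).mono (by omega))
    rw [symbols_concat] at hloop ⊢
    simp only [wordState, WordState.next, wordState_ret, wordState_fst]
    constructor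
    · intro h
      induction h with
      | refl => exact ⟨0, .refl _⟩
      | @tail q₁ q₂ _ h ih =>
        obtain ⟨n₁, h₁⟩ := ih
        rcases h with h | ⟨h1, p', q', h2, h3, h4⟩
        · obtain ⟨n₂, h₂⟩ := (hloop _ _).1 h
          exact ⟨_, h₁.trans (h₂.mono fun _ => Above.nil)⟩
        · obtain ⟨n₂, h₂⟩ := (ih' _ _).1 h3
          have s₁ := (step_concat_iff S (T := T)).2 (.pop1 (v := v ++ [e]) h2 (by simp))
          have s₂ := (step_concat_iff S (T := T)).2 (.push (v := v) (a := e) d.sym h4)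
          have hd : freshLetter d.sym T.length (v.length + 1) = d := by
            have h5 := hp _ _ List.prefix_rfl h1
            obtain ⟨σ, l, r⟩ := d
            obtain rfl : l = .one := h1
            obtain rfl : r = _ := h5
            simp [freshLetter, Letter.sym]
          rw [hd] at s₂
          exact ⟨_, ((h₁.trans (.single (above_nil_concat _ _) s₁)).trans h₂).trans
            (.single (above_nil_concat _ _) s₂)⟩
    · rintro ⟨n, h⟩
      induction n using Nat.strong_induction_on generalizing p with
      | _ n ihn =>
      rcases h.split (Above T (v ++ [e] ++ [d])) with h1 | ⟨k, m, c₁, h1, h2, h3, h4, hkm, -⟩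
      · exact .single (.inl ((hloop _ _).2 ⟨n, h1⟩))
      · -- The run leaves the stacks above `v ++ [e] ++ [d]`, by removing `d`.
        obtain ⟨k, rfl⟩ : ∃ l, k = l + 1 := by
          rcases k with _ | k
          · cases h1
            exact absurd (above_self _ _) h2
          · exact ⟨k, rfl⟩
        obtain ⟨⟨p₁, t₁⟩, h1', h5, hs⟩ := h1.exists_last_step
        obtain ⟨p₂, t₂⟩ := c₁
        rcases h5.exit hs h2 with h6 | ⟨v', a, h6, -, rfl : t₁ = _, rfl : t₂ = _, hpop⟩
        · exact absurd h6 h3.not_prefix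
        obtain ⟨rfl, h6⟩ := List.append_inj' h6 rfl
        obtain rfl : d = a := by simpa using h6
        -- It comes back later, by pushing `d` again.
        obtain ⟨k', m', ⟨q₂, t₂⟩, h6, h7, h8, h9, hkm'⟩ := h4.exists_first_exit
          (P' := fun t => Above T [] t ∧ ¬ Above T (v ++ [e] ++ [d]) t) (fun _ h => h) (above_nil_concat _ _)
          (fun h => h.2 (above_self _ _))
        replace h7 : Above T (v ++ [e] ++ [d]) t₂ := by
          by_contra h
          exact h7 ⟨h8, h⟩
        obtain ⟨k', rfl⟩ : ∃ l, k' = l + 1 := by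
          rcases k' with _ | k'
          · cases h6
            exact absurd h7 h2
          · exact ⟨k', rfl⟩
        obtain ⟨⟨q₁, t₁⟩, h6, h10, hs'⟩ := h6.exists_last_step
        rcases Above.enter h10.2 hs' h7 with rfl | ⟨v', a, b, h11, rfl : t₁ = _, rfl : t₂ = _, hpush⟩
        · exact absurd List.prefix_rfl h10.1.not_prefix
        obtain ⟨h12, h11⟩ := List.append_inj' h11 rfl
        obtain ⟨rfl, h12⟩ := List.append_inj' h12 rfl
        obtain rfl : e = a := by simpa using h12
        obtain rfl : d = _ := by simpa using h11
        have hone : b.2 = .one := by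
          by_contra h
          obtain ⟨σ, _ | _⟩ := b
          · exact h rfl
          · exact absurd (hw (freshLetter (σ, .two) T.length (v.length + 1)) (by simp) rfl)
              (lt_irrefl T.length)
        refine .trans (.single (.inl ((hloop _ _).2 ⟨k, h1'⟩))) (.trans (.single (.inr
          ⟨hone, p₂, q₁, hpop, (ih' _ _).2 ⟨k', h6.mono fun _ h => h.1⟩, ?_⟩))
          (ihn m' (by omega) h9))
        exact hpush

end WordStates

/-! ### Milestones -/

section Milestones

variable {Γ Q : Type*}

/-- The stack `M = T ++ [v]` is a milestone of `t` if `t` extends `T` by a word that begins with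
`v`, and the common prefix of this word and the topmost word of `T` is no longer than `v`.  Every
run that creates `t` from the initial stack visits all milestones of `t`. -/
def IsMilestone (M t : Stack Γ) : Prop :=
  ∃ T v x rest, M = T ++ [v] ∧ t = T ++ (v ++ x) :: rest ∧
    ∀ w ∈ T.getLast?, ∀ u, u <+: w → u <+: v ++ x → u <+: v

theorem isMilestone_concat_iff {T t : Stack Γ} {v : List (Letter Γ)} :
    IsMilestone (T ++ [v]) t ↔ ∃ x rest, t = T ++ (v ++ x) :: rest ∧
      ∀ w ∈ T.getLast?, ∀ u, u <+: w → u <+: v ++ x → u <+: v := by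
  constructor
  · rintro ⟨T', v', x, rest, h, h', h''⟩
    obtain ⟨rfl, h⟩ := List.append_inj' h rfl
    obtain rfl : v = v' := by simpa using h
    exact ⟨x, rest, h', h''⟩
  · rintro ⟨x, rest, h, h'⟩
    exact ⟨T, v, x, rest, rfl, h, h'⟩

theorem IsMilestone.refl {M : Stack Γ} (h : M ≠ []) : IsMilestone M M := by
  obtain ⟨T, v, rfl⟩ := (List.eq_nil_or_concat' M).resolve_left h
  exact isMilestone_concat_iff.2 ⟨[], [], by simp, by simp⟩

theorem IsMilestone.ne_nil {M t : Stack Γ} (h : IsMilestone M t) : M ≠ [] := by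
  obtain ⟨T, v, x, rest, rfl, -⟩ := h
  simp

theorem IsMilestone.trans {M M' t : Stack Γ} (h : IsMilestone M M') (h' : IsMilestone M' t) :
    IsMilestone M t := by
  obtain ⟨T, v, x, rest, rfl, rfl, h⟩ := h
  obtain ⟨T', v', x', rest', e, rfl, h'⟩ := h'
  rw [isMilestone_concat_iff]
  rcases List.eq_nil_or_concat' rest with rfl | ⟨rest, y, rfl⟩
  · obtain ⟨rfl, e⟩ := List.append_inj' e rfl
    obtain rfl : v ++ x = v' := by simpa using e
    refine ⟨x ++ x', rest', by simp, fun w hw u hu hu' => h w hw u hu (h' w hw u hu ?_)⟩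
    simpa using hu'
  · rw [← List.cons_append, ← List.append_assoc] at e
    obtain ⟨rfl, -⟩ := List.append_inj' e rfl
    exact ⟨x, rest ++ (v' ++ x') :: rest', by simp, h⟩

theorem IsMilestone.eq_or_size_lt {M t : Stack Γ} (h : IsMilestone M t) :
    M = t ∨ (M.map fun w => w.length + 1).sum < (t.map fun w => w.length + 1).sum := by
  obtain ⟨T, v, x, rest, rfl, rfl, -⟩ := h
  rcases rest with _ | ⟨y, rest⟩
  · rcases x with _ | ⟨y, x⟩
    · simp
    · right; simp
  · right; simp; omega

theorem IsMilestone.antisymm {M t : Stack Γ} (h : IsMilestone M t) (h' : IsMilestone t M) :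
    M = t := by
  rcases h.eq_or_size_lt with h | h
  · exact h
  · rcases h'.eq_or_size_lt with h' | h'
    · exact h'.symm
    · omega

theorem IsMilestone.above {T t : Stack Γ} {v : List (Letter Γ)} (h : IsMilestone (T ++ [v]) t) :
    Above T v t := by
  obtain ⟨x, rest, rfl, -⟩ := isMilestone_concat_iff.1 h
  exact ⟨x, rest, rfl⟩

variable {S : CPS Γ Q}

/-- A stack only becomes a milestone by being visited. -/
theorem IsMilestone.enter {M : Stack Γ} {c c' : Q × Stack Γ} (h' : IsMilestone M c'.2)
    (hs : S.Step c c') (h : ¬ IsMilestone M c.2) : c'.2 = M := by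
  obtain ⟨T, v, rfl⟩ := (List.eq_nil_or_concat' M).resolve_left h'.ne_nil
  rw [isMilestone_concat_iff] at h h'
  obtain ⟨x, rest, ht', hcond⟩ := h'
  have hcond' : ∀ x', x' <+: x → ∀ w ∈ T.getLast?, ∀ u, u <+: w → u <+: v ++ x' → u <+: v :=
    fun x' hx w hw u hu hu' =>
      hcond w hw u hu (hu'.trans ((List.prefix_append_right_inj v).2 hx))
  by_cases ha : Above T v c.2
  · -- The word with prefix `v` changes, by the removal of a letter.
    obtain ⟨p, t⟩ := c
    obtain ⟨q, t'⟩ := c'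
    obtain ⟨T', u, a, rfl : t = _⟩ := exists_concat_of_step S hs
    rw [step_concat_iff] at hs
    obtain ⟨y, rest', ht⟩ := ha
    dsimp only at h ht' ht ⊢
    have hne : ¬ y <+: x := fun hy => h ⟨y, rest', ht, hcond' y hy⟩
    have hcontra : ∀ r, T ++ (v ++ x) :: rest <+: T ++ (v ++ y) :: r → False := by
      intro r hr
      rw [List.prefix_append_right_inj, List.cons_prefix_cons] at hr
      obtain rfl : x = y := by simpa using hr.1
      exact hne List.prefix_rfl
    rcases List.eq_nil_or_concat' rest' with rfl | ⟨rest', z, rfl⟩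
    · obtain ⟨rfl, hu⟩ := List.append_inj' ht rfl
      obtain hu : u ++ [a] = v ++ y := by simpa using hu
      cases hs with
      | push b _ =>
        rw [hu, List.append_right_inj, List.cons.injEq] at ht'
        exact absurd (by
          have := ht'.1
          rw [List.append_assoc, List.append_right_inj] at this
          exact ⟨_, this⟩) hne
      | clone _ =>
        rw [hu, List.append_assoc, List.append_right_inj, List.singleton_append,
          List.cons.injEq, List.append_right_inj] at ht'
        exact absurd (by rw [ht'.1]) hne
      | pop1 _ _ =>
        rw [List.append_right_inj, List.cons.injEq] at ht'
        obtain ⟨rfl, rfl⟩ := ht'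
        -- The removed letter belongs to the common prefix with the word below.
        have hy : y = x ++ [a] := by
          rw [List.append_assoc, List.append_right_inj] at hu
          exact hu.symm
        subst hy
        have h1 : ¬ ∀ w ∈ T'.getLast?, ∀ u, u <+: w → u <+: v ++ (x ++ [a]) → u <+: v :=
          fun hh => h ⟨x ++ [a], [], by simp, hh⟩
        push Not at h1
        obtain ⟨w, hw, u, hu1, hu2, hu3⟩ := h1
        rw [← List.append_assoc, List.prefix_concat_iff] at hu2
        rcases hu2 with rfl | hu2
        · have h2 := hcond w hw (v ++ x) ((List.prefix_append _ _).trans hu1) List.prefix_rfl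
          obtain rfl : x = [] := by
            have := h2.length_le
            rw [List.length_append] at this
            exact List.length_eq_zero_iff.1 (by omega)
          simp
        · exact absurd (hcond w hw u hu1 hu2) hu3
      | pop2 _ _ => exact absurd (congrArg List.length ht') (by simp)
      | collapse _ _ _ =>
        exact (hcontra [] (by
          rw [← ht', hu]
          exact List.take_prefix _ _)).elim
    · have ht : T' ++ [u ++ [a]] = T ++ (v ++ y) :: rest' ++ [z] := by simpa using ht
      obtain ⟨rfl, -⟩ := List.append_inj' ht rfl
      cases hs with
      | push b _ =>
        exact (hcontra (rest' ++ [u ++ [a] ++ [_]]) (by rw [← ht']; simp; rfl)).elim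
      | clone _ =>
        exact (hcontra (rest' ++ [u ++ [a], u ++ [a]]) (by rw [← ht']; simp)).elim
      | pop1 _ _ => exact (hcontra (rest' ++ [u]) (by rw [← ht']; simp)).elim
      | pop2 _ _ => exact (hcontra rest' (by rw [← ht'])).elim
      | collapse _ _ _ =>
        exact (hcontra (rest' ++ [u ++ [a]]) (by
          rw [← ht']
          refine (List.take_prefix _ _).trans ?_
          simp)).elim
  · rcases Above.enter ha hs (by rw [ht']; exact ⟨x, rest, rfl⟩) with h1 | ⟨_, _, _, _, _, h1, _⟩
    · -- Here the topmost word of `T` is cloned, and the common prefix is this whole word.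
      obtain ⟨p, t⟩ := c
      obtain ⟨q, t'⟩ := c'
      obtain ⟨T', u, a, rfl : t = _⟩ := exists_concat_of_step S hs
      rw [step_concat_iff] at hs
      dsimp only at h1 ht' ⊢
      subst h1
      cases hs with
      | clone _ =>
        rw [List.append_right_inj, List.cons.injEq] at ht'
        obtain ⟨h2, -⟩ := ht'
        have := hcond (u ++ [a]) (by simp) (u ++ [a]) List.prefix_rfl (by rw [h2])
        rw [h2] at this
        obtain rfl : x = [] := by
          have := this.length_le
          rw [List.length_append] at this
          exact List.length_eq_zero_iff.1 (by omega)
        rw [h2]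
        simp
      | _ =>
        have := congrArg List.length ht'
        simp at this
        try omega
    · exact h1

end Milestones

/-! ### Last visits and certificates -/

section Paths

variable {Γ Q : Type*}

/-- A run from one configuration to another, where the list contains the configurations after the
first one. -/
inductive Path (S : CPS Γ Q) : Q × Stack Γ → List (Q × Stack Γ) → Q × Stack Γ → Prop
  | refl (c) : Path S c [] c
  | cons {c d l c'} : S.Step c d → Path S d l c' → Path S c (d :: l) c'

/-- `d` is the configuration at the last visit of its stack on the run given by `l`. -/
def LastVisit (S : CPS Γ Q) (c : Q × Stack Γ) (l : List (Q × Stack Γ)) (c' d : Q × Stack Γ) :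
    Prop :=
  ∃ l₁ l₂, l = l₁ ++ l₂ ∧ Path S c l₁ d ∧ Path S d l₂ c' ∧ ∀ e ∈ l₂, e.2 ≠ d.2

/-- A run from `c` to `c'` that leaves the stack of `c` for good at its beginning. -/
def Segment (S : CPS Γ Q) (c c' : Q × Stack Γ) : Prop :=
  c'.2 ≠ c.2 ∧ ∃ l, Path S c l c' ∧ ∀ e ∈ l, e.2 ≠ c.2

variable {S : CPS Γ Q} {c c' d : Q × Stack Γ} {l l₁ l₂ : List (Q × Stack Γ)}

theorem Path.append (h : Path S c l₁ d) (h' : Path S d l₂ c') : Path S c (l₁ ++ l₂) c' := by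
  induction h with
  | refl => exact h'
  | cons hs _ ih => exact .cons hs (ih h')

theorem Path.mem (h : Path S c l c') : c' ∈ c :: l := by
  induction h with
  | refl => simp
  | cons _ _ ih => exact List.mem_cons_of_mem _ ih

theorem Path.eq_of_eq (h : Path S c l c') (h' : Path S c l d) : c' = d := by
  induction h with
  | refl => cases h'; rfl
  | cons _ _ ih =>
    cases h' with
    | cons _ h' => exact ih h'

theorem Path.exists_of_append (h : Path S c (l₁ ++ l₂) c') :
    ∃ d, Path S c l₁ d ∧ Path S d l₂ c' := by
  induction l₁ generalizing c with
  | nil => exact ⟨c, .refl _, h⟩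
  | cons e l₁ ih =>
    cases h with
    | cons hs h =>
      obtain ⟨d, h1, h2⟩ := ih h
      exact ⟨d, .cons hs h1, h2⟩

theorem Path.runIn {P : Stack Γ → Prop} (h : Path S c l c') (hc : P c.2) (hl : ∀ e ∈ l, P e.2) :
    RunIn S P l.length c c' := by
  induction h with
  | refl => exact .refl _
  | cons hs _ ih =>
    exact .head hc hs (ih (hl _ (by simp)) fun e he => hl e (List.mem_cons_of_mem _ he))

theorem RunIn.path {P : Stack Γ → Prop} {n : ℕ} (h : RunIn S P n c c') (hc' : P c'.2) :
    ∃ l, Path S c l c' ∧ ∀ e ∈ c :: l, P e.2 := by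
  induction h with
  | refl => exact ⟨[], .refl _, by simpa using hc'⟩
  | head h1 hs _ ih =>
    obtain ⟨l, h2, h3⟩ := ih hc'
    exact ⟨_ :: l, .cons hs h2, List.forall_mem_cons.2 ⟨h1, h3⟩⟩

/-- A run to a stack with milestone `M` visits `M`, unless `M` is a milestone of all its stacks. -/
theorem Path.lastVisit_or (h : Path S c l c') {M : Stack Γ} (hM : IsMilestone M c'.2) :
    (∃ q, LastVisit S c l c' (q, M)) ∨ ∀ e ∈ c :: l, IsMilestone M e.2 ∧ e.2 ≠ M := by
  induction h with
  | refl c =>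
    by_cases hc : c.2 = M
    · exact .inl ⟨c.1, [], [], rfl, by rw [← hc]; exact .refl _, by rw [← hc]; exact .refl _, by simp⟩
    · exact .inr (by simpa using ⟨hM, hc⟩)
  | @cons c d l c' hs h ih =>
    rcases ih hM with ⟨q, l₁, l₂, rfl, h1, h2, h3⟩ | h1
    · exact .inl ⟨q, d :: l₁, l₂, rfl, .cons hs h1, h2, h3⟩
    · by_cases hc : c.2 = M
      · exact .inl ⟨c.1, [], d :: l, rfl, by rw [← hc]; exact .refl _,
          by rw [← hc]; exact .cons hs h, fun e he => (h1 e he).2⟩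
      · have h2 := h1 d (by simp)
        by_cases hc' : IsMilestone M c.2
        · exact .inr (List.forall_mem_cons.2 ⟨⟨hc', hc⟩, h1⟩)
        · exact absurd (h2.1.enter hs hc') h2.2

theorem Path.isMilestone (h : Path S c l c') {M : Stack Γ} (hM : IsMilestone M c'.2)
    (hl : ∀ e ∈ l, e.2 ≠ M) : ∀ e ∈ c :: l, IsMilestone M e.2 := by
  induction h with
  | refl => simpa using hM
  | cons hs h ih =>
    have h1 := ih hM fun e he => hl e (List.mem_cons_of_mem _ he)
    refine List.forall_mem_cons.2 ⟨?_, h1⟩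
    by_contra h2
    exact hl _ (by simp) ((h1 _ (by simp)).enter hs h2)

/-- Segments between consecutive milestones are concatenated to a run in which they end at last
visits. -/
theorem exists_path_of_isChain {cs : List (Q × Stack Γ)} (hc : c.2 ≠ [])
    (h : (c :: cs).IsChain fun c d => Segment S c d ∧ IsMilestone c.2 d.2) :
    ∃ l e, (c :: cs).getLast? = some e ∧ Path S c l e ∧ IsMilestone c.2 e.2 ∧
      (∀ e ∈ l, e.2 ≠ c.2) ∧ ∀ d ∈ c :: cs, LastVisit S c l e d := by
  induction cs generalizing c with
  | nil =>
    refine ⟨[], c, rfl, .refl _, .refl hc, by simp, ?_⟩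
    simp only [List.mem_singleton, forall_eq]
    exact ⟨[], [], rfl, .refl _, .refl _, by simp⟩
  | cons d cs ih =>
    obtain ⟨⟨⟨hdc, l₁, hl₁, hl₁'⟩, hm⟩, h⟩ := List.isChain_cons_cons.1 h
    obtain ⟨l₂, e, he, hl₂, hde, hl₂', hlast⟩ := ih (by
      obtain ⟨T, v, x, r, -, h, -⟩ := hm
      simp [h]) h
    have hav : ∀ e ∈ l₁ ++ l₂, e.2 ≠ c.2 := by
      intro e he
      rcases List.mem_append.1 he with he | he
      · exact hl₁' e he
      · intro hec
        have := hl₂.isMilestone hde hl₂' e (List.mem_cons_of_mem _ he)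
        rw [hec] at this
        exact hdc (this.antisymm hm)
    have hp := hl₁.append hl₂
    refine ⟨l₁ ++ l₂, e, by rw [List.getLast?_cons_cons]; exact he, hp, hm.trans hde, hav, ?_⟩
    refine List.forall_mem_cons.2 ⟨⟨[], _, rfl, .refl _, hp, hav⟩, fun a ha => ?_⟩
    obtain ⟨m₁, m₂, rfl, h1, h2, h3⟩ := hlast a ha
    exact ⟨l₁ ++ m₁, m₂, by simp, hl₁.append h1, h2, h3⟩

/-- After a last visit of `d`, the last visits of other stacks with milestone `d.2` are to come. -/
theorem LastVisit.of_append {a : Q × Stack Γ} (h : LastVisit S c (l₁ ++ l₂) c' a)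
    (h₁ : Path S c l₁ d) (h₂ : Path S d l₂ c') (hd : IsMilestone d.2 a.2) (hne : d.2 ≠ a.2)
    (ha : IsMilestone a.2 c'.2) : LastVisit S d l₂ c' a := by
  obtain ⟨m₁, m₂, e, hm₁, hm₂, hav⟩ := h
  rcases List.append_eq_append_iff.1 e with ⟨k, rfl, rfl⟩ | ⟨k, rfl, rfl⟩
  · obtain ⟨b, hb, hb'⟩ := hm₁.exists_of_append
    obtain rfl := hb.eq_of_eq h₁
    exact ⟨k, m₂, rfl, hb', hm₂, hav⟩
  · have h3 := h₂.isMilestone ha (fun e he => hav e (List.mem_append_right _ he)) d (by simp)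
    exact absurd (hd.antisymm h3) hne

/-- A run in which the given configurations are last visits of successive milestones is composed of
segments. -/
theorem isChain_segment_of_lastVisit {cs : List (Q × Stack Γ)} (h : Path S c l c')
    (hl : ∀ e ∈ l, e.2 ≠ c.2)
    (hcs : (c :: cs).Pairwise fun c d => IsMilestone c.2 d.2 ∧ c.2 ≠ d.2)
    (hm : ∀ d ∈ cs, IsMilestone d.2 c'.2) (hlast : ∀ d ∈ cs, LastVisit S c l c' d) :
    (c :: cs).IsChain (Segment S) := by
  induction cs generalizing c l with
  | nil => exact .singleton _
  | cons d cs ih =>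
    obtain ⟨h1, h2⟩ := List.pairwise_cons.1 hcs
    obtain ⟨l₁, l₂, rfl, hl₁, hl₂, hav⟩ := hlast d (by simp)
    refine List.isChain_cons_cons.2 ⟨⟨(h1 d (by simp)).2.symm, l₁, hl₁,
      fun e he => hl e (List.mem_append_left _ he)⟩, ih hl₂ hav h2
      (fun a ha => hm a (List.mem_cons_of_mem _ ha)) fun a ha => ?_⟩
    have h3 := (List.pairwise_cons.1 h2).1 a ha
    exact (hlast a (List.mem_cons_of_mem _ ha)).of_append hl₁ hl₂ h3.1 h3.2
      (hm a (List.mem_cons_of_mem _ ha))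

theorem path_iff : Path S c l c' ↔ (c :: l).IsChain S.Step ∧ (c :: l).getLast? = some c' := by
  induction l generalizing c with
  | nil =>
    constructor
    · rintro ⟨⟩
      simp
    · rintro ⟨-, h⟩
      obtain rfl : c = c' := by simpa using h
      exact .refl _
  | cons d l ih =>
    rw [List.isChain_cons_cons, List.getLast?_cons_cons]
    constructor
    · rintro (_ | ⟨hs, h⟩)
      exact ⟨⟨hs, (ih.1 h).1⟩, (ih.1 h).2⟩
    · rintro ⟨⟨hs, h⟩, h'⟩
      exact .cons hs (ih.2 ⟨h, h'⟩)

theorem lastVisit_iff (h : Path S c l c') : LastVisit S c l c' d ↔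
    ∃ (i : ℕ) (hi : i < (c :: l).length), (c :: l)[i] = d ∧
      ∀ (j : ℕ) (hj : j < (c :: l).length), i < j → ((c :: l)[j]).2 ≠ d.2 := by
  constructor
  · rintro ⟨l₁, l₂, rfl, h1, h2, h3⟩
    refine ⟨l₁.length, by simp, ?_, ?_⟩
    · have h4 := (path_iff.1 h1).2
      rw [List.getLast?_eq_getElem?] at h4
      rw [← Option.some_inj, ← List.getElem?_eq_getElem, ← List.cons_append,
        List.getElem?_append_left (by simp)]
      simpa using h4
    · intro j hj hij
      refine h3 _ ?_
      obtain ⟨k, rfl⟩ : ∃ k, j = k + 1 := ⟨j - 1, by omega⟩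
      rw [List.getElem_cons_succ, List.getElem_append_right (by omega)]
      exact List.getElem_mem _
  · rintro ⟨i, hi, h1, h2⟩
    have h3 := h
    rw [← List.take_append_drop i l] at h3
    obtain ⟨e, he, he'⟩ := h3.exists_of_append
    obtain rfl : e = d := by
      have h4 := (path_iff.1 he).2
      rw [List.getLast?_eq_getElem?] at h4
      rw [← h1, ← Option.some_inj, ← List.getElem?_eq_getElem, ← h4]
      have : i ≤ l.length := by simpa [Nat.lt_succ_iff] using hi
      rcases i with _ | i
      · simp
      · simp [Nat.min_eq_left this]
    refine ⟨_, _, (List.take_append_drop i l).symm, he, he', fun a ha => ?_⟩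
    obtain ⟨j, hj, rfl⟩ := List.getElem_of_mem ha
    have := h2 (i + j + 1) (by simp at hj ⊢; omega) (by omega)
    simpa using this

/-- Certificates in terms of `Path`. -/
theorem CPS.isCertificate_iff [DecidableEq Γ] (S : CPS Γ Q) (f : S.Position c → Q) :
    S.IsCertificate c f ↔ ∃ l, Path S S.initialConfig l c ∧
      ∀ d : S.Position c, LastVisit S S.initialConfig l c (f d, S.leftStack c.2 d.1) := by
  constructor
  · rintro ⟨r, h0, hlast, hf⟩
    have hl : List.ofFn r.config =
        S.initialConfig :: List.ofFn fun i : Fin r.length => r.config i.succ := by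
      rw [List.ofFn_succ, h0]
    have hp : Path S S.initialConfig (List.ofFn fun i : Fin r.length => r.config i.succ) c := by
      rw [path_iff, ← hl]
      constructor
      · rw [List.isChain_iff_getElem]
        intro i hi
        simp only [List.getElem_ofFn]
        exact r.step ⟨i, by simpa [-List.ofFn_succ] using hi⟩
      · rw [List.getLast?_eq_getElem?]
        rw [List.length_ofFn, Nat.add_sub_cancel, List.getElem?_eq_getElem (by simp),
          List.getElem_ofFn]
        exact congrArg some hlast
    refine ⟨_, hp, fun d => ?_⟩
    obtain ⟨i, hi, hj⟩ := hf d
    rw [lastVisit_iff hp]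
    refine ⟨i, by simpa using i.2, ?_, ?_⟩
    · simp only [← hl]
      simpa [-List.ofFn_succ] using hi
    · intro j hj' hij
      simp only [← hl]
      simpa [-List.ofFn_succ] using hj ⟨j, by simpa using hj'⟩ hij
  · rintro ⟨l, hp, hf⟩
    obtain ⟨h1, h2⟩ := path_iff.1 hp
    refine ⟨⟨l.length, fun i => (S.initialConfig :: l)[i], fun i => ?_⟩, rfl, ?_, fun d => ?_⟩
    · exact (List.isChain_iff_getElem.1 h1) i (by simp)
    · rw [List.getLast?_eq_getElem?] at h2
      rw [← Option.some_inj, ← h2]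
      simp
    · obtain ⟨i, hi, hd, hj⟩ := (lastVisit_iff hp).1 (hf d)
      exact ⟨⟨i, hi⟩, hd, fun j hij => hj j j.2 hij⟩

end Paths

/-! ### Segments between consecutive left stacks -/

section Segments

variable {Γ Q : Type*} {S : CPS Γ Q}

/-- A segment to a stack of which the initial stack is a milestone, in terms of `RunIn`. -/
theorem segment_iff_exists_runIn {c c' : Q × Stack Γ} (h : IsMilestone c.2 c'.2) :
    Segment S c c' ↔ c'.2 ≠ c.2 ∧ ∃ d n, S.Step c d ∧ IsMilestone c.2 d.2 ∧ d.2 ≠ c.2 ∧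
      RunIn S (fun t => IsMilestone c.2 t ∧ t ≠ c.2) n d c' := by
  refine and_congr_right fun hne => ⟨?_, ?_⟩
  · rintro ⟨l, hp, hl⟩
    have hm := hp.isMilestone h hl
    cases hp with
    | refl => exact absurd rfl hne
    | @cons _ d l _ hs hp =>
      refine ⟨d, _, hs, hm d (by simp), hl d (by simp), hp.runIn ⟨hm d (by simp), hl d (by simp)⟩
        fun e he => ⟨hm e (by simp [he]), hl e (by simp [he])⟩⟩
  · rintro ⟨d, n, hs, -, -, hr⟩
    obtain ⟨l, hp, hl⟩ := hr.path ⟨h, hne⟩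
    exact ⟨d :: l, .cons hs hp, fun e he => (hl e he).2⟩

theorem RunIn.stay_above_push {T : Stack Γ} {u : List (Letter Γ)} {a : Letter Γ} {n : ℕ}
    {c c' : Q × Stack Γ}
    (h : RunIn S (fun t => IsMilestone (T ++ [u]) t ∧ t ≠ T ++ [u]) n c c')
    (hc : Above T (u ++ [a]) c.2) (hc' : IsMilestone (T ++ [u]) c'.2) (hne : c'.2 ≠ T ++ [u]) :
    RunIn S (Above T (u ++ [a])) n c c' ∧ Above T (u ++ [a]) c'.2 := by
  refine h.stay hc ⟨hc', hne⟩ ?_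
  intro d d' hd hs hd'
  by_contra h'
  rcases hd.exit hs h' with h1 | ⟨v, b, h1, -, -, h2, -⟩
  · exact hd'.1.above.not_prefix h1
  · obtain ⟨rfl, -⟩ := List.append_inj' h1 rfl
    exact hd'.2 h2

theorem RunIn.stay_above_clone {T : Stack Γ} {u : List (Letter Γ)} {n : ℕ} {c c' : Q × Stack Γ}
    (h : RunIn S (fun t => IsMilestone (T ++ [u]) t ∧ t ≠ T ++ [u]) n c c')
    (hc : Above (T ++ [u]) [] c.2) (hc' : IsMilestone (T ++ [u]) c'.2) (hne : c'.2 ≠ T ++ [u]) :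
    RunIn S (Above (T ++ [u]) []) n c c' ∧ Above (T ++ [u]) [] c'.2 := by
  refine h.stay hc ⟨hc', hne⟩ ?_
  intro d d' hd hs hd'
  by_contra h'
  rcases hd.exit hs h' with h1 | ⟨v, b, h1, -⟩
  · have h2 := hd'.1.above.length_lt
    exact hd'.2 (h1.eq_of_length (le_antisymm h1.length_le (by simpa using h2)))
  · simp at h1

/-- After the last visit of a milestone of `t`, a step pushes or clones. -/
theorem step_of_isMilestone {T t : Stack Γ} {v : List (Letter Γ)} {e : Letter Γ} {p q : Q}
    (hs : StepAt S T v e p q t) (h : IsMilestone (T ++ [v ++ [e]]) t) (hne : t ≠ T ++ [v ++ [e]]) :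
    (∃ b, PushStep S p e.1 b q ∧ t = T ++ [v ++ [e] ++ [freshLetter b T.length (v.length + 1)]]) ∨
      ((p, e.1, q, StackOp.clone) ∈ S.trans ∧ t = T ++ [v ++ [e]] ++ [v ++ [e]]) := by
  have hpre : ∀ {t'}, t' <+: T ++ [v ++ [e]] → IsMilestone (T ++ [v ++ [e]]) t' →
      t' = T ++ [v ++ [e]] := by
    intro t' h1 h2
    have h3 := h2.above.length_lt
    exact h1.eq_of_length (le_antisymm h1.length_le (by simpa using h3))
  cases hs with
  | push b hb => exact .inl ⟨b, hb, rfl⟩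
  | clone hc => exact .inr ⟨hc, rfl⟩
  | pop1 _ _ =>
    obtain ⟨x, rest, h⟩ := h.above
    simp at h
  | pop2 _ _ => exact absurd (hpre (List.prefix_append _ _) h) hne
  | collapse _ _ _ => exact absurd (hpre (List.take_prefix _ _) h) hne

theorem segment_push_iff {T : Stack Γ} {v : List (Letter Γ)} {e : Letter Γ} {b : Γ × Level}
    {p q : Q}
    (hm : IsMilestone (T ++ [v ++ [e]])
      (T ++ [v ++ [e] ++ [freshLetter b T.length (v.length + 1)]]))
    (hw : LinksLT (T.length + 1) (v ++ [e])) :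
    Segment S (p, T ++ [v ++ [e]])
        (q, T ++ [v ++ [e] ++ [freshLetter b T.length (v.length + 1)]]) ↔
      ∃ p', PushStep S p e.1 b p' ∧ Loop S (returnBase S (symbols (v ++ [e]))) p' [b] q := by
  have hloop := fun p' => loop_iff_exists_run (S := S) (T := T) (v := v ++ [e])
    (d := freshLetter b T.length (v.length + 1)) (p := p') (q := q)
    (hw.freshLetter (by omega) _ _)
  rw [sym_freshLetter] at hloop
  have hne : T ++ [v ++ [e] ++ [freshLetter b T.length (v.length + 1)]] ≠ T ++ [v ++ [e]] := by
    simp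
  constructor
  · intro h
    obtain ⟨-, ⟨p', t⟩, n, hs, ht, hne', hr⟩ := (segment_iff_exists_runIn hm).1 h
    dsimp only at ht hne' hr hne
    rw [step_concat_iff] at hs
    rcases step_of_isMilestone hs ht hne' with ⟨b', hb, rfl⟩ | ⟨hc, rfl⟩
    · obtain ⟨h1, x, rest, h2⟩ := hr.stay_above_push (above_self _ _) hm hne
      have h2 : (freshLetter b T.length (v.length + 1) = freshLetter b' T.length (v.length + 1) ∧
          x = []) ∧ rest = [] := by simpa using h2
      obtain rfl : b = b' := by simpa using congrArg Letter.sym h2.1.1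
      exact ⟨p', hb, (hloop p').2 ⟨n, h1⟩⟩
    · have h1 := (hr.stay_above_clone (above_nil_concat _ _) hm hne).2.length_lt
      simp at h1
  · rintro ⟨p', hb, h⟩
    obtain ⟨n, hn⟩ := (hloop p').1 h
    obtain ⟨l, h1, h2⟩ := hn.path (above_self _ _)
    refine ⟨hne, _ :: l, .cons ((step_concat_iff S).2 (.push b hb)) h1, fun d hd hd' => ?_⟩
    have h3 := h2 d hd
    dsimp only at hd'
    rw [hd'] at h3
    obtain ⟨x, rest, h3⟩ := h3
    have h5 := congrArg List.length h3
    have h6 : rest = [] := by simpa using h5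
    subst h6
    have h7 := congrArg (fun t => t.getLast?.map List.length) h3
    simp at h7

theorem segment_clone_iff {T : Stack Γ} {v u : List (Letter Γ)} {e : Letter Γ} {p q : Q} :
    Segment S (p, T ++ [v ++ [e]]) (q, T ++ [v ++ [e]] ++ [u]) ↔
      ∃ p', (p, e.1, p', StackOp.clone) ∈ S.trans ∧ ∃ n, RunIn S (Above (T ++ [v ++ [e]]) []) n
        (p', T ++ [v ++ [e]] ++ [v ++ [e]]) (q, T ++ [v ++ [e]] ++ [u]) := by
  have hm : IsMilestone (T ++ [v ++ [e]]) (T ++ [v ++ [e]] ++ [u]) :=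
    isMilestone_concat_iff.2 ⟨[], [u], by simp, by simp⟩
  have hne : T ++ [v ++ [e]] ++ [u] ≠ T ++ [v ++ [e]] := by simp
  constructor
  · intro h
    obtain ⟨-, ⟨p', t⟩, n, hs, ht, hne', hr⟩ := (segment_iff_exists_runIn hm).1 h
    dsimp only at ht hne' hr
    rw [step_concat_iff] at hs
    rcases step_of_isMilestone hs ht hne' with ⟨b', hb, rfl⟩ | ⟨hc, rfl⟩
    · obtain ⟨h1, x, rest, h2⟩ := hr.stay_above_push (above_self _ _) hm hne
      simp at h2
    · exact ⟨p', hc, n, (hr.stay_above_clone (above_nil_concat _ _) hm hne).1⟩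
  · rintro ⟨p', hc, n, hn⟩
    obtain ⟨l, h1, h2⟩ := hn.path (above_nil_concat _ _)
    refine ⟨hne, _ :: l, .cons ((step_concat_iff S).2 (.clone hc)) h1, fun d hd hd' => ?_⟩
    have h3 := (h2 d hd).length_lt
    rw [hd'] at h3
    exact lt_irrefl _ h3

/-- A run that shortens a cloned word by several letters, in terms of its last visit before the
last of these letters is removed for the first time. -/
theorem exists_run_to_prefix_iff {T : Stack Γ} {w u : List (Letter Γ)} {a : Letter Γ} {p q : Q}
    (hu : u ++ [a] <+: w) (hu0 : u ≠ []) :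
    (∃ n, RunIn S (Above T []) n (p, T ++ [w]) (q, T ++ [u])) ↔
      ∃ g, (∃ n, RunIn S (Above T []) n (p, T ++ [w]) (g, T ++ [u ++ [a]])) ∧
        ∃ g', PopStep S g a.sym g' ∧
          ∃ n, RunIn S (Above T []) n (g', T ++ [u]) (q, T ++ [u]) := by
  constructor
  · rintro ⟨n, hn⟩
    obtain ⟨x, rfl⟩ := hu
    obtain ⟨k, m, ⟨g', t⟩, h1, h2, h3, h4, -⟩ := hn.exists_first_exit (P' := Above T (u ++ [a]))
      (fun _ h => h) (above_nil_concat _ _) (by rintro ⟨x, rest, h⟩; simp at h)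
    obtain ⟨k, rfl⟩ : ∃ l, k = l + 1 := by
      rcases k with _ | k
      · cases h1
        exact absurd (above_concat _ _ _) h2
      · exact ⟨k, rfl⟩
    obtain ⟨⟨g, t'⟩, h5, h6, hs⟩ := h1.exists_last_step
    rcases h6.exit hs h2 with h7 | ⟨v, b, h7, -, rfl : t' = _, rfl : t = _, hp⟩
    · exact absurd h7 h3.not_prefix
    · obtain ⟨rfl, h7⟩ := List.append_inj' h7 rfl
      obtain rfl : a = b := by simpa using h7
      exact ⟨g, ⟨k, h5.mono fun _ => Above.nil⟩, g', hp, m, h4⟩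
  · rintro ⟨g, ⟨n, hn⟩, g', hp, m, hm⟩
    have hs := (step_concat_iff S (T := T)).2 (.pop1 (v := u) hp hu0)
    exact ⟨_, (hn.trans (.single (above_nil_concat _ _) hs)).trans hm⟩

end Segments

section Trees

variable {Γ Q : Type*}

/-! ### The stack encoded by a tree -/

/-- The letter that the left subtree `l` stands for, at the top of a word of length `m` with `n`
words below it.  (If the root of `l` is not labelled by a symbol and a level, this is a dummy.) -/
def leftLetter (bot : Γ) (l : BinaryTree (Option (Γ × Level))) (n m : ℕ) : Letter Γ :=
  freshLetter ((labelAt l []).join.getD (bot, .one)) n m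

/-- The stack obtained from `T` by adding the words encoded by the tree, where `u` is the word that
belongs to the root of the tree. -/
def stackOf (bot : Γ) : BinaryTree (Option (Γ × Level)) → Stack Γ → List (Letter Γ) → Stack Γ
  | .nil, T, _ => T
  | .node _ l r, T, u =>
    stackOf bot r
      (match l with
        | .nil => T ++ [u]
        | .node _ _ _ => stackOf bot l T (u ++ [leftLetter bot l T.length u.length])) u

/-- The stack obtained from `T` by adding the first block of words encoded by a tree with left
subtree `l`. -/
def blockOf (bot : Γ) : BinaryTree (Option (Γ × Level)) → Stack Γ → List (Letter Γ) → Stack Γ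
  | .nil, T, u => T ++ [u]
  | .node ρ l r, T, u =>
    stackOf bot (.node ρ l r) T (u ++ [leftLetter bot (.node ρ l r) T.length u.length])

variable {bot : Γ}

@[simp] theorem stackOf_nil (T : Stack Γ) (u : List (Letter Γ)) : stackOf bot .nil T u = T := rfl

theorem stackOf_node (ρ : Option (Γ × Level)) (l r : BinaryTree (Option (Γ × Level))) (T : Stack Γ)
    (u : List (Letter Γ)) :
    stackOf bot (.node ρ l r) T u = stackOf bot r (blockOf bot l T u) u := by
  cases l <;> rfl

@[simp] theorem blockOf_nil (T : Stack Γ) (u : List (Letter Γ)) :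
    blockOf bot .nil T u = T ++ [u] := rfl

theorem blockOf_of_ne_nil {l : BinaryTree (Option (Γ × Level))} (hl : l ≠ .nil) (T : Stack Γ)
    (u : List (Letter Γ)) :
    blockOf bot l T u = stackOf bot l T (u ++ [leftLetter bot l T.length u.length]) := by
  cases l with
  | nil => exact absurd rfl hl
  | node => rfl

theorem labelAt_root_eq_none_iff {α : Type*} {t : BinaryTree α} :
    labelAt t [] = none ↔ t = .nil := by
  cases t <;> simp [labelAt]

theorem ne_nil_of_labelAt {α : Type*} {t : BinaryTree α} {a : α} (h : labelAt t [] = some a) :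
    t ≠ .nil := by
  rintro rfl
  cases h

theorem leftLetter_of_label {l : BinaryTree (Option (Γ × Level))} {b : Γ × Level}
    (h : labelAt l [] = some (some b)) (n m : ℕ) : leftLetter bot l n m = freshLetter b n m := by
  simp [leftLetter, h]

/-- The trees that encode blocklines.  The labels of left subtrees are symbols other than `⊥` with
a level, and right subtrees are labelled `ε`.  The label of a left subtree of the right subtree
differs from that of the left subtree (given as `ex` in the recursive call), if the level is `1`;
otherwise the two words would belong to the same block. -/
def ValidTree (bot : Γ) : Option (Γ × Level) → BinaryTree (Option (Γ × Level)) → Prop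
  | _, .nil => True
  | ex, .node _ l r =>
    (∀ τ, labelAt l [] = some τ → ∃ b, τ = some b ∧ b.1 ≠ bot ∧ (b.2 = .one → ex ≠ some b)) ∧
      (∀ τ, labelAt r [] = some τ → τ = none) ∧
      ValidTree bot none l ∧ ValidTree bot (labelAt l []).join r

theorem exists_stackOf_eq {t : BinaryTree (Option (Γ × Level))} (ht : t ≠ .nil) (T : Stack Γ)
    (u : List (Letter Γ)) : ∃ T' x, stackOf bot t T u = T' ++ [u ++ x] ∧ T <+: T' := by
  induction t generalizing T u with
  | nil => exact absurd rfl ht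
  | node ρ l r ihl ihr =>
    rw [stackOf_node]
    obtain ⟨T', x, h, hT'⟩ : ∃ T' x, blockOf bot l T u = T' ++ [u ++ x] ∧ T <+: T' := by
      by_cases hl : l = .nil
      · exact ⟨T, [], by simp [hl], List.prefix_rfl⟩
      · rw [blockOf_of_ne_nil hl]
        obtain ⟨T', x, h, h'⟩ := ihl hl T (u ++ [leftLetter bot l T.length u.length])
        exact ⟨T', _, by rw [h, List.append_assoc], h'⟩
    by_cases hr : r = .nil
    · exact ⟨T', x, by simp [hr, h], hT'⟩
    · obtain ⟨T'', y, h', hT''⟩ := ihr hr (blockOf bot l T u) u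
      exact ⟨T'', y, h', hT'.trans ((List.prefix_append _ _).trans (h ▸ hT''))⟩

theorem exists_blockOf_eq (l : BinaryTree (Option (Γ × Level))) (T : Stack Γ)
    (u : List (Letter Γ)) : ∃ T' x, blockOf bot l T u = T' ++ [u ++ x] ∧ T <+: T' := by
  have := exists_stackOf_eq (bot := bot) (t := .node none l .nil) (by simp) T u
  rwa [stackOf_node, stackOf_nil] at this

theorem length_lt_length_blockOf (l : BinaryTree (Option (Γ × Level))) (T : Stack Γ)
    (u : List (Letter Γ)) : T.length < (blockOf bot l T u).length := by
  obtain ⟨T', x, h, h'⟩ := exists_blockOf_eq (bot := bot) l T u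
  rw [h]
  simpa using h'.length_le

/-! ### Invariants of stacks -/

/-- The properties that the word `w` has in every stack in which it is on top of the words `T`. -/
structure WordOK (bot : Γ) (T : Stack Γ) (w : List (Letter Γ)) : Prop where
  head : ∃ v, w = (bot, Level.one, 0) :: v
  symbol : ∀ v a, v ++ [a] <+: w → v ≠ [] → a.1 ≠ bot
  link_one : ∀ v a, v ++ [a] <+: w → a.2.1 = .one → a.2.2 = v.length
  link_two_le : ∀ v a, v ++ [a] <+: w → a.2.1 = .two → a.2.2 ≤ T.length
  link_two : ∀ v a, v ++ [a] <+: w → a.2.1 = .two → (∀ w' ∈ T.getLast?, ¬ v ++ [a] <+: w') →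
    a.2.2 = T.length

/-- All words of a stack satisfy `WordOK`. -/
def StackOK (bot : Γ) (s : Stack Γ) : Prop := ∀ T w, T ++ [w] <+: s → WordOK bot T w

theorem StackOK.of_prefix {s t : Stack Γ} (h : StackOK bot t) (hs : s <+: t) : StackOK bot s :=
  fun T w hw => h T w (hw.trans hs)

theorem stackOK_concat_iff {T : Stack Γ} {w : List (Letter Γ)} :
    StackOK bot (T ++ [w]) ↔ StackOK bot T ∧ WordOK bot T w := by
  constructor
  · exact fun h => ⟨h.of_prefix (List.prefix_append _ _), h T w List.prefix_rfl⟩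
  · rintro ⟨h, h'⟩ T' w' hw
    rcases List.prefix_concat_iff.1 hw with hw | hw
    · obtain ⟨rfl, hw⟩ := List.append_inj' hw rfl
      obtain rfl : w' = w := by simpa using hw
      exact h'
    · exact h T' w' hw

theorem WordOK.of_prefix {T : Stack Γ} {v w : List (Letter Γ)} (h : WordOK bot T w) (hv : v <+: w)
    (hv0 : v ≠ []) : WordOK bot T v where
  head := by
    obtain ⟨x, rfl⟩ := h.head
    obtain ⟨a, v, rfl⟩ := List.exists_cons_of_ne_nil hv0
    exact ⟨v, by rw [(List.cons_prefix_cons.1 hv).1]⟩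
  symbol v a hva := h.symbol v a (hva.trans hv)
  link_one v a hva := h.link_one v a (hva.trans hv)
  link_two_le v a hva := h.link_two_le v a (hva.trans hv)
  link_two v a hva := h.link_two v a (hva.trans hv)

theorem WordOK.clone {T : Stack Γ} {w : List (Letter Γ)} (h : WordOK bot T w) :
    WordOK bot (T ++ [w]) w where
  head := h.head
  symbol := h.symbol
  link_one := h.link_one
  link_two_le v a hva h2 := (h.link_two_le v a hva h2).trans (by simp)
  link_two v a hva _ h3 := absurd hva (h3 w (by simp))

theorem WordOK.push {T : Stack Γ} {w : List (Letter Γ)} (h : WordOK bot T w) {b : Γ × Level}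
    (hb : b.1 ≠ bot) : WordOK bot T (w ++ [freshLetter b T.length w.length]) := by
  obtain ⟨σ, k⟩ := b
  have key : ∀ {v a}, v ++ [a] <+: w ++ [freshLetter (σ, k) T.length w.length] →
      v ++ [a] <+: w ∨ v = w ∧ a = freshLetter (σ, k) T.length w.length := by
    intro v a hva
    rcases List.prefix_concat_iff.1 hva with h | h
    · obtain ⟨rfl, h⟩ := List.append_inj' h rfl
      exact .inr ⟨rfl, by simpa using h⟩
    · exact .inl h
  constructor
  · obtain ⟨v, hv⟩ := h.head
    exact ⟨v ++ [freshLetter (σ, k) T.length w.length], by rw [← List.cons_append, ← hv]⟩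
  · intro v a hva hv
    rcases key hva with hva | ⟨rfl, rfl⟩
    · exact h.symbol v a hva hv
    · exact hb
  · intro v a hva h1
    rcases key hva with hva | ⟨rfl, rfl⟩
    · exact h.link_one v a hva h1
    · obtain rfl : k = .one := h1
      rfl
  · intro v a hva h1
    rcases key hva with hva | ⟨rfl, rfl⟩
    · exact h.link_two_le v a hva h1
    · obtain rfl : k = .two := h1
      exact le_rfl
  · intro v a hva h1
    rcases key hva with hva | ⟨rfl, rfl⟩
    · exact h.link_two v a hva h1
    · obtain rfl : k = .two := h1
      exact fun _ => rfl

theorem StackOK.getLast_eq {s : Stack Γ} (h : StackOK bot s) (hs : s ≠ []) :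
    ∃ T v a, s = T ++ [v ++ [a]] := by
  obtain ⟨T, w, rfl⟩ := (List.eq_nil_or_concat' s).resolve_left hs
  obtain ⟨v, hv⟩ := (h T w List.prefix_rfl).head
  obtain ⟨v', a, rfl⟩ := (List.eq_nil_or_concat' w).resolve_left (by rw [hv]; simp)
  exact ⟨T, v', a, rfl⟩

/-- The system with one state and all transitions, used to treat operations as steps. -/
def fullSystem (bot : Γ) : CPS Γ Unit := ⟨bot, Set.univ, ()⟩

theorem IsStack.of_step {p q : Unit} {s t : Stack Γ} (h : IsStack bot s)
    (hs : (fullSystem bot).Step (p, s) (q, t)) : IsStack bot t := by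
  obtain ⟨_, op, _, _, h'⟩ := hs
  exact .step op h h'

theorem IsStack.stackOK {s : Stack Γ} (h : IsStack bot s) : StackOK bot s ∧ s ≠ [] := by
  induction h with
  | init =>
    refine ⟨?_, by simp [initialStack]⟩
    have : StackOK bot ([] ++ [[(bot, Level.one, 0)]]) := by
      refine stackOK_concat_iff.2 ⟨fun T w h => by simp at h, ⟨_, rfl⟩, ?_, ?_, ?_, ?_⟩
      all_goals
        intro v a hva
        obtain ⟨rfl, rfl⟩ : v = [] ∧ a = (bot, Level.one, 0) := by
          rcases v with _ | ⟨b, v⟩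
          · simpa using hva
          · have := hva.length_le
            simp at this
        simp
    exact this
  | @step s t op _ hop ih =>
    obtain ⟨hok, hs⟩ := ih
    obtain ⟨T, v, a, rfl⟩ := hok.getLast_eq hs
    have hstep : (fullSystem bot).Step ((), T ++ [v ++ [a]]) ((), t) :=
      ⟨a.1, op, Set.mem_univ _, topSym_concat _ _ _, hop⟩
    obtain ⟨hT, hw⟩ := stackOK_concat_iff.1 hok
    rw [step_concat_iff] at hstep
    cases hstep with
    | push b hb =>
      refine ⟨stackOK_concat_iff.2 ⟨hT, ?_⟩, by simp⟩
      obtain ⟨hb, -⟩ := hb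
      simpa using hw.push hb
    | clone _ => exact ⟨stackOK_concat_iff.2 ⟨hok, hw.clone⟩, by simp⟩
    | pop1 _ hv =>
      exact ⟨stackOK_concat_iff.2 ⟨hT, hw.of_prefix (List.prefix_append _ _) hv⟩, by simp⟩
    | pop2 _ hT' => exact ⟨hT, hT'⟩
    | collapse _ _ h0 =>
      refine ⟨hok.of_prefix (List.take_prefix _ _), ?_⟩
      rw [← List.length_pos_iff, List.length_take]
      simp only [List.length_append, List.length_singleton]
      omega

theorem IsStack.of_prefix_top {T : Stack Γ} {v w : List (Letter Γ)} (h : IsStack bot (T ++ [w]))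
    (hv : v <+: w) (hv0 : v ≠ []) : IsStack bot (T ++ [v]) := by
  obtain ⟨x, rfl⟩ := hv
  induction x using List.reverseRecOn with
  | nil => simpa using h
  | append_singleton x a ih =>
    rw [← List.append_assoc] at h
    have hs : (fullSystem bot).Step ((), T ++ [v ++ x ++ [a]]) ((), T ++ [v ++ x]) :=
      (step_concat_iff _).2 (.pop1 (.inl (Set.mem_univ _)) (by simp [hv0]))
    exact ih (h.of_step hs)

theorem IsStack.clone {s : Stack Γ} {T : Stack Γ} {u x : List (Letter Γ)} (h : IsStack bot s)
    (hs : s = T ++ [u ++ x]) (hu : u ≠ []) : IsStack bot (s ++ [u]) := by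
  subst hs
  obtain ⟨v, a, hva⟩ := (List.eq_nil_or_concat' (u ++ x)).resolve_left (by simp [hu])
  have hs : (fullSystem bot).Step ((), T ++ [u ++ x]) ((), T ++ [u ++ x] ++ [u ++ x]) := by
    rw [hva]
    exact (step_concat_iff _).2 (.clone (Set.mem_univ _))
  exact (h.of_step hs).of_prefix_top (List.prefix_append _ _) hu

/-- Valid trees encode stacks. -/
theorem ValidTree.isStack {t : BinaryTree (Option (Γ × Level))} {ex : Option (Γ × Level)}
    (h : ValidTree bot ex t) (ht : t ≠ .nil) {T : Stack Γ} {u : List (Letter Γ)} (hu : u ≠ [])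
    (hs : IsStack bot (T ++ [u])) : IsStack bot (stackOf bot t T u) := by
  induction t generalizing ex T u with
  | nil => exact absurd rfl ht
  | node ρ l r ihl ihr =>
    obtain ⟨h1, h2, h3, h4⟩ := h
    rw [stackOf_node]
    have hblock : IsStack bot (blockOf bot l T u) := by
      by_cases hl : l = .nil
      · simpa [hl] using hs
      · rw [blockOf_of_ne_nil hl]
        refine ihl h3 hl (by simp) ?_
        obtain ⟨τ, hτ⟩ := Option.ne_none_iff_exists'.1 (mt labelAt_root_eq_none_iff.1 hl)
        obtain ⟨b, rfl, hb, -⟩ := h1 τ hτ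
        rw [leftLetter_of_label hτ]
        obtain ⟨v, a, rfl⟩ := (List.eq_nil_or_concat' u).resolve_left hu
        have hs' : (fullSystem bot).Step ((), T ++ [v ++ [a]]) ((), _) :=
          (step_concat_iff _).2 (.push b ⟨hb, Set.mem_univ _⟩)
        simpa using hs.of_step hs'
    by_cases hr : r = .nil
    · simpa [hr] using hblock
    · obtain ⟨T', x, hT', -⟩ := exists_blockOf_eq (bot := bot) l T u
      exact ihr h4 hr hu (hblock.clone hT' hu)

end Trees

section Encode

variable {Γ Q : Type*} {bot : Γ}

/-! ### Initial parts of trees -/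

/-- The restriction of a tree to the addresses that are lexicographically at most `d`, for an
address `d` of the tree. -/
def cut {α : Type*} : BinaryTree α → List Bool → BinaryTree α
  | .nil, _ => .nil
  | .node a _ _, [] => .node a .nil .nil
  | .node a l _, false :: d => .node a (cut l d) .nil
  | .node a l r, true :: d => .node a l (cut r d)

theorem lex_cons_le_cons_iff {d e : List Bool} {a b : Bool} :
    a :: d ≤ b :: e ↔ a < b ∨ a = b ∧ d ≤ e := by
  simp only [le_iff_lt_or_eq, List.cons_lt_cons_iff, List.cons.injEq]
  tauto

theorem lex_nil_le (d : List Bool) : [] ≤ d := by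
  cases d <;> simp [le_iff_lt_or_eq]

theorem lex_not_cons_le_nil (a : Bool) (d : List Bool) : ¬ a :: d ≤ [] := by
  simp [le_iff_lt_or_eq]

theorem restrict_of_forall {α : Type*} (t : BinaryTree α) (P : List Bool → Prop) [DecidablePred P]
    (h : ∀ d, P d) : restrict t P = t := by
  induction t generalizing P with
  | nil => rfl
  | node a l r ihl ihr => rw [restrict, if_pos (h []), ihl _ fun d => h _, ihr _ fun d => h _]

theorem restrict_of_not {α : Type*} (t : BinaryTree α) (P : List Bool → Prop) [DecidablePred P]
    (h : ¬ P []) : restrict t P = .nil := by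
  cases t with
  | nil => rfl
  | node a l r => rw [restrict, if_neg h]

theorem restrict_eq_cut {α : Type*} (t : BinaryTree α) (d : List Bool) (P : List Bool → Prop)
    [DecidablePred P] (h : ∀ e, P e ↔ e ≤ d) : restrict t P = cut t d := by
  induction t generalizing d P with
  | nil => cases d <;> rfl
  | node a l r ihl ihr =>
    rw [restrict, if_pos ((h []).2 (lex_nil_le _))]
    rcases d with _ | ⟨_ | _, d⟩
    · rw [restrict_of_not l _ (by simp [h, lex_not_cons_le_nil]),
        restrict_of_not r _ (by simp [h, lex_not_cons_le_nil])]
      rfl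
    · rw [ihl d _ (fun e => by simp [h, lex_cons_le_cons_iff]),
        restrict_of_not r _ (by simp [h, lex_cons_le_cons_iff])]
      rfl
    · rw [restrict_of_forall l _ (fun e => by simp [h, lex_cons_le_cons_iff]),
        ihr d _ (fun e => by simp [h, lex_cons_le_cons_iff])]
      rfl

theorem labelAt_cut {α : Type*} (t : BinaryTree α) (d : List Bool) :
    labelAt (cut t d) [] = labelAt t [] := by
  rcases t with _ | ⟨a, l, r⟩
  · cases d <;> rfl
  · rcases d with _ | ⟨_ | _, d⟩ <;> rfl

theorem ValidTree.cut {t : BinaryTree (Option (Γ × Level))} {ex : Option (Γ × Level)}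
    (h : ValidTree bot ex t) (d : List Bool) : ValidTree bot ex (cut t d) := by
  induction t generalizing d ex with
  | nil => cases d <;> exact h
  | node a l r ihl ihr =>
    obtain ⟨h1, h2, h3, h4⟩ := h
    rcases d with _ | ⟨_ | _, d⟩
    · exact ⟨by simp [labelAt], by simp [labelAt], trivial, trivial⟩
    · exact ⟨by rwa [labelAt_cut], by simp [labelAt], ihl h3 d, trivial⟩
    · exact ⟨h1, by rwa [labelAt_cut], h3, ihr h4 d⟩

/-- The trees that encode stacks: those that are valid, with the label `(⊥, 1)` at the root. -/
def StackTree (bot : Γ) (t : BinaryTree (Option (Γ × Level))) : Prop :=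
  labelAt t [] = some (some (bot, .one)) ∧ ValidTree bot none t

/-- The stack encoded by a tree. -/
def rootStack (bot : Γ) (t : BinaryTree (Option (Γ × Level))) : Stack Γ :=
  stackOf bot t [] [(bot, .one, 0)]

theorem StackTree.ne_nil {t : BinaryTree (Option (Γ × Level))} (h : StackTree bot t) :
    t ≠ .nil :=
  ne_nil_of_labelAt h.1

theorem StackTree.isStack {t : BinaryTree (Option (Γ × Level))} (h : StackTree bot t) :
    IsStack bot (rootStack bot t) :=
  h.2.isStack h.ne_nil (by simp) .init

variable [DecidableEq Γ]

/-! ### The tree of a stack determines the stack, and conversely -/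

/-- The encoding of a blockline (whose words continue the word `u` and begin with `y`) is a valid
tree that encodes these words. -/
theorem stackOf_encodeBlockline (B : Stack Γ) (ρ : Option (Γ × Level)) {T : Stack Γ}
    {u : List (Letter Γ)} {y : Letter Γ} {ex : Option (Γ × Level)}
    (hB : ∀ w ∈ B, ∃ v, w = y :: v) (hok : StackOK bot (T ++ B.map (u ++ ·)))
    (hnew : ∀ w' ∈ T.getLast?, ∀ z v rest, B = (y :: z :: v) :: rest → ¬ u ++ [y, z] <+: w')
    (hex : ∀ σ, ex = some (σ, .one) → ∃ w' ∈ T.getLast?, u ++ [y, (σ, .one, u.length + 1)] <+: w') :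
    stackOf bot (encodeBlockline B ρ) T (u ++ [y]) = T ++ B.map (u ++ ·) ∧
      ValidTree bot ex (encodeBlockline B ρ) ∧
      (B ≠ [] → labelAt (encodeBlockline B ρ) [] = some ρ) := by
  induction B, ρ using encodeBlockline.induct generalizing T u y ex with
  | case1 ρ => simp [encodeBlockline, ValidTree]
  | case2 rest ρ => exact absurd (hB [] (by simp)) (by simp)
  | case3 x rest ρ ih =>
    obtain rfl : x = y := by simpa using hB [x] (by simp)
    have h := ih (T := T ++ [u ++ [x]]) (u := u) (y := x) (ex := none)
      (fun w hw => hB w (List.mem_cons_of_mem _ hw)) (by simpa using hok) (by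
        intro w' hw' z v rest' _ h
        obtain rfl : w' = u ++ [x] := by simpa using hw'.symm
        have := h.length_le
        simp at this) (by simp)
    rw [encodeBlockline, stackOf_node, blockOf_nil, h.1]
    refine ⟨by simp, ⟨by simp [labelAt], ?_, trivial, h.2.1⟩, fun _ => rfl⟩
    intro τ hτ
    by_cases hr : rest = []
    · subst hr
      simp [encodeBlockline, labelAt] at hτ
    · rw [h.2.2 hr] at hτ
      exact (Option.some_inj.1 hτ).symm
  | case4 x z v rest ρ ihl ihr =>
    obtain rfl : x = y := by
      obtain ⟨v', hv'⟩ := hB (x :: z :: v) (by simp)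
      exact (List.cons.inj hv').1
    set first := (x :: z :: v) :: rest.takeWhile (fun w => decide ([x, z] <+: w)) with hfirst
    set later := rest.dropWhile (fun w => decide ([x, z] <+: w)) with hlater
    have hsplit : (x :: z :: v) :: rest = first ++ later := by
      rw [hfirst, hlater, List.cons_append, List.takeWhile_append_dropWhile]
    have hfirst_mem : ∀ w ∈ first, ∃ t, w = x :: z :: t := by
      intro w hw
      rcases List.mem_cons.1 hw with rfl | hw
      · exact ⟨v, rfl⟩
      · obtain ⟨t, ht⟩ := of_decide_eq_true
          (List.mem_takeWhile_imp (p := fun w => decide ([x, z] <+: w)) hw)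
        exact ⟨t, ht.symm⟩
    have hfirst_map : (first.map List.tail).map (u ++ [x] ++ ·) = first.map (u ++ ·) := by
      rw [List.map_map]
      refine List.map_congr_left fun w hw => ?_
      obtain ⟨t, rfl⟩ := hfirst_mem w hw
      simp
    rw [hsplit, List.map_append, ← List.append_assoc] at hok
    -- The letter `z` is recovered from its symbol and level.
    have hzw : u ++ [x] ++ [z] <+: u ++ (x :: z :: v) := ⟨v, by simp⟩
    have hword : WordOK bot T (u ++ (x :: z :: v)) := hok T _ (by simp [hfirst])
    have hz : freshLetter (z.1, z.2.1) T.length (u ++ [x]).length = z := by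
      obtain ⟨σ, _ | _, r⟩ := z
      · have := hword.link_one _ _ hzw rfl
        simp only [freshLetter, Prod.mk.injEq, true_and]
        exact this.symm
      · have := hword.link_two _ _ hzw rfl fun w' hw' => by
          simpa using hnew w' hw' _ v rest rfl
        simp only [freshLetter, Prod.mk.injEq, true_and]
        exact this.symm
    have hl := ihl (T := T) (u := u ++ [x]) (y := z) (ex := none)
      (by
        intro _ hw
        obtain ⟨w, hw', rfl⟩ := List.mem_map.1 hw
        obtain ⟨t, rfl⟩ := hfirst_mem w hw'
        exact ⟨t, rfl⟩)
      (by rw [hfirst_map]; exact hok.of_prefix (List.prefix_append _ _))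
      (by
        intro w' hw' z' v' rest' _ h
        refine hnew w' hw' z v rest rfl (List.IsPrefix.trans ⟨[z'], ?_⟩ h)
        simp) (by simp)
    have hlabel := hl.2.2 (by simp [hfirst])
    have hlast : ∃ t, (T ++ first.map (u ++ ·)).getLast? = some (u ++ x :: z :: t) := by
      obtain ⟨f, w, hfw⟩ := (List.eq_nil_or_concat' first).resolve_left (by simp [hfirst])
      obtain ⟨t, rfl⟩ := hfirst_mem w (by rw [hfw]; simp)
      exact ⟨t, by rw [hfw]; simp⟩
    obtain ⟨t, hlast⟩ := hlast
    have hr := ihr (T := T ++ first.map (u ++ ·)) (u := u) (y := x) (ex := some (z.1, z.2.1))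
      (fun w hw => hB w (by rw [hsplit]; exact List.mem_append_right _ hw)) hok
      (by
        intro w' hw' z' v' rest' hrest h
        rw [hlast, Option.mem_some_iff] at hw'
        subst hw'
        rw [List.prefix_append_right_inj] at h
        obtain rfl : z' = z := by simpa using h
        have h1 := List.head?_dropWhile_not (fun w => decide ([x, z'] <+: w)) rest
        rw [← hlater, hrest] at h1
        simp at h1)
      (by
        intro σ hσ
        refine ⟨_, hlast, (List.prefix_append_right_inj u).2 ?_⟩
        rw [Option.some_inj, Prod.mk.injEq] at hσ
        have h1 : z = (σ, .one, u.length + 1) := by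
          rw [← hz, hσ.1, hσ.2]
          simp [freshLetter]
        rw [← h1]
        exact ⟨t, rfl⟩)
    have hblock : blockOf bot (encodeBlockline (first.map List.tail) (some (z.1, z.2.1))) T
        (u ++ [x]) = T ++ first.map (u ++ ·) := by
      rw [blockOf_of_ne_nil (ne_nil_of_labelAt hlabel),
        leftLetter_of_label hlabel, hz, hl.1, hfirst_map]
    rw [encodeBlockline, stackOf_node]
    simp only [← hfirst, ← hlater]
    rw [hblock, hr.1]
    refine ⟨by rw [hsplit]; simp, ⟨?_, ?_, hl.2.1, by rw [hlabel]; exact hr.2.1⟩, fun _ => rfl⟩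
    · intro τ hτ
      rw [hlabel, Option.some_inj] at hτ
      refine ⟨_, hτ.symm, hword.symbol _ _ hzw (by simp), ?_⟩
      rintro h1 rfl
      have h1 : z.2.1 = .one := h1
      obtain ⟨w', hw', h2⟩ := hex z.1 (by rw [h1])
      refine hnew w' hw' z v rest rfl ?_
      convert h2 using 4
      rw [← hz, h1]
      simp [freshLetter]
    · intro τ hτ
      by_cases hr0 : later = []
      · rw [hr0] at hτ
        simp [encodeBlockline, labelAt] at hτ
      · rw [hr.2.2 hr0] at hτ
        exact (Option.some_inj.1 hτ).symm

/-- A valid tree is the encoding of the blockline that it encodes. -/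
theorem exists_encodeBlockline_eq {t : BinaryTree (Option (Γ × Level))} {ex : Option (Γ × Level)}
    (h : ValidTree bot ex t) (T : Stack Γ) (u : List (Letter Γ)) (y : Letter Γ)
    {ρ : Option (Γ × Level)} (hρ : ∀ ρ', labelAt t [] = some ρ' → ρ' = ρ) :
    ∃ B, stackOf bot t T (u ++ [y]) = T ++ B.map (u ++ ·) ∧ (∀ w ∈ B, ∃ v, w = y :: v) ∧
      encodeBlockline B ρ = t ∧ (t ≠ .nil → B ≠ []) ∧
      ∀ z, (∃ w ∈ B.head?, [y, z] <+: w) → ∃ b ρ l r, t = .node ρ l r ∧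
        labelAt l [] = some (some b) ∧ z = freshLetter b T.length (u.length + 1) := by
  induction t generalizing ex T u y ρ with
  | nil => exact ⟨[], by simp [encodeBlockline]⟩
  | node ρ' l r ihl ihr =>
    obtain rfl : ρ' = ρ := hρ _ rfl
    obtain ⟨h1, h2, h3, h4⟩ := h
    obtain ⟨B₂, e₂, m₂, c₂, n₂, f₂⟩ := ihr h4 (blockOf bot l T (u ++ [y])) u y h2
    rw [stackOf_node, e₂]
    by_cases hl : l = .nil
    · subst hl
      refine ⟨[y] :: B₂, by simp, by simpa using m₂, by rw [encodeBlockline, c₂], by simp, ?_⟩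
      rintro z ⟨w, hw, hz⟩
      obtain rfl : w = [y] := by simpa using hw.symm
      simpa using hz.length_le
    · obtain ⟨τ, hτ⟩ := Option.ne_none_iff_exists'.1 (mt labelAt_root_eq_none_iff.1 hl)
      obtain ⟨b, rfl, hb, -⟩ := h1 τ hτ
      obtain ⟨B₁, e₁, m₁, c₁, n₁, f₁⟩ := ihl h3 T (u ++ [y])
        (leftLetter bot l T.length (u ++ [y]).length) (ρ := some b)
        (fun ρ' hρ' => by rw [hτ] at hρ'; exact (Option.some_inj.1 hρ').symm)
      rw [← blockOf_of_ne_nil hl] at e₁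
      have hbl := length_lt_length_blockOf (bot := bot) l T (u ++ [y])
      rw [leftLetter_of_label hτ] at m₁ f₁
      set z := freshLetter b T.length (u ++ [y]).length with hz
      obtain ⟨w, B₁, rfl⟩ := List.exists_cons_of_ne_nil (n₁ hl)
      obtain ⟨v, rfl⟩ := m₁ w (by simp)
      refine ⟨((z :: v) :: B₁).map (y :: ·) ++ B₂, ?_, ?_, ?_, by simp, ?_⟩
      · rw [e₁]; simp
      · intro w hw
        rcases List.mem_append.1 hw with hw | hw
        · obtain ⟨w, -, rfl⟩ := List.mem_map.1 hw
          exact ⟨w, rfl⟩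
        · exact m₂ w hw
      · have hp : ∀ w ∈ B₁.map (y :: ·), decide ([y, z] <+: w) = true := by
          intro _ hw
          obtain ⟨w, hw', rfl⟩ := List.mem_map.1 hw
          obtain ⟨v', rfl⟩ := m₁ w (List.mem_cons_of_mem _ hw')
          simp
        have hq : ∀ w ∈ B₂.head?, ¬ decide ([y, z] <+: w) = true := by
          intro w hw hdec
          obtain ⟨b', ρ'', l', r', rfl, hl', hz'⟩ := f₂ z ⟨w, hw, of_decide_eq_true hdec⟩
          have hbb : b' = b := by simpa [hz] using (congrArg Letter.sym hz').symm
          obtain ⟨b'', hb'', -, hne⟩ := h4.1 _ hl'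
          obtain rfl : b' = b'' := Option.some_inj.1 hb''
          subst hbb
          obtain ⟨σ, _ | _⟩ := b'
          · exact hne rfl (by rw [hτ]; rfl)
          · have h5 : T.length = _ := congrArg (fun a : Letter Γ => a.2.2) hz'
            exact absurd h5 (ne_of_lt hbl)
        have htake : (B₁.map (y :: ·) ++ B₂).takeWhile (fun w => decide ([y, z] <+: w)) =
            B₁.map (y :: ·) := by
          rw [List.takeWhile_append_of_pos hp]
          rcases B₂ with _ | ⟨w, B₂⟩
          · simp
          · rw [List.takeWhile_cons_of_neg (p := fun w => decide ([y, z] <+: w)) (hq w (by simp)),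
              List.append_nil]
        have hdrop : (B₁.map (y :: ·) ++ B₂).dropWhile (fun w => decide ([y, z] <+: w)) = B₂ := by
          rw [List.dropWhile_append_of_pos hp]
          rcases B₂ with _ | ⟨w, B₂⟩
          · simp
          · rw [List.dropWhile_cons_of_neg (p := fun w => decide ([y, z] <+: w)) (hq w (by simp))]
        rw [List.map_cons, List.cons_append, encodeBlockline, htake, hdrop, c₂]
        have h6 : ((y :: z :: v) :: B₁.map (y :: ·)).map List.tail = (z :: v) :: B₁ := by
          simp [Function.comp_def]
        rw [h6, show (some (z.1, z.2.1) : Option (Γ × Level)) = some b from rfl, c₁]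
      · rintro z' ⟨w, hw, hz'⟩
        obtain rfl : w = y :: z :: v := by simpa using hw.symm
        obtain rfl : z' = z := by simpa using hz'
        exact ⟨b, ρ', l, r, rfl, hτ, by rw [hz]; simp⟩

variable (S : CPS Γ Q)

theorem rootStack_encodeStack {s : Stack Γ} (hs : IsStack S.bot s) :
    rootStack S.bot (S.encodeStack s) = s ∧ StackTree S.bot (S.encodeStack s) := by
  obtain ⟨h1, h2⟩ := hs.stackOK
  have := stackOf_encodeBlockline (bot := S.bot) s (some (S.bot, .one)) (T := []) (u := [])
    (y := (S.bot, .one, 0)) (ex := none)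
    (by
      intro w hw
      obtain ⟨T, R, rfl⟩ := List.append_of_mem hw
      exact (h1 T w ⟨R, by simp⟩).head)
    (by simpa using h1) (by simp) (by simp)
  refine ⟨?_, this.2.2 h2, this.2.1⟩
  simpa [rootStack, CPS.encodeStack] using this.1

theorem encodeStack_rootStack {t : BinaryTree (Option (Γ × Level))} (h : StackTree S.bot t) :
    S.encodeStack (rootStack S.bot t) = t := by
  obtain ⟨B, e, -, hB, -⟩ := exists_encodeBlockline_eq h.2 [] [] (S.bot, .one, 0)
    (ρ := some (S.bot, .one)) (fun ρ' hρ' => by rw [h.1] at hρ'; exact (Option.some_inj.1 hρ').symm)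
  have : rootStack S.bot t = B := by simpa [rootStack] using e
  rw [this]
  exact hB

theorem decode_eq {t : BinaryTree (Option (Γ × Level))} (h : StackTree S.bot t) :
    S.decode t = rootStack S.bot t := by
  have h1 : ∃ s ∈ {s | IsStack S.bot s}, S.encodeStack s = t :=
    ⟨rootStack S.bot t, h.isStack, encodeStack_rootStack S h⟩
  have h2 : IsStack S.bot (S.decode t) := Function.invFunOn_mem h1
  have h3 : S.encodeStack (S.decode t) = t := Function.invFunOn_eq h1
  rw [← (rootStack_encodeStack S h2).1, h3]

theorem leftStack_eq {s : Stack Γ} (hs : IsStack S.bot s) (d : List Bool) :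
    S.leftStack s (false :: d) = rootStack S.bot (CPG.cut (S.encodeStack s) d) := by
  obtain ⟨-, h1, h2⟩ := rootStack_encodeStack S hs
  rw [CPS.leftStack, restrict_eq_cut _ d _ (by simp [lex_cons_le_cons_iff]),
    decode_eq S ⟨by rw [labelAt_cut]; exact h1, h2.cut d⟩]

end Encode

section Preorder

variable {Γ Q : Type*} {bot : Γ}

/-! ### The sequence of milestones of a stack -/

/-- The left stacks of the nodes of a tree, in lexicographic order of the nodes, paired with the
states that `f` assigns to the nodes. -/
def preorder (bot : Γ) : BinaryTree (Option (Γ × Level)) → (List Bool → Q) → Stack Γ →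
    List (Letter Γ) → List (Q × Stack Γ)
  | .nil, _, _, _ => []
  | .node _ l r, f, T, u =>
    ((f [], T ++ [u]) :: preorder bot l (fun d => f (false :: d)) T
        (u ++ [leftLetter bot l T.length u.length])) ++
      preorder bot r (fun d => f (true :: d)) (blockOf bot l T u) u

theorem leftLetter_cut (l : BinaryTree (Option (Γ × Level))) (d : List Bool) (n m : ℕ) :
    leftLetter bot (cut l d) n m = leftLetter bot l n m := by
  rw [leftLetter, labelAt_cut, leftLetter]

theorem mem_preorder_iff {t : BinaryTree (Option (Γ × Level))} {f : List Bool → Q} {T : Stack Γ}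
    {u : List (Letter Γ)} {c : Q × Stack Γ} :
    c ∈ preorder bot t f T u ↔ ∃ d ∈ dom t, c = (f d, stackOf bot (cut t d) T u) := by
  induction t generalizing f T u with
  | nil => simp [preorder, dom, labelAt]
  | node ρ l r ihl ihr =>
    simp only [preorder, List.mem_append, List.mem_cons, ihl, ihr]
    constructor
    · rintro ((rfl | ⟨d, hd, rfl⟩) | ⟨d, hd, rfl⟩)
      · exact ⟨[], by simp [dom, labelAt], by simp [cut, stackOf_node]⟩
      · have hl : l ≠ .nil := by
          rintro rfl
          simp [dom, labelAt] at hd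
        have hc : cut l d ≠ .nil := by
          rwa [Ne, ← labelAt_root_eq_none_iff, labelAt_cut, labelAt_root_eq_none_iff]
        refine ⟨false :: d, hd, ?_⟩
        rw [cut, stackOf_node, blockOf_of_ne_nil hc, stackOf_nil, leftLetter_cut]
      · exact ⟨true :: d, hd, by rw [cut, stackOf_node]⟩
    · rintro ⟨_ | ⟨_ | _, d⟩, hd, rfl⟩
      · exact .inl (.inl (by simp [cut, stackOf_node]))
      · have hl : l ≠ .nil := by
          rintro rfl
          simp [dom, labelAt] at hd
        have hc : cut l d ≠ .nil := by
          rwa [Ne, ← labelAt_root_eq_none_iff, labelAt_cut, labelAt_root_eq_none_iff]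
        refine .inl (.inr ⟨d, hd, ?_⟩)
        rw [cut, stackOf_node, blockOf_of_ne_nil hc, stackOf_nil, leftLetter_cut]
      · exact .inr ⟨d, hd, by rw [cut, stackOf_node]⟩

theorem head?_preorder {t : BinaryTree (Option (Γ × Level))} (ht : t ≠ .nil) (f : List Bool → Q)
    (T : Stack Γ) (u : List (Letter Γ)) :
    (preorder bot t f T u).head? = some (f [], T ++ [u]) := by
  cases t with
  | nil => exact absurd rfl ht
  | node => rfl

theorem getLast?_preorder {t : BinaryTree (Option (Γ × Level))} (ht : t ≠ .nil) (f : List Bool → Q)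
    (T : Stack Γ) (u : List (Letter Γ)) :
    ∃ q, (preorder bot t f T u).getLast? = some (q, stackOf bot t T u) := by
  induction t generalizing f T u with
  | nil => exact absurd rfl ht
  | node ρ l r ihl ihr =>
    rw [preorder, stackOf_node, List.getLast?_append]
    by_cases hr : r = .nil
    · subst hr
      by_cases hl : l = .nil
      · subst hl
        exact ⟨f [], by simp [preorder]⟩
      · obtain ⟨q, hq⟩ := ihl hl (fun d => f (false :: d)) T
          (u ++ [leftLetter bot l T.length u.length])
        exact ⟨q, by rw [List.getLast?_cons, hq, blockOf_of_ne_nil hl]; simp [preorder]⟩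
    · obtain ⟨q, hq⟩ := ihr hr (fun d => f (true :: d)) (blockOf bot l T u) u
      exact ⟨q, by rw [hq]; simp⟩

/-- The last element of `preorder` before the right subtree. -/
theorem getLast?_block (l : BinaryTree (Option (Γ × Level))) (f : List Bool → Q) (T : Stack Γ)
    (u : List (Letter Γ)) :
    ∃ q, ((f [], T ++ [u]) :: preorder bot l (fun d => f (false :: d)) T
      (u ++ [leftLetter bot l T.length u.length])).getLast? = some (q, blockOf bot l T u) := by
  have := getLast?_preorder (bot := bot) (t := .node none l .nil) (by simp) f T u
  simpa [preorder, stackOf_node] using this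

/-- Condition on the topmost word `w` of `T`, for a tree whose root belongs to the word `u` on top
of `T`: no letter by which `w` continues `u` is the label of the left subtree. -/
def TopOK (T : Stack Γ) (u : List (Letter Γ)) (ex : Option (Γ × Level)) : Prop :=
  ∀ w ∈ T.getLast?, ∀ z, u ++ [z] <+: w →
    (z.2.1 = .two → z.2.2 < T.length) ∧ (z.2.1 = .one → ex = some z.sym)

theorem TopOK.not_prefix {T : Stack Γ} {u w : List (Letter Γ)} {ex : Option (Γ × Level)}
    (h : TopOK T u ex) {b : Γ × Level} (hb : b.2 = .one → ex ≠ some b) (m : ℕ)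
    (hw : w ∈ T.getLast?) : ¬ u ++ [freshLetter b T.length m] <+: w := by
  intro hu
  obtain ⟨h1, h2⟩ := h w hw _ hu
  obtain ⟨σ, _ | _⟩ := b
  · exact hb rfl (h2 rfl)
  · exact lt_irrefl _ (h1 rfl)

theorem TopOK.left {T : Stack Γ} {u : List (Letter Γ)} {ex : Option (Γ × Level)}
    (h : TopOK T u ex) {b : Γ × Level} (hb : b.2 = .one → ex ≠ some b) (m : ℕ)
    (ex' : Option (Γ × Level)) : TopOK T (u ++ [freshLetter b T.length m]) ex' :=
  fun _ hw _ hz => absurd ((List.prefix_append _ _).trans hz) (h.not_prefix hb m hw)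

theorem topOK_blockOf {l : BinaryTree (Option (Γ × Level))} {T : Stack Γ} {u : List (Letter Γ)}
    (hl : ∀ τ, labelAt l [] = some τ → ∃ b, τ = some b) :
    TopOK (blockOf bot l T u) u (labelAt l []).join := by
  intro w hw z hz
  by_cases hl' : l = .nil
  · subst hl'
    obtain rfl : w = u := by simpa using hw.symm
    simpa using hz.length_le
  · obtain ⟨τ, hτ⟩ := Option.ne_none_iff_exists'.1 (mt labelAt_root_eq_none_iff.1 hl')
    obtain ⟨b, rfl⟩ := hl τ hτ
    have hlen := length_lt_length_blockOf (bot := bot) l T u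
    rw [blockOf_of_ne_nil hl', leftLetter_of_label hτ] at hw hlen ⊢
    obtain ⟨T', x, h, -⟩ := exists_stackOf_eq (bot := bot) hl' T
      (u ++ [freshLetter b T.length u.length])
    rw [h] at hw
    obtain rfl : w = u ++ [freshLetter b T.length u.length] ++ x := by simpa using hw.symm
    obtain rfl : z = freshLetter b T.length u.length := by simpa using hz
    obtain ⟨σ, _ | _⟩ := b
    · exact ⟨fun h => (by cases h), fun _ => (by rw [hτ]; rfl)⟩
    · exact ⟨fun _ => hlen, fun h => (by cases h)⟩

theorem isMilestone_push {T : Stack Γ} {u : List (Letter Γ)} {a : Letter Γ}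
    (h : ∀ w ∈ T.getLast?, ¬ u ++ [a] <+: w) : IsMilestone (T ++ [u]) (T ++ [u ++ [a]]) := by
  refine isMilestone_concat_iff.2 ⟨[a], [], rfl, fun w hw x hx hx' => ?_⟩
  rcases List.prefix_concat_iff.1 hx' with rfl | hx'
  · exact absurd hx (h w hw)
  · exact hx'

theorem isMilestone_clone {t : Stack Γ} (ht : t ≠ []) (u : List (Letter Γ)) :
    IsMilestone t (t ++ [u]) := by
  obtain ⟨T, w, rfl⟩ := (List.eq_nil_or_concat' t).resolve_left ht
  exact isMilestone_concat_iff.2 ⟨[], [u], by simp, by simp⟩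

/-- Each left stack is a milestone of the following one. -/
theorem isChain_preorder {t : BinaryTree (Option (Γ × Level))} {ex : Option (Γ × Level)}
    (h : ValidTree bot ex t) (f : List Bool → Q) {T : Stack Γ} {u : List (Letter Γ)}
    (hT : TopOK T u ex) :
    (preorder bot t f T u).IsChain fun c d => IsMilestone c.2 d.2 ∧ c.2 ≠ d.2 := by
  induction t generalizing ex f T u with
  | nil => exact .nil
  | node ρ l r ihl ihr =>
    obtain ⟨h1, h2, h3, h4⟩ := h
    refine .append ?_ (ihr h4 _ (topOK_blockOf fun τ hτ => (h1 τ hτ).imp fun _ h => h.1)) ?_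
    · by_cases hl : l = .nil
      · subst hl
        exact .singleton _
      · obtain ⟨τ, hτ⟩ := Option.ne_none_iff_exists'.1 (mt labelAt_root_eq_none_iff.1 hl)
        obtain ⟨b, rfl, -, hb⟩ := h1 τ hτ
        rw [leftLetter_of_label hτ]
        refine .cons (ihl h3 _ (hT.left hb _ _)) ?_
        rw [head?_preorder hl]
        rintro _ ⟨⟩
        exact ⟨isMilestone_push fun w hw => hT.not_prefix hb _ hw, by simp⟩
    · obtain ⟨q, hq⟩ := getLast?_block (bot := bot) l f T u
      rw [hq]
      rintro _ ⟨⟩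
      by_cases hr : r = .nil
      · subst hr
        simp [preorder]
      · rw [head?_preorder hr]
        rintro _ ⟨⟩
        have := length_lt_length_blockOf (bot := bot) l T u
        exact ⟨isMilestone_clone (List.ne_nil_of_length_pos (Nat.zero_lt_of_lt this)) u, by simp⟩

end Preorder

/-! ### Automata with states in an arbitrary finite type -/

section Automata

variable {α : Type*}

/-- The tree has a run from the given state, for a transition relation on any type of states. -/
def Derives {σ : Type*} (trans : Set (σ × α × σ × σ)) (final : Set σ) : σ → BinaryTree α → Prop
  | p, .nil => p ∈ final
  | p, .node a l r =>
    ∃ p₀ p₁, (p, a, p₀, p₁) ∈ trans ∧ Derives trans final p₀ l ∧ Derives trans final p₁ r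

/-- The states of a finite automaton may be taken from any universe. -/
theorem exists_treeAutomaton {σ : Type*} [Finite σ] (init : Set σ) (trans : Set (σ × α × σ × σ))
    (final : Set σ) :
    ∃ A : TreeAutomaton α, ∀ t, A.Accepts t ↔ ∃ p ∈ init, Derives trans final p t := by
  obtain ⟨n, ⟨e⟩⟩ := Finite.exists_equiv_fin σ
  let A : TreeAutomaton α :=
    { State := Fin n
      finite := inferInstance
      init := {i | e.symm i ∈ init}
      trans := {x | (e.symm x.1, x.2.1, e.symm x.2.2.1, e.symm x.2.2.2) ∈ trans}
      final := {i | e.symm i ∈ final} }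
  have h : ∀ t i, A.AcceptsFrom i t ↔ Derives trans final (e.symm i) t := by
    intro t
    induction t with
    | nil => exact fun i => Iff.rfl
    | node a l r ihl ihr =>
      intro i
      simp only [TreeAutomaton.AcceptsFrom, Derives, ihl, ihr]
      exact e.symm.exists_congr fun _ => e.symm.exists_congr fun _ => Iff.rfl
  exact ⟨A, fun t => e.symm.exists_congr fun i => and_congr_right fun _ => h t i⟩

/-- The transitions of the product of two automata. -/
def prodTrans {σ τ : Type*} (trans : Set (σ × α × σ × σ)) (trans' : Set (τ × α × τ × τ)) :
    Set ((σ × τ) × α × (σ × τ) × (σ × τ)) :=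
  {x | (x.1.1, x.2.1, x.2.2.1.1, x.2.2.2.1) ∈ trans ∧
    (x.1.2, x.2.1, x.2.2.1.2, x.2.2.2.2) ∈ trans'}

theorem derives_prodTrans_iff {σ τ : Type*} {trans : Set (σ × α × σ × σ)} {final : Set σ}
    {trans' : Set (τ × α × τ × τ)} {final' : Set τ} {t : BinaryTree α} {p : σ} {q : τ} :
    Derives (prodTrans trans trans') (final ×ˢ final') (p, q) t ↔
      Derives trans final p t ∧ Derives trans' final' q t := by
  induction t generalizing p q with
  | nil => rfl
  | node a l r ihl ihr =>
    simp only [Derives, Prod.exists, ihl, ihr]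
    constructor
    · rintro ⟨p₀, q₀, p₁, q₁, ⟨h1, h2⟩, ⟨h3, h4⟩, h5, h6⟩
      exact ⟨⟨p₀, p₁, h1, h3, h5⟩, q₀, q₁, h2, h4, h6⟩
    · rintro ⟨⟨p₀, p₁, h1, h3, h5⟩, q₀, q₁, h2, h4, h6⟩
      exact ⟨p₀, q₀, p₁, q₁, ⟨h1, h2⟩, ⟨h3, h4⟩, h5, h6⟩

/-- The transitions of an automaton that guesses the second components of the labels. -/
def projTrans {σ β : Type*} (trans : Set (σ × (α × β) × σ × σ)) : Set (σ × α × σ × σ) :=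
  {x | ∃ b, (x.1, (x.2.1, b), x.2.2) ∈ trans}

theorem derives_projTrans_iff {σ β : Type*} {trans : Set (σ × (α × β) × σ × σ)} {final : Set σ}
    [Nonempty β] {t : BinaryTree α} {p : σ} :
    Derives (projTrans trans) final p t ↔ ∃ g, Derives trans final p (annotate t g) := by
  induction t generalizing p with
  | nil =>
    obtain ⟨b⟩ := ‹Nonempty β›
    exact ⟨fun h => ⟨fun _ => b, h⟩, fun ⟨_, h⟩ => h⟩
  | node a l r ihl ihr =>
    simp only [Derives, annotate, ihl, ihr]
    constructor
    · rintro ⟨p₀, p₁, ⟨b, hb⟩, ⟨g₀, h₀⟩, g₁, h₁⟩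
      exact ⟨fun d => match d with | [] => b | false :: d => g₀ d | true :: d => g₁ d,
        p₀, p₁, hb, h₀, h₁⟩
    · rintro ⟨g, p₀, p₁, hb, h₀, h₁⟩
      exact ⟨p₀, p₁, ⟨_, hb⟩, ⟨_, h₀⟩, _, h₁⟩

theorem annotate_congr {β : Type*} {t : BinaryTree α} {g g' : List Bool → β}
    (h : ∀ d ∈ dom t, g d = g' d) : annotate t g = annotate t g' := by
  induction t generalizing g g' with
  | nil => rfl
  | node a l r ihl ihr =>
    rw [annotate, annotate, h [] rfl, ihl fun d hd => h (false :: d) hd,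
      ihr fun d hd => h (true :: d) hd]

end Automata

section Certificates

variable {Γ Q : Type*} (S : CPS Γ Q)

/-! ### The automaton that recognises certificates -/

/-- A state of the automaton at a node: the label of the node, the information about the word of
the node, the state assigned to the node, and a description of what happens after the last visit of
the last left stack `t` of the subtree: either the run is in the given state and ends there (`inl`),
or it continues with a segment to `t ++ [u]`, in the given state (`inr`), where `u` is the word of
the node.  At missing nodes the state is `none`. -/
abbrev NodeState (Γ Q : Type*) := Option (Option (Γ × Level) × WordState Γ Q × Q × (Q ⊕ Q))

/-- The condition on the state at the left child of a node with state `p`, where `o` describes what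
happens after the last visit of the last left stack in the left subtree (or of the left stack of
the node itself, if there is no left subtree). -/
def LeftTrans (W : WordState Γ Q) (p : Q) (o : Q ⊕ Q) : NodeState Γ Q → Prop
  | none =>
    match o with
    | .inl q => p = q
    | .inr g => ∃ p', (p, W.1.1, p', StackOp.clone) ∈ S.trans ∧ W.2.2 p' g
  | some (ρ, W₀, p₀, o₀) => ∃ b, ρ = some b ∧ W₀ = W.next S b ∧
      (∃ p', PushStep S p W.1.1 b p' ∧ Loop S (W.ret S) p' [b] p₀) ∧
      match o with
      | .inl q => o₀ = .inl q
      | .inr g => ∃ g₁ g', o₀ = .inr g₁ ∧ PopStep S g₁ b g' ∧ W.2.2 g' g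

/-- The condition on the state at the right child of a node, where `o` belongs to the subtree of
the node and `o'` to this subtree without the right subtree. -/
def RightTrans (W : WordState Γ Q) (o o' : Q ⊕ Q) : NodeState Γ Q → Prop
  | none => o' = o
  | some (ρ, W₁, p₁, o₁) => ρ = none ∧ W₁ = W ∧ o₁ = o ∧ o' = .inr p₁

/-- The transitions at the nodes of the encoding of a stack. -/
def nodeTrans : Set (NodeState Γ Q × (ConfigLabel Γ Q × Option Q) × NodeState Γ Q × NodeState Γ Q) :=
  {x | ∃ ρ W p o o' s₀ s₁, x = (some (ρ, W, p, o), (.inr ρ, some p), s₀, s₁) ∧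
    LeftTrans S W p o' s₀ ∧ RightTrans W o o' s₁}

variable {S}

/-- What happens after the last visit of the last left stack of a subtree. -/
def EndsWith (S : CPS Γ Q) (c : Q × Stack Γ) (u : List (Letter Γ)) : Q ⊕ Q → Prop
  | .inl q => c.1 = q
  | .inr g => Segment S c (g, c.2 ++ [u])

/-- The words that occur at the nodes of encodings, on top of the words `T`. -/
structure NodeWord (T : Stack Γ) (u : List (Letter Γ)) : Prop where
  ne_nil : u ≠ []
  links : LinksLT (T.length + 1) u
  positions : PositionLinks u

theorem NodeWord.left {T : Stack Γ} {u : List (Letter Γ)} (h : NodeWord T u) (b : Γ × Level) :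
    NodeWord T (u ++ [freshLetter b T.length u.length]) where
  ne_nil := by simp
  links := h.links.freshLetter (by omega) _ _
  positions := by
    intro v a hv h1
    rcases List.prefix_concat_iff.1 hv with hv | hv
    · obtain ⟨rfl, hv⟩ := List.append_inj' hv rfl
      obtain rfl : a = _ := by simpa using hv
      obtain ⟨σ, _ | _⟩ := b
      · rfl
      · cases h1
    · exact h.positions v a hv h1

theorem NodeWord.mono {T T' : Stack Γ} {u : List (Letter Γ)} (h : NodeWord T u)
    (hT : T.length ≤ T'.length) : NodeWord T' u :=
  ⟨h.ne_nil, h.links.mono (by omega), h.positions⟩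

/-- The information about a word, with a dummy value for the empty word. -/
def wordStateOf (S : CPS Γ Q) (u : List (Letter Γ)) : WordState Γ Q :=
  match symbols u with
  | [] => wordState S (S.bot, .one) []
  | a :: x => wordState S a x

theorem wordStateOf_concat (v : List (Letter Γ)) (e : Letter Γ) :
    wordStateOf S (v ++ [e]) = wordState S e.sym (symbols v) := by
  simp [wordStateOf]

theorem wordStateOf_push {u : List (Letter Γ)} (hu : u ≠ []) (b : Γ × Level) (n m : ℕ) :
    wordStateOf S (u ++ [freshLetter b n m]) = (wordStateOf S u).next S b := by
  obtain ⟨v, e, rfl⟩ := (List.eq_nil_or_concat' u).resolve_left hu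
  rw [wordStateOf_concat, wordStateOf_concat, symbols_concat, sym_freshLetter]
  rfl

theorem endsWith_leaf_iff {T : Stack Γ} {u : List (Letter Γ)} {p g : Q} (hu : NodeWord T u) :
    Segment S (p, T ++ [u]) (g, T ++ [u] ++ [u]) ↔
      ∃ p', (p, (wordStateOf S u).1.1, p', StackOp.clone) ∈ S.trans ∧
        (wordStateOf S u).2.2 p' g := by
  obtain ⟨v, e, rfl⟩ := (List.eq_nil_or_concat' u).resolve_left hu.ne_nil
  rw [segment_clone_iff, wordStateOf_concat, wordState_fst]
  simp only [wordState_loops_iff (S := S) (T := T ++ [v ++ [e]]) (v := v) (d := e) (by simp)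
    (by simpa using hu.links) hu.positions]
  rfl

theorem endsWith_pop_iff {t T' : Stack Γ} {u x : List (Letter Γ)} {b : Γ × Level} {n m : ℕ}
    {p g : Q} (ht : t = T' ++ [u ++ [freshLetter b n m] ++ x]) {T : Stack Γ} (hu : NodeWord T u)
    (hT : T.length < t.length) :
    Segment S (p, t) (g, t ++ [u]) ↔ ∃ g₁ g', Segment S (p, t) (g₁, t ++ [u ++ [freshLetter b n m]]) ∧
      PopStep S g₁ b g' ∧ (wordStateOf S u).2.2 g' g := by
  obtain ⟨v', e', hve⟩ := (List.eq_nil_or_concat' (u ++ [freshLetter b n m] ++ x)).resolve_left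
    (by simp)
  obtain ⟨v, e, rfl⟩ := (List.eq_nil_or_concat' u).resolve_left hu.ne_nil
  have ht0 : t ≠ [] := by rw [ht]; simp
  have h1 := fun g' => wordState_loops_iff (S := S) (T := t) (v := v) (d := e) (p := g') (q := g)
    ht0 (hu.links.mono hT) hu.positions
  rw [wordStateOf_concat]
  simp only [h1]
  rw [hve] at ht
  subst ht
  simp only [segment_clone_iff]
  rw [← hve]
  simp only [exists_run_to_prefix_iff (S := S) (T := T' ++ [v ++ [e] ++ [freshLetter b n m] ++ x])
    (List.prefix_append (v ++ [e] ++ [freshLetter b n m]) x) (by simp), sym_freshLetter]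
  constructor
  · rintro ⟨p', h, g₁, h2, g', h3, h4⟩
    exact ⟨g₁, g', ⟨p', h, h2⟩, h3, h4⟩
  · rintro ⟨g₁, g', ⟨p', h, h2⟩, h3, h4⟩
    exact ⟨p', h, g₁, h2, g', h3, h4⟩

theorem segment_push_iff' {T : Stack Γ} {u : List (Letter Γ)} {b : Γ × Level} {p q : Q}
    (hu : NodeWord T u)
    (hm : IsMilestone (T ++ [u]) (T ++ [u ++ [freshLetter b T.length u.length]])) :
    Segment S (p, T ++ [u]) (q, T ++ [u ++ [freshLetter b T.length u.length]]) ↔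
      ∃ p', PushStep S p (wordStateOf S u).1.1 b p' ∧
        Loop S ((wordStateOf S u).ret S) p' [b] q := by
  obtain ⟨v, e, rfl⟩ := (List.eq_nil_or_concat' u).resolve_left hu.ne_nil
  rw [wordStateOf_concat, wordState_fst, wordState_ret, ← symbols_concat]
  simp only [List.length_append, List.length_singleton] at hm ⊢
  exact segment_push_iff hm hu.links

theorem derives_none_iff {α : Type*} {t : BinaryTree α} {g : List Bool → Option Q}
    (φ : α → ConfigLabel Γ Q) :
    Derives (nodeTrans S) {none} none (annotate (t.map φ) g) ↔ t = .nil := by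
  cases t with
  | nil => simp [Derives, annotate, BinaryTree.map]
  | node a l r => simp [Derives, annotate, BinaryTree.map, nodeTrans]

end Certificates

section NodeAutomaton

variable {Γ Q : Type*} {S : CPS Γ Q}

/-- What a state of the automaton at the root of a subtree says about the segments between the
consecutive left stacks of the subtree. -/
def CertifiesFrom (S : CPS Γ Q) (t : BinaryTree (Option (Γ × Level))) (f : List Bool → Q)
    (T : Stack Γ) (u : List (Letter Γ)) (o : Q ⊕ Q) : Prop :=
  (preorder S.bot t f T u).IsChain (Segment S) ∧
    ∃ c, (preorder S.bot t f T u).getLast? = some c ∧ EndsWith S c u o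

/-- The part of the claim of `derives_nodeTrans_iff` about a node and its left subtree. -/
theorem exists_leftTrans_iff {l : BinaryTree (Option (Γ × Level))} {ex : Option (Γ × Level)}
    {f : List Bool → Q} {T : Stack Γ} {u : List (Letter Γ)} {o : Q ⊕ Q}
    (hl : ∀ τ, labelAt l [] = some τ → ∃ b, τ = some b ∧ b.1 ≠ S.bot ∧ (b.2 = .one → ex ≠ some b))
    (hT : TopOK T u ex) (hu : NodeWord T u)
    (ih : ∀ {b : Γ × Level} {ρ p o'}, labelAt l [] = some (some b) →
      (Derives (nodeTrans S) {none}
          (some (ρ, wordStateOf S (u ++ [freshLetter b T.length u.length]), p, o'))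
          (annotate (l.map Sum.inr) fun d => some (f (false :: d))) ↔
        labelAt l [] = some ρ ∧ f [false] = p ∧ CertifiesFrom S l (fun d => f (false :: d)) T
          (u ++ [freshLetter b T.length u.length]) o')) :
    (∃ s₀, LeftTrans S (wordStateOf S u) (f []) o s₀ ∧ Derives (nodeTrans S) {none} s₀
        (annotate (l.map Sum.inr) fun d => some (f (false :: d)))) ↔
      ((f [], T ++ [u]) :: preorder S.bot l (fun d => f (false :: d)) T
          (u ++ [leftLetter S.bot l T.length u.length])).IsChain (Segment S) ∧
        ∃ c, ((f [], T ++ [u]) :: preorder S.bot l (fun d => f (false :: d)) T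
          (u ++ [leftLetter S.bot l T.length u.length])).getLast? = some c ∧ EndsWith S c u o := by
  by_cases hl0 : l = .nil
  · subst hl0
    have h0 : ∀ s₀, Derives (nodeTrans S) {none} s₀ (annotate
        ((.nil : BinaryTree (Option (Γ × Level))).map Sum.inr) fun d => some (f (false :: d))) ↔
          s₀ = none := fun s₀ => Iff.rfl
    simp only [h0, exists_eq_right, preorder, List.isChain_singleton, List.getLast?_singleton,
      Option.some.injEq, true_and, exists_eq_left']
    rcases o with q | g
    · rfl
    · exact (endsWith_leaf_iff hu).symm
  obtain ⟨τ, hτ⟩ := Option.ne_none_iff_exists'.1 (mt labelAt_root_eq_none_iff.1 hl0)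
  obtain ⟨b, rfl, hb0, hb⟩ := hl τ hτ
  rw [leftLetter_of_label hτ]
  obtain ⟨q, hq⟩ := getLast?_preorder (bot := S.bot) hl0 (fun d => f (false :: d)) T
    (u ++ [freshLetter b T.length u.length])
  obtain ⟨T', x, hst, -⟩ := exists_stackOf_eq (bot := S.bot) hl0 T
    (u ++ [freshLetter b T.length u.length])
  have hlen := length_lt_length_blockOf (bot := S.bot) l T u
  rw [blockOf_of_ne_nil hl0, leftLetter_of_label hτ] at hlen
  have hhead := head?_preorder (bot := S.bot) hl0 (fun d => f (false :: d)) T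
    (u ++ [freshLetter b T.length u.length])
  have hpush := segment_push_iff' (S := S) (p := f []) (q := f [false]) hu
    (isMilestone_push fun w hw => hT.not_prefix hb u.length hw)
  -- the states at the left child that agree with its label and with the letter it stands for
  have key : (∃ s₀, LeftTrans S (wordStateOf S u) (f []) o s₀ ∧ Derives (nodeTrans S) {none} s₀
        (annotate (l.map Sum.inr) fun d => some (f (false :: d)))) ↔
      ∃ o₀, (∃ p', PushStep S (f []) (wordStateOf S u).1.1 b p' ∧
          Loop S ((wordStateOf S u).ret S) p' [b] (f [false])) ∧
        (match o with
          | .inl q => o₀ = .inl q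
          | .inr g => ∃ g₁ g', o₀ = .inr g₁ ∧ PopStep S g₁ b g' ∧ (wordStateOf S u).2.2 g' g) ∧
        CertifiesFrom S l (fun d => f (false :: d)) T
          (u ++ [freshLetter b T.length u.length]) o₀ := by
    constructor
    · rintro ⟨_ | ⟨ρ, W₀, p₀, o₀⟩, h1, h2⟩
      · rw [derives_none_iff] at h2
        exact absurd h2 hl0
      · obtain ⟨b', rfl, rfl, h1, h3⟩ := h1
        obtain rfl : b = b' := by
          cases l with
          | nil => exact absurd rfl hl0
          | node a l r =>
            obtain ⟨_, _, ⟨_, _, _, _, _, _, _, hx, -⟩, -⟩ := h2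
            simp only [Prod.mk.injEq, Option.some.injEq, Sum.inr.injEq] at hx
            rw [labelAt, hx.2.1.1, ← hx.1.1] at hτ
            simpa using hτ.symm
        rw [← wordStateOf_push hu.ne_nil b T.length u.length, ih hτ] at h2
        obtain ⟨-, rfl, h2⟩ := h2
        exact ⟨o₀, h1, h3, h2⟩
    · rintro ⟨o₀, h1, h3, h2⟩
      exact ⟨some (some b, _, f [false], o₀), ⟨b, rfl, wordStateOf_push hu.ne_nil b _ _, h1, h3⟩,
        (ih hτ).2 ⟨hτ, rfl, h2⟩⟩
  rw [key, List.isChain_cons, hhead, ← hpush, List.getLast?_cons, hq]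
  simp only [CertifiesFrom, hq, Option.mem_def, Option.some.injEq, exists_eq_left',
    Option.getD_some, forall_eq']
  have hend : (∃ o₀, (match o with
          | .inl q => o₀ = .inl q
          | .inr g => ∃ g₁ g', o₀ = .inr g₁ ∧ PopStep S g₁ b g' ∧ (wordStateOf S u).2.2 g' g) ∧
        EndsWith S (q, stackOf S.bot l T (u ++ [freshLetter b T.length u.length]))
          (u ++ [freshLetter b T.length u.length]) o₀) ↔
      EndsWith S (q, stackOf S.bot l T (u ++ [freshLetter b T.length u.length])) u o := by
    rcases o with q' | g
    · simp only [exists_eq_left]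
      rfl
    · refine Iff.trans ?_ (endsWith_pop_iff hst hu hlen).symm
      constructor
      · rintro ⟨_, ⟨g₁, g', rfl, h1, h2⟩, h3⟩
        exact ⟨g₁, g', h3, h1, h2⟩
      · rintro ⟨g₁, g', h3, h1, h2⟩
        exact ⟨_, ⟨g₁, g', rfl, h1, h2⟩, h3⟩
  rw [← hend]
  constructor
  · rintro ⟨o₀, h1, h2, h3, h4⟩
    exact ⟨⟨h1, h3⟩, o₀, h2, h4⟩
  · rintro ⟨⟨h1, h3⟩, o₀, h2, h4⟩
    exact ⟨o₀, h1, h2, h3, h4⟩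

/-- The runs of the automaton on a subtree are the certificates, restricted to the subtree. -/
theorem derives_nodeTrans_iff {t : BinaryTree (Option (Γ × Level))} {ex : Option (Γ × Level)}
    (h : ValidTree S.bot ex t) {f : List Bool → Q} {T : Stack Γ} {u : List (Letter Γ)}
    (hT : TopOK T u ex) (hu : NodeWord T u) {ρ : Option (Γ × Level)} {p : Q} {o : Q ⊕ Q} :
    Derives (nodeTrans S) {none} (some (ρ, wordStateOf S u, p, o))
        (annotate (t.map Sum.inr) fun d => some (f d)) ↔
      labelAt t [] = some ρ ∧ f [] = p ∧ CertifiesFrom S t f T u o := by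
  induction t generalizing ex f T u ρ p o with
  | nil => simp [BinaryTree.map, annotate, Derives, labelAt]
  | node a l r ihl ihr =>
    obtain ⟨h1, h2, h3, h4⟩ := h
    have hleft := fun o => exists_leftTrans_iff (f := f) (o := o) h1 hT hu fun {b ρ p o'} hb =>
      ihl (f := fun d => f (false :: d)) h3
        (by
          obtain ⟨b', hb', -, hb1⟩ := h1 _ hb
          obtain rfl : b = b' := by simpa using hb'
          exact hT.left hb1 u.length none)
        (hu.left b)
    have hright : ∀ {ρ p o'}, _ := fun {ρ p o'} =>
      ihr (f := fun d => f (true :: d)) (T := blockOf S.bot l T u) (u := u) (ρ := ρ) (p := p)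
        (o := o') h4 (topOK_blockOf fun τ hτ => (h1 τ hτ).imp fun _ h => h.1)
        (hu.mono (length_lt_length_blockOf _ _ _).le)
    have hnode : Derives (nodeTrans S) {none} (some (ρ, wordStateOf S u, p, o))
          (annotate ((BinaryTree.node a l r).map Sum.inr) fun d => some (f d)) ↔
        a = ρ ∧ f [] = p ∧ ∃ o',
          (∃ s₀, LeftTrans S (wordStateOf S u) (f []) o' s₀ ∧ Derives (nodeTrans S) {none} s₀
            (annotate (l.map Sum.inr) fun d => some (f (false :: d)))) ∧
          ∃ s₁, RightTrans (wordStateOf S u) o o' s₁ ∧ Derives (nodeTrans S) {none} s₁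
            (annotate (r.map Sum.inr) fun d => some (f (true :: d))) := by
      simp only [BinaryTree.map, annotate, Derives]
      constructor
      · rintro ⟨s₀, s₁, ⟨ρ', W, p', o₁, o', s₀', s₁', hx, hl, hr⟩, h5, h6⟩
        simp only [Prod.mk.injEq, Option.some.injEq, Sum.inr.injEq] at hx
        obtain ⟨⟨rfl, rfl, rfl, rfl⟩, ⟨rfl, rfl⟩, rfl, rfl⟩ := hx
        exact ⟨rfl, rfl, o', ⟨s₀, hl, h5⟩, s₁, hr, h6⟩
      · rintro ⟨rfl, rfl, o', ⟨s₀, hl, h5⟩, s₁, hr, h6⟩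
        exact ⟨s₀, s₁, ⟨_, _, _, _, o', _, _, rfl, hl, hr⟩, h5, h6⟩
    rw [hnode]
    simp only [hleft, labelAt, Option.some.injEq]
    refine and_congr_right fun _ => and_congr_right fun _ => ?_
    rw [CertifiesFrom, preorder, List.isChain_append]
    obtain ⟨q, hq⟩ := getLast?_block (bot := S.bot) l f T u
    simp only [List.getLast?_append, hq, Option.some.injEq, exists_eq_left', Option.mem_def,
      forall_eq']
    by_cases hr : r = .nil
    · subst hr
      have hs : ∀ o', (∃ s₁, RightTrans (wordStateOf S u) o o' s₁ ∧
          Derives (nodeTrans S) {none} s₁ (annotate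
            ((.nil : BinaryTree (Option (Γ × Level))).map Sum.inr)
              fun d => some (f (true :: d)))) ↔ o' = o := by
        intro o'
        refine ⟨?_, fun h => ⟨none, h, rfl⟩⟩
        rintro ⟨s₁, h1, rfl⟩
        exact h1
      simp only [hs, exists_eq_right]
      simp [preorder]
    · obtain ⟨ε, hε⟩ := Option.ne_none_iff_exists'.1 (mt labelAt_root_eq_none_iff.1 hr)
      obtain rfl := h2 ε hε
      obtain ⟨q', hq'⟩ := getLast?_preorder (bot := S.bot) hr (fun d => f (true :: d))
        (blockOf S.bot l T u) u
      have hs : ∀ o', (∃ s₁, RightTrans (wordStateOf S u) o o' s₁ ∧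
          Derives (nodeTrans S) {none} s₁ (annotate (r.map Sum.inr)
            fun d => some (f (true :: d)))) ↔
          o' = .inr (f [true]) ∧
            CertifiesFrom S r (fun d => f (true :: d)) (blockOf S.bot l T u) u o := by
        intro o'
        constructor
        · rintro ⟨_ | ⟨ρ, W₁, p₁, o₁⟩, h5, h6⟩
          · rw [derives_none_iff] at h6
            exact absurd h6 hr
          · obtain ⟨rfl, rfl, rfl, rfl⟩ := h5
            obtain ⟨-, rfl, h7⟩ := hright.1 h6
            exact ⟨rfl, h7⟩
        · rintro ⟨rfl, h6⟩
          exact ⟨some (none, wordStateOf S u, f [true], o), ⟨rfl, rfl, rfl, rfl⟩,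
            hright.2 ⟨hε, rfl, h6⟩⟩
      simp only [hs, head?_preorder hr, CertifiesFrom, hq', Option.some.injEq, exists_eq_left',
        forall_eq', Option.some_or, EndsWith]
      constructor
      · rintro ⟨o', ⟨h5, h6⟩, rfl, h7, h8⟩
        exact ⟨⟨h5, h7, h6⟩, h8⟩
      · rintro ⟨⟨h5, h7, h6⟩, h8⟩
        exact ⟨_, ⟨h5, h6⟩, rfl, h7, h8⟩

end NodeAutomaton

section Certificates

variable {Γ Q : Type*} {S : CPS Γ Q}

/-! ### Certificates as chains of segments -/

theorem Path.isStack {c c' : Q × Stack Γ} {l : List (Q × Stack Γ)} (h : Path S c l c')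
    (hc : IsStack S.bot c.2) : ∀ e ∈ c :: l, IsStack S.bot e.2 := by
  induction h with
  | refl => simpa using hc
  | cons hs _ ih =>
    obtain ⟨_, op, _, _, h⟩ := hs
    exact List.forall_mem_cons.2 ⟨hc, ih (.step op hc h)⟩

theorem reachable_iff_exists_path {c : Q × Stack Γ} :
    c ∈ S.reachable ↔ ∃ l, Path S S.initialConfig l c := by
  constructor
  · intro h
    induction h with
    | refl => exact ⟨[], .refl _⟩
    | tail _ hs ih =>
      obtain ⟨l, hl⟩ := ih
      exact ⟨_, hl.append (.cons hs (.refl _))⟩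
  · rintro ⟨l, hl⟩
    have : ∀ {c c' l}, Path S c l c' → Relation.ReflTransGen S.Step c c' := by
      intro c c' l h
      induction h with
      | refl => exact .refl
      | cons hs _ ih => exact .head hs ih
    exact this hl

theorem IsStack.above {bot : Γ} {s : Stack Γ} (hs : IsStack bot s) :
    Above [] [(bot, .one, 0)] s := by
  obtain ⟨h, h0⟩ := hs.stackOK
  obtain ⟨w, r, rfl⟩ := List.exists_cons_of_ne_nil h0
  obtain ⟨v, rfl⟩ := (h [] w (by simp)).head
  exact ⟨v, r, rfl⟩

/-- The runs from the initial configuration to the initial stack are loops, as every stack begins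
with `⊥`. -/
theorem loop_init_iff {p : Q} : Loop S (returnBase S []) S.init [(S.bot, .one)] p ↔
    ∃ l, Path S S.initialConfig l (p, initialStack S.bot) := by
  have h := loop_iff_exists_run (S := S) (T := []) (v := []) (d := (S.bot, .one, 0))
    (p := S.init) (q := p) (by simp [LinksLT])
  refine Iff.trans h ⟨?_, ?_⟩
  · rintro ⟨n, hn⟩
    obtain ⟨l, hl, -⟩ := hn.path (above_self _ _)
    exact ⟨l, hl⟩
  · rintro ⟨l, hl⟩
    have hst := fun e he => (hl.isStack IsStack.init e he).above
    exact ⟨_, hl.runIn (hst _ (by simp)) fun e he => hst e (List.mem_cons_of_mem _ he)⟩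

theorem topOK_nil (u : List (Letter Γ)) (ex : Option (Γ × Level)) : TopOK [] u ex := by
  simp [TopOK]

theorem StackTree.pairwise_preorder {bot : Γ} {t : BinaryTree (Option (Γ × Level))}
    (h : StackTree bot t) (f : List Bool → Q) :
    (preorder bot t f [] [(bot, .one, 0)]).Pairwise fun c d =>
      IsMilestone c.2 d.2 ∧ c.2 ≠ d.2 := by
  let R : Q × Stack Γ → Q × Stack Γ → Prop := fun c d => IsMilestone c.2 d.2 ∧ c.2 ≠ d.2
  have : Trans R R R :=
    ⟨fun h h' => ⟨h.1.trans h'.1, fun e => h.2 (h.1.antisymm (e ▸ h'.1))⟩⟩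
  exact List.isChain_iff_pairwise (R := R).1 (isChain_preorder h.2 f (topOK_nil _ _))

theorem StackTree.exists_preorder_eq {bot : Γ} {t : BinaryTree (Option (Γ × Level))}
    (h : StackTree bot t) (f : List Bool → Q) :
    ∃ cs, preorder bot t f [] [(bot, .one, 0)] = (f [], initialStack bot) :: cs := by
  cases t with
  | nil => exact absurd rfl h.ne_nil
  | node => exact ⟨_, rfl⟩

/-- The left stacks of a tree are milestones of its stack. -/
theorem StackTree.isMilestone_last {bot : Γ} {t : BinaryTree (Option (Γ × Level))}
    (h : StackTree bot t) {f : List Bool → Q} {c : Q × Stack Γ}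
    (hc : c ∈ preorder bot t f [] [(bot, .one, 0)]) : IsMilestone c.2 (rootStack bot t) := by
  obtain ⟨q, hq⟩ := getLast?_preorder (bot := bot) h.ne_nil f [] [(bot, .one, 0)]
  obtain ⟨cs, hcs⟩ := List.getLast?_eq_some_iff.1 hq
  have hp := h.pairwise_preorder f
  rw [hcs] at hp hc
  rcases List.mem_append.1 hc with hc | hc
  · exact ((List.pairwise_append.1 hp).2.2 c hc _ (List.mem_singleton_self _)).1
  · obtain rfl : c = _ := by simpa using hc
    exact .refl h.isStack.stackOK.2

theorem StackTree.isMilestone_first {bot : Γ} {t : BinaryTree (Option (Γ × Level))}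
    (h : StackTree bot t) {f : List Bool → Q} {c : Q × Stack Γ}
    (hc : c ∈ preorder bot t f [] [(bot, .one, 0)]) : IsMilestone (initialStack bot) c.2 := by
  obtain ⟨cs, hcs⟩ := h.exists_preorder_eq f
  have hp := h.pairwise_preorder f
  rw [hcs] at hp hc
  rcases List.mem_cons.1 hc with rfl | hc
  · exact .refl (by simp [initialStack])
  · exact ((List.pairwise_cons.1 hp).1 c hc).1

/-- A run with the prescribed last visits of the left stacks is composed of a run to the initial
stack and of segments between consecutive left stacks. -/
theorem exists_lastVisit_iff {t : BinaryTree (Option (Γ × Level))} (ht : StackTree S.bot t)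
    {f : List Bool → Q} {q : Q} :
    (∃ l, Path S S.initialConfig l (q, rootStack S.bot t) ∧ ∀ d ∈ dom t,
        LastVisit S S.initialConfig l (q, rootStack S.bot t)
          (f d, rootStack S.bot (cut t d))) ↔
      (∃ l, Path S S.initialConfig l (f [], initialStack S.bot)) ∧
        CertifiesFrom S t f [] [(S.bot, .one, 0)] (.inl q) := by
  obtain ⟨cs, hcs⟩ := ht.exists_preorder_eq f
  obtain ⟨q', hq'⟩ := getLast?_preorder (bot := S.bot) ht.ne_nil f [] [(S.bot, .one, 0)]
  have hp := ht.pairwise_preorder f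
  have hmem : ∀ (P : Q × Stack Γ → Prop), (∀ d ∈ dom t, P (f d, rootStack S.bot (cut t d))) ↔
      ∀ c ∈ preorder S.bot t f [] [(S.bot, .one, 0)], P c := by
    intro P
    simp only [mem_preorder_iff]
    constructor
    · rintro h _ ⟨d, hd, rfl⟩
      exact h d hd
    · exact fun h d hd => h _ ⟨d, hd, rfl⟩
  have hlast : ∀ c ∈ preorder S.bot t f [] [(S.bot, .one, 0)],
      IsMilestone c.2 (rootStack S.bot t) := fun c hc => ht.isMilestone_last hc
  simp only [hmem, CertifiesFrom, hq', Option.some.injEq, exists_eq_left', EndsWith]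
  have hq'mem := List.mem_of_getLast? hq'
  rw [hcs] at hp hlast hq' hq'mem ⊢
  constructor
  · rintro ⟨l, hl, hv⟩
    obtain ⟨l₁, l₂, rfl, h1, h2, h3⟩ := hv _ List.mem_cons_self
    refine ⟨⟨l₁, h1⟩, ?_, ?_⟩
    · refine isChain_segment_of_lastVisit h2 h3 hp
        (fun d hd => hlast d (List.mem_cons_of_mem _ hd)) fun d hd => ?_
      have h4 := (List.pairwise_cons.1 hp).1 d hd
      exact (hv d (List.mem_cons_of_mem _ hd)).of_append h1 h2 h4.1 h4.2
        (hlast d (List.mem_cons_of_mem _ hd))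
    · obtain ⟨m₁, m₂, -, -, h4, h5⟩ := hv _ hq'mem
      rcases List.mem_cons.1 h4.mem with h6 | h6
      · exact (congrArg Prod.fst h6).symm
      · exact (h5 (q, rootStack S.bot t) h6 rfl).elim
  · rintro ⟨⟨l₁, h1⟩, h2, rfl⟩
    obtain ⟨l, e, he, hl, -, -, hv⟩ := exists_path_of_isChain (S := S)
      (c := (f [], initialStack S.bot)) (cs := cs) (by simp [initialStack])
      (List.isChain_iff_getElem.2 fun i hi => ⟨List.isChain_iff_getElem.1 h2 i hi,
        (List.isChain_iff_getElem.1 hp.isChain i hi).1⟩)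
    rw [hq'] at he
    obtain rfl : (q', rootStack S.bot t) = e := by simpa [rootStack] using he
    refine ⟨l₁ ++ l, h1.append hl, fun d hd => ?_⟩
    obtain ⟨m₁, m₂, rfl, h3, h4, h5⟩ := hv d hd
    exact ⟨l₁ ++ m₁, m₂, by simp, h1.append h3, h4, h5⟩

theorem labelAt_map {α β : Type*} (φ : α → β) (t : BinaryTree α) (d : List Bool) :
    labelAt (t.map φ) d = (labelAt t d).map φ := by
  induction t generalizing d with
  | nil => rfl
  | node a l r ihl ihr =>
    rcases d with _ | ⟨_ | _, d⟩
    · rfl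
    · exact ihl d
    · exact ihr d

variable [DecidableEq Γ]

theorem mem_position_iff {c : Q × Stack Γ} {d : List Bool} :
    d ∈ dom (S.encode c) ∧ d ≠ [] ↔ ∃ e ∈ dom (S.encodeStack c.2), d = false :: e := by
  rcases d with _ | ⟨_ | _, d⟩ <;> simp [dom, CPS.encode, labelAt, labelAt_map]

theorem exists_eq_tail {c : Q × Stack Γ} (f : S.Position c → Q) :
    ∃ F : List Bool → Q, f = fun d => F d.1.tail := by
  have h : ∀ e, ∃ q, ∀ h : false :: e ∈ dom (S.encode c) ∧ false :: e ≠ [], f ⟨_, h⟩ = q := by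
    intro e
    by_cases h : false :: e ∈ dom (S.encode c) ∧ false :: e ≠ []
    · exact ⟨f ⟨_, h⟩, fun _ => rfl⟩
    · exact ⟨S.init, fun h' => absurd h' h⟩
  choose F hF using h
  refine ⟨F, funext fun ⟨d, hd⟩ => ?_⟩
  obtain ⟨e, -, rfl⟩ := mem_position_iff.1 hd
  exact hF e hd

theorem encodeWith_tail (c : Q × Stack Γ) (F : List Bool → Q) :
    S.encodeWith c (fun d => F d.1.tail) = .node (.inl c.1, none)
      (annotate ((S.encodeStack c.2).map Sum.inr) fun d => some (F d)) .nil := by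
  classical
  rw [CPS.encodeWith, CPS.encode, annotate, annotate]
  congr 1
  · simp
  refine annotate_congr fun d hd => ?_
  replace hd : (labelAt _ d).isSome := hd
  rw [labelAt_map, Option.isSome_map] at hd
  exact dif_pos (mem_position_iff.2 ⟨d, hd, rfl⟩)

theorem isCertificate_tail_iff {q : Q} {s : Stack Γ} (hs : IsStack S.bot s) (F : List Bool → Q) :
    S.IsCertificate (q, s) (fun d => F d.1.tail) ↔
      (∃ l, Path S S.initialConfig l (F [], initialStack S.bot)) ∧
        CertifiesFrom S (S.encodeStack s) F [] [(S.bot, .one, 0)] (.inl q) := by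
  obtain ⟨h1, h2⟩ := rootStack_encodeStack S hs
  rw [CPS.isCertificate_iff, ← exists_lastVisit_iff h2, h1]
  refine exists_congr fun l => and_congr_right fun _ => ?_
  constructor
  · intro h d hd
    have := h ⟨false :: d, mem_position_iff.2 ⟨d, hd, rfl⟩⟩
    rwa [leftStack_eq S hs] at this
  · rintro h ⟨d, hd⟩
    obtain ⟨e, he, rfl⟩ := mem_position_iff.1 hd
    rw [leftStack_eq S hs]
    exact h e he

/-- The reachable configurations are those with a certificate. -/
theorem reachable_iff_exists_certificate {c : Q × Stack Γ} :
    c ∈ S.reachable ↔ IsStack S.bot c.2 ∧ ∃ F : List Bool → Q,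
      (∃ l, Path S S.initialConfig l (F [], initialStack S.bot)) ∧
        CertifiesFrom S (S.encodeStack c.2) F [] [(S.bot, .one, 0)] (.inl c.1) := by
  rw [reachable_iff_exists_path]
  constructor
  · rintro ⟨l, hl⟩
    have hs := hl.isStack IsStack.init c hl.mem
    obtain ⟨h1, h2⟩ := rootStack_encodeStack S hs
    refine ⟨hs, ?_⟩
    simp only [← exists_lastVisit_iff h2, h1]
    have hv : ∀ d, ∃ q, d ∈ dom (S.encodeStack c.2) → LastVisit S S.initialConfig l c
        (q, rootStack S.bot (cut (S.encodeStack c.2) d)) := by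
      intro d
      by_cases hd : d ∈ dom (S.encodeStack c.2)
      · have hm := mem_preorder_iff (bot := S.bot) (f := fun _ => S.init) (T := [])
          (u := [(S.bot, .one, 0)]).2 ⟨d, hd, rfl⟩
        have h3 := h2.isMilestone_last hm
        rw [h1] at h3
        rcases hl.lastVisit_or h3 with ⟨q, hq⟩ | h4
        · exact ⟨q, fun _ => hq⟩
        -- The left stack cannot be a milestone of the initial stack other than itself.
        · obtain ⟨h4, h5⟩ := h4 _ List.mem_cons_self
          exact absurd ((h2.isMilestone_first hm).antisymm h4) h5
      · exact ⟨S.init, fun h => absurd h hd⟩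
    choose F hF using hv
    exact ⟨F, l, hl, hF⟩
  · rintro ⟨hs, F, hF⟩
    obtain ⟨h1, h2⟩ := rootStack_encodeStack S hs
    rw [← exists_lastVisit_iff h2, h1] at hF
    obtain ⟨l, hl, -⟩ := hF
    exact ⟨l, hl⟩

end Certificates

/-! ### The automata for encodings of configurations -/

section Root

variable {α σ : Type*}

/-- The transitions of an automaton with the additional state `none`, which is used at the root
only, with the label and the states at the children given by `R`. -/
def withRoot (R : Set (α × σ × σ)) (trans : Set (σ × α × σ × σ)) :
    Set (Option σ × α × Option σ × Option σ) :=
  {x | ∃ a p₀ p₁, x.2 = (a, some p₀, some p₁) ∧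
    ((x.1 = none ∧ (a, p₀, p₁) ∈ R) ∨ ∃ p, x.1 = some p ∧ (p, a, p₀, p₁) ∈ trans)}

theorem derives_withRoot_some_iff {R : Set (α × σ × σ)} {trans : Set (σ × α × σ × σ)}
    {final : Set σ} {p : σ} {t : BinaryTree α} :
    Derives (withRoot R trans) (some '' final) (some p) t ↔ Derives trans final p t := by
  induction t generalizing p with
  | nil => simp [Derives]
  | node a l r ihl ihr =>
    simp only [Derives]
    constructor
    · rintro ⟨_, _, ⟨_, p₀, p₁, ⟨⟩, ⟨⟨⟩, -⟩ | ⟨_, ⟨⟩, h⟩⟩, h1, h2⟩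
      exact ⟨p₀, p₁, h, ihl.1 h1, ihr.1 h2⟩
    · rintro ⟨p₀, p₁, h, h1, h2⟩
      exact ⟨_, _, ⟨a, p₀, p₁, rfl, .inr ⟨p, rfl, h⟩⟩, ihl.2 h1, ihr.2 h2⟩

theorem derives_withRoot_none_iff {R : Set (α × σ × σ)} {trans : Set (σ × α × σ × σ)}
    {final : Set σ} {t : BinaryTree α} :
    Derives (withRoot R trans) (some '' final) none t ↔
      ∃ a l r p₀ p₁, t = .node a l r ∧ (a, p₀, p₁) ∈ R ∧ Derives trans final p₀ l ∧
        Derives trans final p₁ r := by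
  cases t with
  | nil => simp [Derives]
  | node a l r =>
    simp only [Derives]
    constructor
    · rintro ⟨_, _, ⟨_, p₀, p₁, ⟨⟩, ⟨-, h⟩ | ⟨_, ⟨⟩, -⟩⟩, h1, h2⟩
      exact ⟨a, l, r, p₀, p₁, rfl, h, derives_withRoot_some_iff.1 h1,
        derives_withRoot_some_iff.1 h2⟩
    · rintro ⟨_, _, _, p₀, p₁, ⟨⟩, h, h1, h2⟩
      exact ⟨_, _, ⟨a, p₀, p₁, rfl, .inl ⟨rfl, h⟩⟩, derives_withRoot_some_iff.2 h1,
        derives_withRoot_some_iff.2 h2⟩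

/-- Automata with states in an arbitrary finite type may use an additional state at the root. -/
theorem exists_treeAutomaton_withRoot [Finite σ] (R : Set (α × σ × σ))
    (trans : Set (σ × α × σ × σ)) (final : Set σ) :
    ∃ A : TreeAutomaton α, ∀ t, A.Accepts t ↔ ∃ a l r p₀ p₁, t = .node a l r ∧
      (a, p₀, p₁) ∈ R ∧ Derives trans final p₀ l ∧ Derives trans final p₁ r := by
  obtain ⟨A, hA⟩ := exists_treeAutomaton {none} (withRoot R trans) (some '' final)
  refine ⟨A, fun t => (hA t).trans ?_⟩
  simp only [Set.mem_singleton_iff, exists_eq_left, derives_withRoot_none_iff]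

end Root

section Validity

variable {Γ Q : Type*}

/-- The transitions of an automaton that checks `ValidTree`. A state consists of the label of the
root (or `none`, if the tree is empty) and the label that is excluded at its left child. -/
def validTrans (Q : Type*) (bot : Γ) :
    Set ((Option (Option (Γ × Level)) × Option (Γ × Level)) × ConfigLabel Γ Q ×
      (Option (Option (Γ × Level)) × Option (Γ × Level)) ×
      (Option (Option (Γ × Level)) × Option (Γ × Level))) :=
  {x | ∃ ρ ex l r, x = ((some ρ, ex), .inr ρ, (l, none), (r, l.join)) ∧
    (∀ τ, l = some τ → ∃ b, τ = some b ∧ b.1 ≠ bot ∧ (b.2 = .one → ex ≠ some b)) ∧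
    ∀ τ, r = some τ → τ = none}

theorem derives_validTrans_iff {bot : Γ} {t : BinaryTree (ConfigLabel Γ Q)}
    {a : Option (Option (Γ × Level))} {ex : Option (Γ × Level)} :
    Derives (validTrans Q bot) {x | x.1 = none} (a, ex) t ↔
      ∃ t', t = t'.map Sum.inr ∧ labelAt t' [] = a ∧ ValidTree bot ex t' := by
  induction t generalizing a ex with
  | nil =>
    constructor
    · rintro (rfl : a = none)
      exact ⟨.nil, rfl, rfl, trivial⟩
    · rintro ⟨_ | ⟨_, _, _⟩, h, rfl, -⟩
      · exact rfl
      · cases h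
  | node c l r ihl ihr =>
    simp only [Derives]
    constructor
    · rintro ⟨_, _, ⟨ρ, _, a₀, a₁, ⟨⟩, h1, h2⟩, h3, h4⟩
      obtain ⟨l', rfl, rfl, h5⟩ := ihl.1 h3
      obtain ⟨r', rfl, rfl, h6⟩ := ihr.1 h4
      exact ⟨.node ρ l' r', rfl, rfl, h1, h2, h5, h6⟩
    · rintro ⟨_ | ⟨ρ, l', r'⟩, ⟨⟩, rfl, h1, h2, h3, h4⟩
      exact ⟨_, _, ⟨ρ, ex, _, _, rfl, h1, h2⟩, ihl.2 ⟨l', rfl, rfl, h3⟩,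
        ihr.2 ⟨r', rfl, rfl, h4⟩⟩

variable {S : CPS Γ Q}

theorem isSome_of_derives_nodeTrans {t : BinaryTree (ConfigLabel Γ Q)}
    {g : List Bool → Option Q} {s : NodeState Γ Q}
    (h : Derives (nodeTrans S) {none} s (annotate t g)) : ∀ d ∈ dom t, (g d).isSome := by
  induction t generalizing g s with
  | nil => simp [dom, labelAt]
  | node a l r ihl ihr =>
    obtain ⟨s₀, s₁, ⟨_, _, p, _, _, _, _, hx, -⟩, h0, h1⟩ := h
    simp only [Prod.mk.injEq] at hx
    rintro (_ | ⟨_ | _, d⟩) hd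
    · rw [hx.2.1.2]
      rfl
    · exact ihl h0 d hd
    · exact ihr h1 d hd

/-- The annotations that are accepted are total functions on the domain. -/
theorem exists_derives_annotate_iff {t : BinaryTree (ConfigLabel Γ Q)} {s : NodeState Γ Q} :
    (∃ g, Derives (nodeTrans S) {none} s (annotate t g)) ↔
      ∃ F : List Bool → Q, Derives (nodeTrans S) {none} s (annotate t fun d => some (F d)) := by
  constructor
  · rintro ⟨g, h⟩
    refine ⟨fun d => (g d).getD S.init, ?_⟩
    rwa [annotate_congr (g' := g) fun d hd => ?_]
    obtain ⟨q, hq⟩ := Option.isSome_iff_exists.1 (isSome_of_derives_nodeTrans h d hd)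
    simp [hq]
  · rintro ⟨F, h⟩
    exact ⟨_, h⟩

instance : Finite Level :=
  Finite.of_injective (fun | .one => true | .two => false : Level → Bool)
    (by rintro (_ | _) (_ | _) h <;> first | rfl | cases h)

/-- The state at the root of the encoding of a stack, if the run is in state `p` at the last visit
of the initial stack and ends in state `q`. -/
def rootState (S : CPS Γ Q) (p q : Q) : NodeState Γ Q :=
  some (some (S.bot, .one), wordState S (S.bot, .one) [], p, .inl q)

theorem exists_derives_rootState_iff {t : BinaryTree (Option (Γ × Level))}
    (ht : StackTree S.bot t) {F : List Bool → Q} {q : Q} :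
    (∃ p, Loop S (returnBase S []) S.init [(S.bot, .one)] p ∧
        Derives (nodeTrans S) {none} (rootState S p q)
          (annotate (t.map Sum.inr) fun d => some (F d))) ↔
      (∃ l, Path S S.initialConfig l (F [], initialStack S.bot)) ∧
        CertifiesFrom S t F [] [(S.bot, .one, 0)] (.inl q) := by
  have hu : NodeWord [] [(S.bot, Level.one, 0)] :=
    ⟨by simp, by simp [LinksLT], by
      intro v a hv _
      replace hv : v ++ [a] <+: [] ++ [_] := hv
      rcases List.prefix_concat_iff.1 hv with hv | hv
      · obtain ⟨rfl, hv⟩ := List.append_inj' hv rfl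
        obtain rfl : a = _ := by simpa using hv
        rfl
      · simp at hv⟩
  have h := fun p => derives_nodeTrans_iff (S := S) ht.2 (f := F) (topOK_nil _ _) hu
    (ρ := some (S.bot, .one)) (p := p) (o := .inl q)
  simp only [ht.1, true_and] at h
  simp only [← loop_init_iff]
  constructor
  · rintro ⟨p, h1, h2⟩
    obtain ⟨rfl, h3⟩ := (h p).1 h2
    exact ⟨h1, h3⟩
  · rintro ⟨h1, h2⟩
    exact ⟨_, h1, (h _).2 ⟨rfl, h2⟩⟩

variable [DecidableEq Γ]

theorem exists_certificateAutomaton [Finite Γ] [Finite Q] (S : CPS Γ Q) :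
    ∃ A : TreeAutomaton (ConfigLabel Γ Q × Option Q), ∀ (q : Q) (s : Stack Γ), IsStack S.bot s →
      ∀ f : S.Position (q, s) → Q, A.Accepts (S.encodeWith (q, s) f) ↔ S.IsCertificate (q, s) f := by
  obtain ⟨A, hA⟩ := exists_treeAutomaton_withRoot (σ := NodeState Γ Q)
    {x : (ConfigLabel Γ Q × Option Q) × NodeState Γ Q × NodeState Γ Q |
      ∃ p q, Loop S (returnBase S []) S.init [(S.bot, .one)] p ∧
        x = ((.inl q, none), rootState S p q, none)} (nodeTrans S) {none}
  refine ⟨A, fun q s hs f => ?_⟩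
  obtain ⟨F, rfl⟩ := exists_eq_tail f
  rw [hA, encodeWith_tail, isCertificate_tail_iff hs,
    ← exists_derives_rootState_iff (rootStack_encodeStack S hs).2]
  constructor
  · rintro ⟨_, _, _, _, _, ⟨⟩, ⟨p, _, hp, ⟨⟩⟩, h, -⟩
    exact ⟨p, hp, h⟩
  · rintro ⟨p, hp, h⟩
    exact ⟨_, _, _, _, _, rfl, ⟨p, q, hp, rfl⟩, h, rfl⟩

theorem isRegularTreeLanguage_encode_reachable [Finite Γ] [Finite Q] (S : CPS Γ Q) :
    IsRegularTreeLanguage (S.encode '' S.reachable) := by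
  obtain ⟨A, hA⟩ := exists_treeAutomaton_withRoot
    {x : ConfigLabel Γ Q × (NodeState Γ Q × Option (Option (Γ × Level)) × Option (Γ × Level)) ×
        (NodeState Γ Q × Option (Option (Γ × Level)) × Option (Γ × Level)) |
      ∃ p q, Loop S (returnBase S []) S.init [(S.bot, .one)] p ∧
        x = (.inl q, (rootState S p q, some (some (S.bot, .one)), none), none, none, none)}
    (prodTrans (projTrans (nodeTrans S)) (validTrans Q S.bot)) ({none} ×ˢ {x | x.1 = none})
  refine ⟨A, fun T => (hA T).trans ?_⟩
  simp only [derives_prodTrans_iff, derives_projTrans_iff, exists_derives_annotate_iff, Prod.exists]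
  simp only [Set.mem_image, Prod.exists]
  constructor
  · rintro ⟨_, l, r, _, _, _, _, _, _, rfl, ⟨p, q, hp, ⟨⟩⟩, h1, h2⟩
    obtain ⟨⟨F, hF⟩, h1⟩ := h1
    obtain ⟨t, rfl, ht, ht'⟩ := derives_validTrans_iff.1 h1
    obtain ⟨t₁, rfl, ht₁, -⟩ := derives_validTrans_iff.1 (h2).2
    obtain rfl := labelAt_root_eq_none_iff.1 ht₁
    have hst : StackTree S.bot t := ⟨ht, ht'⟩
    refine ⟨q, rootStack S.bot t, reachable_iff_exists_certificate.2 ⟨hst.isStack, F, ?_⟩, ?_⟩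
    · rw [encodeStack_rootStack S hst, ← exists_derives_rootState_iff hst]
      exact ⟨p, hp, hF⟩
    · rw [CPS.encode, encodeStack_rootStack S hst]
      rfl
  · rintro ⟨q, s, hr, rfl⟩
    obtain ⟨hs, F, hF⟩ := reachable_iff_exists_certificate.1 hr
    have hst := (rootStack_encodeStack S hs).2
    obtain ⟨p, hp, h⟩ := (exists_derives_rootState_iff hst).2 hF
    exact ⟨_, _, _, _, _, _, _, _, _, rfl, ⟨p, q, hp, rfl⟩,
      ⟨⟨F, h⟩, derives_validTrans_iff.2 ⟨_, rfl, hst.1, hst.2⟩⟩,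
      ⟨F, rfl⟩, rfl⟩

end Validity
end CPG

theorem mainTheorem4 {Γ Q : Type*} [DecidableEq Γ] [Finite Γ] [Finite Q] (S : CPG.CPS Γ Q) :
    (∃ A : CPG.TreeAutomaton (CPG.ConfigLabel Γ Q × Option Q),
      ∀ (q : Q) (s : CPG.Stack Γ), CPG.IsStack S.bot s →
        ∀ f : S.Position (q, s) → Q,
          A.Accepts (S.encodeWith (q, s) f) ↔ S.IsCertificate (q, s) f) ∧
    CPG.IsRegularTreeLanguage (S.encode '' S.reachable) :=
  ⟨CPG.exists_certificateAutomaton S, CPG.isRegularTreeLanguage_encode_reachable S⟩
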